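/- Let $C^r$ mean smooth ($r=\infty$) or real analytic ($r=\omega$). Let $U\subset\mathbb R^2$ be open, $f:U\to\mathbb R^3$ a $C^r$ map, and $p\in U$ a generalized cuspidal edge point of $f$, i.e. the germ of $f$ at $p$ is $C^r$ right-left equivalent to the germ at $0$ of $(u,v)\mapsto(v^2,v^3\alpha(u,v),u)$ for some $C^r$ function $\alpha$. Let $T\neq\mathrm{id}$ be an isometry of $\mathbb R^3$ with $T(f(p))=f(p)$ such that $T\circ f(V)\subset f(U)$ for some neighborhood $V$ of $p$, in the sense of germs at $p$: for every neighborhood $U'\subset U$ of $p$ there is a neighborhood $V\subset U$ of $p$ with $T\circ f(V)\subset f(U')$. Notation. Near $p$ there is a $C^r$ unit normal field $\nu$ along $f$, and the singular set of $f$ near $p$ is parametrized by a regular injective $C^r$ curve $\gamma$ with $\gamma(0)=p$ (both exist; this is part of the assertion). Let $\Pi_0$ be the limiting tangent plane (through $f(p)$, perpendicular to $\nu(p)$), $\Pi_1$ the normal plane (through $f(p)$, perpendicular to the tangent line $f(p)+df_p(\mathbb R^2)$), $l_2=\Pi_0\cap\Pi_1$ the co-normal line, and $$\kappa_\nu(p)=\frac{\langle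 (f\circ\gamma)''(0),\nu(p)\rangle}{\langle (f\circ\gamma)'(0),(f\circ\gamma)'(0)\rangle}$$ the limiting normal curvature. A connecting map is a homeomorphism $\psi$ between connected open neighborhoods of $p$ in $U$ with $\psi(p)=p$ and $f\circ\psi=T\circ f$. Then, for every such $\nu$ and $\gamma$, one of the following two cases occurs: 1. $T$ is the reflection in $\Pi_0$; the image under $f$ of the singular set of $f$ in some neighborhood of $p$ lies in $\Pi_0$; and $\kappa_\nu(p)=0$. 2. $T$ is the reflection in $\Pi_1$ or the $180^\circ$-rotation about $l_2$. In addition, every connecting map $\psi$ restricts to a $C^r$ involution $\psi:W\to W$ of some connected open neighborhood $W$ of $p$, and it reverses the orientation of the singular curve: $\psi(\gamma(t))=\gamma(h(t))$ for $t$ near $0$, with $h$ continuous, strictly decreasing and $h(0)=0$. Moreover, a connecting map exists if $r=\omega$, or if $r=\infty$ and the Legendrian lift $(f,\nu)$ is injective on some neighborhood of $p$ for some $C^r$ unit normal field $\nu$ near $p$. -/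

import Mathlib

open Set Filter Topology
open scoped ContDiff

/-- The parameter plane. -/
abbrev E2 : Type := EuclideanSpace ℝ (Fin 2)

/-- Euclidean three-space. -/
abbrev E3 : Type := EuclideanSpace ℝ (Fin 3)

/-- The model germ `(u, v) ↦ (v², v³ α(u, v), u)`. -/
noncomputable def modelEdge (α : E2 → ℝ) (q : E2) : E3 :=
  !₂[(q 1) ^ 2, (q 1) ^ 3 * α q, q 0]

/-- `e` is a `C^r` diffeomorphism from its (open) source onto its (open) target. -/
def IsLocalDiffeo {E : Type*} [NormedAddCommGroup E] [NormedSpace ℝ E]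
    (r : WithTop ℕ∞) (e : OpenPartialHomeomorph E E) : Prop :=
  ContDiffOn ℝ r e e.source ∧ ContDiffOn ℝ r e.symm e.target

/-- `p` is a generalized cuspidal edge point of `f`: the germ of `f` at `p` is `C^r` right-left
equivalent to the germ at the origin of `(u, v) ↦ (v², v³ α(u, v), u)` for some `C^r` function
`α` defined near the origin. -/
def IsGeneralizedCuspidalEdgePoint (r : WithTop ℕ∞) (f : E2 → E3) (p : E2) : Prop :=
  ∃ (φ : OpenPartialHomeomorph E2 E2) (Φ : OpenPartialHomeomorph E3 E3) (α : E2 → ℝ),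
    IsLocalDiffeo r φ ∧ IsLocalDiffeo r Φ ∧ ContDiffOn ℝ r α φ.target ∧
    p ∈ φ.source ∧ φ p = 0 ∧ Φ (f p) = 0 ∧
    ∀ q ∈ φ.source, f q ∈ Φ.source ∧ Φ (f q) = modelEdge α (φ q)

/-- The set of singular points of `f : U → ℝ³` (points where `f` is not an immersion). -/
def singularSet (f : E2 → E3) (U : Set E2) : Set E2 :=
  {q ∈ U | ¬ Function.Injective (fderiv ℝ f q)}

/-- `ν` is, near `p`, a `C^r` unit normal vector field along `f`. -/
def IsUnitNormalNear (r : WithTop ℕ∞) (f : E2 → E3) (p : E2) (ν : E2 → E3) : Prop :=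
  ∃ W : Set E2, IsOpen W ∧ p ∈ W ∧ ContDiffOn ℝ r ν W ∧
    ∀ q ∈ W, ‖ν q‖ = 1 ∧ ∀ w : E2, inner ℝ (fderiv ℝ f q w) (ν q) = 0

/-- The Legendrian lift `(f, ν)` of `f` is injective on a neighborhood of `p`. -/
def LegendrianLiftInjectiveNear (r : WithTop ℕ∞) (f : E2 → E3) (p : E2) : Prop :=
  ∃ ν : E2 → E3, IsUnitNormalNear r f p ν ∧ ∃ N ∈ 𝓝 p, InjOn (fun q => (f q, ν q)) N

/-- `γ`, on some interval `(-ε, ε)`, is a `C^r` regular injective curve with `γ 0 = p` that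
parametrizes the singular set of `f : U → ℝ³` near `p`. -/
def IsSingularCurve (r : WithTop ℕ∞) (f : E2 → E3) (U : Set E2) (p : E2) (γ : ℝ → E2) : Prop :=
  ∃ ε > 0, γ 0 = p ∧ ContDiffOn ℝ r γ (Ioo (-ε) ε) ∧ InjOn γ (Ioo (-ε) ε) ∧
    (∀ t ∈ Ioo (-ε) ε, deriv γ t ≠ 0 ∧ γ t ∈ singularSet f U) ∧
    ∃ N ∈ 𝓝 p, singularSet f U ∩ N ⊆ γ '' Ioo (-ε) ε

/-- The limiting normal curvature at `γ 0`, computed from the image `f ∘ γ` of the singular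
curve and the unit normal field: `⟪(f ∘ γ)''(0), ν⟫ / ⟪(f ∘ γ)'(0), (f ∘ γ)'(0)⟫`. -/
noncomputable def limitingNormalCurvature (f : E2 → E3) (γ : ℝ → E2) (ν : E2 → E3) : ℝ :=
  inner ℝ (iteratedDeriv 2 (f ∘ γ) 0) (ν (γ 0)) /
    inner ℝ (deriv (f ∘ γ) 0) (deriv (f ∘ γ) 0)

/-- The direction of the tangent line at `p`, i.e. the image of the differential
(spanned by `f_u(p)` when `f_v(p) = 0`). -/
noncomputable def tangentDirection (f : E2 → E3) (p : E2) : Submodule ℝ E3 :=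
  LinearMap.range (fderiv ℝ f p : E2 →ₗ[ℝ] E3)

/-- The plane `Π₀` through `f p` perpendicular to `ν p`. -/
noncomputable def limitingTangentPlane (f : E2 → E3) (ν : E2 → E3) (p : E2) :
    AffineSubspace ℝ E3 :=
  AffineSubspace.mk' (f p) (ℝ ∙ ν p)ᗮ

/-- The plane `Π₁` through `f p` perpendicular to the tangent line. -/
noncomputable def normalPlane (f : E2 → E3) (p : E2) : AffineSubspace ℝ E3 :=
  AffineSubspace.mk' (f p) (tangentDirection f p)ᗮ

/-- The co-normal line `l₂ = Π₀ ∩ Π₁`: the line through `f p`, lying in the limiting tangent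
plane and perpendicular to the tangent line. -/
noncomputable def conormalLine (f : E2 → E3) (ν : E2 → E3) (p : E2) : AffineSubspace ℝ E3 :=
  AffineSubspace.mk' (f p) ((ℝ ∙ ν p)ᗮ ⊓ (tangentDirection f p)ᗮ)

theorem conormalLine_eq_inf (f : E2 → E3) (ν : E2 → E3) (p : E2) :
    conormalLine f ν p = limitingTangentPlane f ν p ⊓ normalPlane f p := by
  ext x
  simp only [conormalLine, limitingTangentPlane, normalPlane]
  rw [AffineSubspace.mem_inf_iff]
  simp only [AffineSubspace.mem_mk', Submodule.mem_inf]

/-- The reflection of `ℝ³` in the affine subspace `S`: it fixes that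
subspace pointwise and reverses the vectors orthogonal to it. -/
noncomputable def reflectionThrough (S : AffineSubspace ℝ E3) [Nonempty S] : E3 ≃ᵢ E3 :=
  (EuclideanGeometry.reflection S).toIsometryEquiv

/-- The rotation by `180°` about a line: it fixes the line pointwise and reverses the vectors
orthogonal to it, so it is Mathlib's reflection in the (one-dimensional) affine subspace. -/
noncomputable def halfTurnAbout (l : AffineSubspace ℝ E3) [Nonempty l] : E3 ≃ᵢ E3 :=
  (EuclideanGeometry.reflection l).toIsometryEquiv

instance (f : E2 → E3) (ν : E2 → E3) (p : E2) : Nonempty (limitingTangentPlane f ν p) :=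
  ⟨⟨f p, AffineSubspace.self_mem_mk' _ _⟩⟩

instance (f : E2 → E3) (p : E2) : Nonempty (normalPlane f p) :=
  ⟨⟨f p, AffineSubspace.self_mem_mk' _ _⟩⟩

instance (f : E2 → E3) (ν : E2 → E3) (p : E2) : Nonempty (conormalLine f ν p) :=
  ⟨⟨f p, AffineSubspace.self_mem_mk' _ _⟩⟩

/-- `ψ` is a connecting map at `p` between `T ∘ f` and `f`: a homeomorphism between connected open
neighborhoods of `p` in `U`, fixing `p`, with `f ∘ ψ = T ∘ f`. -/
def IsConnectingMap (f : E2 → E3) (U : Set E2) (T : E3 ≃ᵢ E3) (p : E2)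
    (ψ : OpenPartialHomeomorph E2 E2) : Prop :=
  p ∈ ψ.source ∧ ψ p = p ∧ IsConnected ψ.source ∧ ψ.source ⊆ U ∧ ψ.target ⊆ U ∧
    ∀ q ∈ ψ.source, f (ψ q) = T (f q)

/-- `ψ` maps the curve `γ` near `t = 0` to itself, reversing its orientation. -/
def ReversesCurve (ψ : E2 → E2) (γ : ℝ → E2) : Prop :=
  ∃ δ > 0, ∃ h : ℝ → ℝ, ContinuousOn h (Ioo (-δ) δ) ∧ StrictAntiOn h (Ioo (-δ) δ) ∧ h 0 = 0 ∧
    ∀ t ∈ Ioo (-δ) δ, ψ (γ t) = γ (h t)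

/-- `ψ` restricts to a `C^r` involution of a connected open neighborhood `W ⊆ S` of `p`. -/
def IsInvolutionNear (r : WithTop ℕ∞) (ψ : E2 → E2) (S : Set E2) (p : E2) : Prop :=
  ∃ W : Set E2, IsOpen W ∧ IsConnected W ∧ p ∈ W ∧ W ⊆ S ∧ MapsTo ψ W W ∧
    ContDiffOn ℝ r ψ W ∧ ∀ q ∈ W, ψ (ψ q) = q

/-! In charts `φ`, `Φ` the map `f` becomes the model g(u, v) = (v², v³α, u), and `T` becomes a germ
G carrying the image of g into itself. That image lies in a cusp x ≥ 0, y² ≤ Cx³, whose tangent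
directions at the origin fill only the half-plane x ≥ 0, y = 0. The vectors e₁ and ±e₃ are such
directions, so DG(0)e₃ = c e₃ and DG(0)e₁ = a e₁ + b e₃ with a ≥ 0. For the orthogonal linear part
of `T` this leaves no freedom but signs (`EdgeChart.exists_symmetry_frame`): the conormal direction
is fixed, the tangent direction is multiplied by c = ±1, and the normal goes to ± itself. With the
identity excluded, c = 1 is the reflection in Π₀, and c = -1 is the reflection in Π₁ or the
half-turn about l₂. In each case `T` is an involution.

An involutive G preserves the image of the singular axis (`ModelSymmetry.axis_to_axis`), because an
immersed sheet cannot be squeezed into a half-plane of directions. The induced germ on the line is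
an involution with derivative c. If c = 1, it is the identity, so `T` fixes the image of the
singular set pointwise; this image then lies in Π₀ and the limiting normal curvature vanishes. If c
= -1, the singular curve is reversed.

The first coordinate of G ∘ g is nonnegative and zero on the axis. Dividing twice by v gives v²m
with m of class C^r and m(0) > 0 (`ModelSymmetry.exists_factor`), so a point over G(g(q)) has second
coordinate ±v√m. There are thus two C^r candidate lifts. A connecting map is a homeomorphism, cannot
fold the plane, and so agrees with one candidate on both sides of the axis
(`FactoredSymmetry.eventually_eq_lift`).

For existence, each candidate has a defect, and the product of the two defects is zero. If r = ω,
the identity theorem makes one of them vanish. If the Legendrian lift is injective, the sheets of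
the model are never tangent off the axis (`EdgeChart.sheets_transverse`); the defects then have no
common critical zero on a half-disc, and connectedness selects one on each half. Different choices
on the two halves would make the sheets coincide. -/

/-! ### Averages along a path of contractions -/

section AveragedComposition

variable {E : Type} [NormedAddCommGroup E] [NormedSpace ℝ E]

theorem mapsTo_ball_of_norm_le_one {π : E →L[ℝ] E} (hπ : ‖π‖ ≤ 1) (R : ℝ) {q : E}
    (hq : q ∈ Metric.ball (0 : E) R) : π q ∈ Metric.ball (0 : E) R := by
  rw [mem_ball_zero_iff] at hq ⊢
  exact ((π.le_opNorm q).trans (mul_le_of_le_one_left (norm_nonneg q) hπ)).trans_lt hq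

theorem continuousOn_averaged_integrand {F G : Type} [NormedAddCommGroup F] [NormedSpace ℝ F]
    [NormedAddCommGroup G] [NormedSpace ℝ G] {π : ℝ → E →L[ℝ] E} (hπc : Continuous π)
    (hπ : ∀ s ∈ Icc (0 : ℝ) 1, ‖π s‖ ≤ 1) {A : ℝ → F →L[ℝ] G} (hA : Continuous A) {R : ℝ}
    {f : E → F} (hf : ContinuousOn f (Metric.ball 0 R)) {q : E} (hq : q ∈ Metric.ball (0 : E) R) :
    ContinuousOn (fun s => A s (f (π s q))) (Icc 0 1) := by
  refine hA.continuousOn.clm_apply (hf.comp ?_ fun s hs => mapsTo_ball_of_norm_le_one (hπ s hs) R hq)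
  exact (hπc.clm_apply continuous_const).continuousOn

/-- A smaller closed ball is compact and stable under contractions; the bound on it supplies the
domination for limits and derivatives under the integral. -/
theorem exists_bound_averaged_integrand [FiniteDimensional ℝ E] {F G : Type}
    [NormedAddCommGroup F] [NormedSpace ℝ F]
    [NormedAddCommGroup G] [NormedSpace ℝ G] {π : ℝ → E →L[ℝ] E}
    (hπ : ∀ s ∈ Icc (0 : ℝ) 1, ‖π s‖ ≤ 1) {A : ℝ → F →L[ℝ] G} (hA : Continuous A) {R : ℝ}
    {f : E → F} (hf : ContinuousOn f (Metric.ball 0 R)) {q : E} (hq : q ∈ Metric.ball (0 : E) R) :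
    ∃ C, ∃ S ∈ 𝓝 q, S ⊆ Metric.ball 0 R ∧
      ∀ s ∈ Icc (0 : ℝ) 1, ∀ x ∈ S, ‖A s (f (π s x))‖ ≤ C := by
  have : ProperSpace E := FiniteDimensional.proper ℝ E
  rw [mem_ball_zero_iff] at hq
  obtain ⟨R', h1, h2⟩ := exists_between hq
  have hsub : Metric.closedBall (0 : E) R' ⊆ Metric.ball 0 R := Metric.closedBall_subset_ball h2
  obtain ⟨C1, hC1⟩ := (isCompact_closedBall (0 : E) R').exists_bound_of_continuousOn (hf.mono hsub)
  obtain ⟨C2, hC2⟩ := (isCompact_Icc (a := (0 : ℝ)) (b := 1)).exists_bound_of_continuousOn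
    hA.continuousOn
  refine ⟨C2 * C1, Metric.ball 0 R', Metric.isOpen_ball.mem_nhds (by simpa using h1),
    Metric.ball_subset_closedBall.trans hsub, fun s hs x hx => ?_⟩
  have h3 := mapsTo_ball_of_norm_le_one (hπ s hs) R' hx
  have h4 := hC1 _ (Metric.ball_subset_closedBall h3)
  exact ((A s).le_opNorm _).trans
    (mul_le_mul (hC2 s hs) h4 (norm_nonneg _) ((norm_nonneg _).trans (hC2 s hs)))

/-- The derivative is written as an average of the same shape, with `fderiv ℝ f` in place of `f` and
composition with `A s` and `π s` as the new weight, so that the result can be iterated. -/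
theorem hasFDerivAt_averaged [FiniteDimensional ℝ E] {F G : Type} [NormedAddCommGroup F]
    [NormedSpace ℝ F]
    [NormedAddCommGroup G] [NormedSpace ℝ G] {π : ℝ → E →L[ℝ] E} (hπc : Continuous π)
    (hπ : ∀ s ∈ Icc (0 : ℝ) 1, ‖π s‖ ≤ 1) {A : ℝ → F →L[ℝ] G} (hA : Continuous A) {R : ℝ}
    {f : E → F} (hf : DifferentiableOn ℝ f (Metric.ball 0 R))
    (hf' : ContinuousOn (fderiv ℝ f) (Metric.ball 0 R)) {q : E} (hq : q ∈ Metric.ball (0 : E) R) :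
    HasFDerivAt (fun q => ∫ s in (0 : ℝ)..1, A s (f (π s q)))
      (∫ s in (0 : ℝ)..1, (((ContinuousLinearMap.compL ℝ E E G).flip (π s)).comp
        (ContinuousLinearMap.compL ℝ E F G (A s))) (fderiv ℝ f (π s q))) q := by
  set A' : ℝ → (E →L[ℝ] F) →L[ℝ] (E →L[ℝ] G) := fun s =>
    ((ContinuousLinearMap.compL ℝ E E G).flip (π s)).comp (ContinuousLinearMap.compL ℝ E F G (A s))
    with hA'
  have hA'c : Continuous A' := by
    simp only [hA']
    exact ((ContinuousLinearMap.continuous _).comp hπc).clm_comp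
      ((ContinuousLinearMap.continuous _).comp hA)
  have huI : uIoc (0 : ℝ) 1 ⊆ Icc 0 1 := by
    rw [uIoc_of_le zero_le_one]; exact Ioc_subset_Icc_self
  have hmeas : ∀ {H : Type} [NormedAddCommGroup H] (u : ℝ → H), ContinuousOn u (Icc 0 1) →
      MeasureTheory.AEStronglyMeasurable u (MeasureTheory.volume.restrict (uIoc (0 : ℝ) 1)) := by
    intro H _ u hu
    exact ((hu.mono huI).aestronglyMeasurable measurableSet_uIoc)
  obtain ⟨C, S, hS, hSR, hC⟩ := exists_bound_averaged_integrand hπ hA'c hf' hq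
  refine intervalIntegral.hasFDerivAt_integral_of_dominated_of_fderiv_le
    (F' := fun x s => A' s (fderiv ℝ f (π s x))) (bound := fun _ => C) hS ?_ ?_ ?_ ?_ ?_ ?_
  · filter_upwards [hS] with x hx
    exact hmeas _ (continuousOn_averaged_integrand hπc hπ hA hf.continuousOn (hSR hx))
  · refine ContinuousOn.intervalIntegrable ?_
    rw [uIcc_of_le zero_le_one]
    exact continuousOn_averaged_integrand hπc hπ hA hf.continuousOn hq
  · exact hmeas _ (continuousOn_averaged_integrand hπc hπ hA'c hf' hq)
  · exact Eventually.of_forall fun s hs x hx => hC s (huI hs) x hx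
  · simp
  · refine Eventually.of_forall fun s hs x hx => ?_
    have h1 := mapsTo_ball_of_norm_le_one (hπ s (huI hs)) R (hSR hx)
    have h2 := (hf.differentiableAt (Metric.isOpen_ball.mem_nhds h1)).hasFDerivAt
    exact (A s).hasFDerivAt.comp x (h2.comp x (π s).hasFDerivAt)

/-- Induction on the order. The spaces and the weight `A` are quantified inside because
differentiation changes them all. -/
theorem contDiffOn_averaged_nat [FiniteDimensional ℝ E] {π : ℝ → E →L[ℝ] E} (hπc : Continuous π)
    (hπ : ∀ s ∈ Icc (0 : ℝ) 1, ‖π s‖ ≤ 1) {R : ℝ} (n : ℕ) :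
    ∀ {F G : Type} [NormedAddCommGroup F] [NormedSpace ℝ F]
    [NormedAddCommGroup G] [NormedSpace ℝ G] {A : ℝ → F →L[ℝ] G} (_ : Continuous A)
    {f : E → F} (_ : ContDiffOn ℝ n f (Metric.ball 0 R)),
    ContDiffOn ℝ n (fun q => ∫ s in (0 : ℝ)..1, A s (f (π s q))) (Metric.ball 0 R) := by
  have huI : uIoc (0 : ℝ) 1 ⊆ Icc 0 1 := by
    rw [uIoc_of_le zero_le_one]; exact Ioc_subset_Icc_self
  induction n with
  | zero =>
    intro F G _ _ _ _ A hA f hf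
    have hf := hf.continuousOn
    refine contDiffOn_zero.2 fun q hq => ContinuousAt.continuousWithinAt ?_
    obtain ⟨C, S, hS, hSR, hC⟩ := exists_bound_averaged_integrand hπ hA hf hq
    refine intervalIntegral.continuousAt_of_dominated_interval (bound := fun _ => C) ?_ ?_ ?_ ?_
    · filter_upwards [hS] with x hx
      exact ((continuousOn_averaged_integrand hπc hπ hA hf (hSR hx)).mono huI).aestronglyMeasurable
        measurableSet_uIoc
    · filter_upwards [hS] with x hx
      exact Eventually.of_forall fun s hs => hC s (huI hs) x hx
    · simp
    · refine Eventually.of_forall fun s hs => ?_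
      have h1 := mapsTo_ball_of_norm_le_one (hπ s (huI hs)) R hq
      exact (A s).continuous.continuousAt.comp
        (ContinuousAt.comp (f := π s) (hf.continuousAt (Metric.isOpen_ball.mem_nhds h1))
          (π s).continuous.continuousAt)
  | succ n ih =>
    intro F G _ _ _ _ A hA f hf
    push_cast at hf ⊢
    rw [contDiffOn_succ_iff_fderiv_of_isOpen Metric.isOpen_ball] at hf ⊢
    obtain ⟨h1, -, h2⟩ := hf
    have key := fun q (hq : q ∈ Metric.ball (0 : E) R) =>
      hasFDerivAt_averaged hπc hπ hA h1 h2.continuousOn hq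
    refine ⟨fun q hq => (key q hq).differentiableAt.differentiableWithinAt, by simp, ?_⟩
    refine ContDiffOn.congr (ih ?_ h2) fun q hq => (key q hq).fderiv
    exact ((ContinuousLinearMap.continuous _).comp hπc).clm_comp
      ((ContinuousLinearMap.continuous _).comp hA)

/-- The power series is averaged term by term. Composition with a contraction does not increase the
norm of a coefficient, so convergence persists on the original ball. -/
theorem analyticAt_averaged {F : Type} [NormedAddCommGroup F] [NormedSpace ℝ F]
    [CompleteSpace F] {π : ℝ → E →L[ℝ] E} (hπc : Continuous π)
    (hπ : ∀ s ∈ Icc (0 : ℝ) 1, ‖π s‖ ≤ 1) {f : E → F} (hf : AnalyticAt ℝ f 0) :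
    AnalyticAt ℝ (fun q => ∫ s in (0 : ℝ)..1, f (π s q)) 0 := by
  obtain ⟨p, r, hp⟩ := hf
  have huI : uIoc (0 : ℝ) 1 ⊆ Icc 0 1 := by
    rw [uIoc_of_le zero_le_one]; exact Ioc_subset_Icc_self
  have hc : ∀ n, Continuous fun s => (p n).compContinuousLinearMap (fun _ => π s) := by
    intro n
    exact (((ContinuousMultilinearMap.compContinuousLinearMapContinuousMultilinear ℝ
      (fun _ : Fin n => E) (fun _ : Fin n => E) F).cont.comp
        (continuous_pi fun _ => hπc)).clm_apply continuous_const)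
  have hnorm : ∀ n, ∀ s ∈ Icc (0 : ℝ) 1,
      ‖(p n).compContinuousLinearMap (fun _ => π s)‖ ≤ ‖p n‖ := by
    intro n s hs
    refine (ContinuousMultilinearMap.norm_compContinuousLinearMap_le _ _).trans ?_
    refine mul_le_of_le_one_right (norm_nonneg _) ?_
    exact Finset.prod_le_one (fun _ _ => norm_nonneg _) fun _ _ => hπ s hs
  refine ⟨fun n => ∫ s in (0 : ℝ)..1, (p n).compContinuousLinearMap (fun _ => π s), r, ?_⟩
  refine ⟨hp.r_le.trans (FormalMultilinearSeries.radius_le_of_le fun n => ?_), hp.r_pos, ?_⟩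
  · refine (intervalIntegral.norm_integral_le_of_norm_le_const
      fun s hs => hnorm n s (huI hs)).trans ?_
    simp
  · intro y hy
    have hev : ∀ n, (∫ s in (0 : ℝ)..1, (p n).compContinuousLinearMap (fun _ => π s)) (fun _ => y)
        = ∫ s in (0 : ℝ)..1, p n (fun _ => π s y) := by
      intro n
      exact ((ContinuousMultilinearMap.apply ℝ (fun _ : Fin n => E) F
        (fun _ => y)).intervalIntegral_comp_comm ((hc n).intervalIntegrable 0 1)).symm
    simp only [hev, zero_add]
    have hy' : ‖y‖₊ < p.radius := by
      refine lt_of_lt_of_le ?_ hp.r_le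
      simpa [edist_zero_right, enorm_eq_nnnorm] using hy
    refine intervalIntegral.hasSum_integral_of_dominated_convergence
      (fun n _ => ‖p n‖ * (‖y‖₊ : ℝ) ^ n) ?_ ?_ ?_ ?_ ?_
    · intro n
      refine Continuous.aestronglyMeasurable ?_
      exact (p n).cont.comp (continuous_pi fun _ => hπc.clm_apply continuous_const)
    · intro n
      refine Eventually.of_forall fun s hs => ?_
      have := ((p n).compContinuousLinearMap (fun _ => π s)).le_of_opNorm_le
        (hnorm n s (huI hs)) (fun _ => y)
      simpa using this
    · exact Eventually.of_forall fun s _ => p.summable_norm_mul_pow hy'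
    · simp
    · refine Eventually.of_forall fun s hs => ?_
      have h1 : π s y ∈ Metric.eball (0 : E) r := by
        rw [Metric.mem_eball, edist_zero_right] at hy ⊢
        refine lt_of_le_of_lt ?_ hy
        rw [enorm_le_iff_norm_le]
        exact ((π s).le_opNorm y).trans (mul_le_of_le_one_left (norm_nonneg y) (hπ s (huI hs)))
      simpa using hp.hasSum h1

/-- Averages of a `C^r` germ along a path of contractions are `C^r`. -/
theorem eventually_contDiffAt_averaged [FiniteDimensional ℝ E] {F : Type} [NormedAddCommGroup F]
    [NormedSpace ℝ F] [CompleteSpace F] {r : WithTop ℕ∞} (hr : r = ∞ ∨ r = ω)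
    {π : ℝ → E →L[ℝ] E} (hπc : Continuous π)
    (hπ : ∀ s ∈ Icc (0 : ℝ) 1, ‖π s‖ ≤ 1) {f : E → F} (hf : ∀ᶠ q in 𝓝 0, ContDiffAt ℝ r f q) :
    ∀ᶠ q in 𝓝 0, ContDiffAt ℝ r (fun q => ∫ s in (0 : ℝ)..1, f (π s q)) q := by
  rcases hr with rfl | rfl
  · obtain ⟨R, hR, hball⟩ := Metric.eventually_nhds_iff_ball.1 hf
    have h1 : ContDiffOn ℝ ∞ (fun q => ∫ s in (0 : ℝ)..1, f (π s q)) (Metric.ball 0 R) := by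
      refine contDiffOn_infty.2 fun n => ?_
      exact contDiffOn_averaged_nat hπc hπ n (A := fun _ => ContinuousLinearMap.id ℝ F)
        continuous_const fun q hq => ((hball q hq).of_le (by exact_mod_cast le_top)).contDiffWithinAt
    filter_upwards [Metric.ball_mem_nhds (0 : E) hR] with q hq
    exact h1.contDiffAt (Metric.isOpen_ball.mem_nhds hq)
  · have h1 : AnalyticAt ℝ f 0 := hf.self_of_nhds.analyticAt
    exact (analyticAt_averaged hπc hπ h1).contDiffAt.eventually (by simp)

end AveragedComposition

/-! ### Hadamard division by the second coordinate -/

/-- The second basis vector of the parameter plane. -/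
noncomputable def e2v : E2 := !₂[0, 1]

/-- The contraction `(u, v) ↦ (u, s v)`. -/
noncomputable def squeeze (s : ℝ) : E2 →L[ℝ] E2 :=
  ContinuousLinearMap.id ℝ E2 -
    (1 - s) • (EuclideanSpace.proj 1 : E2 →L[ℝ] ℝ).smulRight e2v

@[simp] theorem squeeze_apply_zero (s : ℝ) (q : E2) : squeeze s q 0 = q 0 := by
  simp [squeeze, e2v]

@[simp] theorem squeeze_apply_one (s : ℝ) (q : E2) : squeeze s q 1 = s * q 1 := by
  simp [squeeze, e2v]; ring

theorem E2.ext_coord {a b : E2} (h0 : a 0 = b 0) (h1 : a 1 = b 1) : a = b := by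
  ext i; fin_cases i <;> assumption

theorem E3.ext_coord {a b : E3} (h0 : a 0 = b 0) (h1 : a 1 = b 1) (h2 : a 2 = b 2) : a = b := by
  ext i; fin_cases i <;> assumption

theorem squeeze_one : squeeze 1 = ContinuousLinearMap.id ℝ E2 := by
  ext q; simp [squeeze]

theorem norm_squeeze_le {s : ℝ} (hs : s ∈ Icc (0 : ℝ) 1) : ‖squeeze s‖ ≤ 1 := by
  refine ContinuousLinearMap.opNorm_le_bound _ zero_le_one fun q => ?_
  rw [one_mul, ← abs_of_nonneg (norm_nonneg q), ← abs_of_nonneg (norm_nonneg (squeeze s q)),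
    ← sq_le_sq, EuclideanSpace.norm_sq_eq, EuclideanSpace.norm_sq_eq]
  simp only [Fin.sum_univ_two, squeeze_apply_zero, squeeze_apply_one, Real.norm_eq_abs, sq_abs]
  have : s ^ 2 ≤ 1 := by nlinarith [hs.1, hs.2]
  nlinarith [sq_nonneg (q 1)]

theorem continuous_squeeze : Continuous squeeze := by
  unfold squeeze; fun_prop

theorem hasDerivAt_squeeze (q : E2) (s : ℝ) :
    HasDerivAt (fun s => squeeze s q) (q 1 • e2v) s := by
  have h : (fun s => squeeze s q) = fun s : ℝ => q + (s - 1) • (q 1 • e2v) := by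
    funext s; simp only [squeeze]; simp; module
  rw [h]
  simpa using (((hasDerivAt_id s).sub_const 1).smul_const (q 1 • e2v)).const_add q

/-- For these two classes differentiation loses no regularity; derivatives of C^r germs are again
C^r throughout. -/
theorem add_one_le_of_infty_or_omega {r : WithTop ℕ∞} (hr : r = ∞ ∨ r = ω) : r + 1 ≤ r := by
  rcases hr with rfl | rfl <;> rfl

theorem one_le_of_infty_or_omega {r : WithTop ℕ∞} (hr : r = ∞ ∨ r = ω) : 1 ≤ r := by
  rcases hr with rfl | rfl
  · exact_mod_cast le_top
  · exact le_top

theorem two_le_of_infty_or_omega {r : WithTop ℕ∞} (hr : r = ∞ ∨ r = ω) : 2 ≤ r := by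
  rcases hr with rfl | rfl
  · change ((2 : ℕ∞) : WithTop ℕ∞) ≤ ((⊤ : ℕ∞) : WithTop ℕ∞)
    exact_mod_cast le_top
  · exact le_top

/-- Hadamard's lemma: a `C^r` germ vanishing on the first axis is divisible by the second
coordinate. -/
theorem exists_contDiffAt_eq_mul_of_vanishing {r : WithTop ℕ∞} (hr : r = ∞ ∨ r = ω) {k : E2 → ℝ}
    (hk : ∀ᶠ q in 𝓝 0, ContDiffAt ℝ r k q) (hk0 : ∀ᶠ q in 𝓝 (0 : E2), q 1 = 0 → k q = 0) :
    ∃ k1 : E2 → ℝ, (∀ᶠ q in 𝓝 0, ContDiffAt ℝ r k1 q) ∧ ∀ᶠ q in 𝓝 0, k q = q 1 * k1 q := by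
  have hk' : ∀ᶠ q in 𝓝 0, ContDiffAt ℝ r (fun q => fderiv ℝ k q e2v) q := by
    filter_upwards [hk] with q hq
    exact (hq.fderiv_right (add_one_le_of_infty_or_omega hr)).clm_apply contDiffAt_const
  -- The quotient is an average of ∂ᵥk: since k(u, 0) = 0, the fundamental theorem of calculus gives
  -- k(u, v) = v ∫₀¹ ∂ᵥk(u, sv) ds.
  refine ⟨_, eventually_contDiffAt_averaged hr continuous_squeeze
    (fun s hs => norm_squeeze_le hs) hk', ?_⟩
  obtain ⟨R, hR, hball⟩ := Metric.eventually_nhds_iff_ball.1 (hk.and (hk0.and hk'))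
  filter_upwards [Metric.ball_mem_nhds (0 : E2) hR] with q hq
  have hmem : ∀ s ∈ Icc (0 : ℝ) 1, squeeze s q ∈ Metric.ball (0 : E2) R := fun s hs =>
    mapsTo_ball_of_norm_le_one (norm_squeeze_le hs) R hq
  have hder : ∀ s ∈ uIcc (0 : ℝ) 1,
      HasDerivAt (fun s => k (squeeze s q)) (fderiv ℝ k (squeeze s q) (q 1 • e2v)) s := by
    intro s hs
    rw [uIcc_of_le zero_le_one] at hs
    exact ((hball _ (hmem s hs)).1.differentiableAt
      (zero_lt_one.trans_le (one_le_of_infty_or_omega hr)).ne').hasFDerivAt.comp_hasDerivAt s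
      (hasDerivAt_squeeze q s)
  have hcont : ContinuousOn (fun s => fderiv ℝ k (squeeze s q) e2v) (Icc 0 1) := by
    intro s hs
    refine ContinuousAt.continuousWithinAt ?_
    exact ContinuousAt.comp (f := fun s => squeeze s q) (hball _ (hmem s hs)).2.2.continuousAt
      (hasDerivAt_squeeze q s).continuousAt
  have hftc := intervalIntegral.integral_eq_sub_of_hasDerivAt hder (by
    simp only [map_smul, smul_eq_mul]
    refine ContinuousOn.intervalIntegrable ?_
    rw [uIcc_of_le zero_le_one]
    exact continuousOn_const.mul hcont)
  have h0 : k (squeeze 0 q) = 0 :=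
    (hball _ (hmem 0 (by simp))).2.1 (by simp)
  rw [h0, sub_zero, squeeze_one] at hftc
  simp only [map_smul, smul_eq_mul, intervalIntegral.integral_const_mul] at hftc
  exact hftc.symm

/-- A nonnegative `C^r` germ vanishing on the first axis is divisible by the square of the second
coordinate, with a quotient that is nonnegative. -/
theorem exists_contDiffAt_eq_sq_mul_of_nonneg {r : WithTop ℕ∞} (hr : r = ∞ ∨ r = ω) {k : E2 → ℝ}
    (hk : ∀ᶠ q in 𝓝 0, ContDiffAt ℝ r k q) (hk0 : ∀ᶠ q in 𝓝 (0 : E2), q 1 = 0 → k q = 0)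
    (hpos : ∀ᶠ q in 𝓝 0, 0 ≤ k q) :
    ∃ m : E2 → ℝ, (∀ᶠ q in 𝓝 0, ContDiffAt ℝ r m q) ∧ ∀ᶠ q in 𝓝 0, k q = (q 1) ^ 2 * m q := by
  obtain ⟨k1, hk1, hkk1⟩ := exists_contDiffAt_eq_mul_of_vanishing hr hk hk0
  -- Along a vertical line t · k1 ≥ 0 for both signs of t, so k1 is nonpositive on one side and
  -- nonnegative on the other. It vanishes on the axis and can be divided once more.
  have h0 : ∀ᶠ q in 𝓝 (0 : E2), q 1 = 0 → k1 q = 0 := by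
    filter_upwards [hk1, (hkk1.and hpos).eventually_nhds] with q hq hq2 hq1
    have hline : Tendsto (fun t : ℝ => q + t • e2v) (𝓝 0) (𝓝 q) := by
      have : Continuous fun t : ℝ => q + t • e2v := by fun_prop
      simpa using this.tendsto 0
    have hlim : Tendsto (fun t : ℝ => k1 (q + t • e2v)) (𝓝 0) (𝓝 (k1 q)) :=
      hq.continuousAt.tendsto.comp hline
    have hev : ∀ᶠ t : ℝ in 𝓝 0, 0 ≤ t * k1 (q + t • e2v) := by
      filter_upwards [hline.eventually hq2] with t ht
      have h1 : (q + t • e2v) 1 = t := by simp [e2v, hq1]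
      rw [h1] at ht
      rw [← ht.1]; exact ht.2
    apply le_antisymm
    · refine le_of_tendsto (hlim.mono_left (nhdsWithin_le_nhds (s := Iio 0))) ?_
      filter_upwards [nhdsWithin_le_nhds hev, self_mem_nhdsWithin] with t ht ht0
      exact nonpos_of_mul_nonneg_right ht ht0
    · refine ge_of_tendsto (hlim.mono_left (nhdsWithin_le_nhds (s := Ioi 0))) ?_
      filter_upwards [nhdsWithin_le_nhds hev, self_mem_nhdsWithin] with t ht ht0
      exact nonneg_of_mul_nonneg_right ht ht0
  obtain ⟨m, hm, hkm⟩ := exists_contDiffAt_eq_mul_of_vanishing hr hk1 h0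
  refine ⟨m, hm, ?_⟩
  filter_upwards [hkk1, hkm] with q h1 h2
  rw [h1, h2]; ring

/-! ### The model edge and its tangent cone -/

section ModelBasics

variable {r : WithTop ℕ∞} {α : E2 → ℝ}

@[simp] theorem modelEdge_apply_zero (α : E2 → ℝ) (q : E2) : modelEdge α q 0 = (q 1) ^ 2 := by
  simp [modelEdge]

@[simp] theorem modelEdge_apply_one (α : E2 → ℝ) (q : E2) :
    modelEdge α q 1 = (q 1) ^ 3 * α q := by
  simp [modelEdge]

@[simp] theorem modelEdge_apply_two (α : E2 → ℝ) (q : E2) : modelEdge α q 2 = q 0 := by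
  simp [modelEdge]

@[simp] theorem modelEdge_zero (α : E2 → ℝ) : modelEdge α 0 = 0 := by
  apply E3.ext_coord <;> simp

theorem contDiffAt_coord {E : Type*} [NormedAddCommGroup E] [NormedSpace ℝ E] {n : ℕ}
    {f : E → EuclideanSpace ℝ (Fin n)} {x : E} (hf : ContDiffAt ℝ r f x) (i : Fin n) :
    ContDiffAt ℝ r (fun y => f y i) x :=
  contDiffAt_euclidean.1 hf i

theorem contDiffAt_modelEdge {q : E2} (hα : ContDiffAt ℝ r α q) :
    ContDiffAt ℝ r (modelEdge α) q := by
  rw [contDiffAt_euclidean]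
  have h0 : ContDiffAt ℝ r (fun q : E2 => q 0) q := contDiffAt_coord contDiffAt_id 0
  have h1 : ContDiffAt ℝ r (fun q : E2 => q 1) q := contDiffAt_coord contDiffAt_id 1
  intro i
  fin_cases i
  · simpa using h1.pow 2
  · simpa using (h1.pow 3).mul hα
  · simpa using h0

theorem hasFDerivAt_modelEdge_coords {q : E2} (hα : DifferentiableAt ℝ α q) (w : E2) :
    fderiv ℝ (modelEdge α) q w 0 = 2 * q 1 * w 1 ∧
    fderiv ℝ (modelEdge α) q w 1 =
      3 * q 1 ^ 2 * α q * w 1 + (q 1) ^ 3 * fderiv ℝ α q w ∧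
    fderiv ℝ (modelEdge α) q w 2 = w 0 := by
  have h0 : HasFDerivAt (fun q : E2 => q 0) (EuclideanSpace.proj 0 : E2 →L[ℝ] ℝ) q :=
    (EuclideanSpace.proj 0 : E2 →L[ℝ] ℝ).hasFDerivAt
  have h1 : HasFDerivAt (fun q : E2 => q 1) (EuclideanSpace.proj 1 : E2 →L[ℝ] ℝ) q :=
    (EuclideanSpace.proj 1 : E2 →L[ℝ] ℝ).hasFDerivAt
  have hd : DifferentiableAt ℝ (modelEdge α) q := by
    rw [differentiableAt_euclidean]
    intro i
    fin_cases i
    · simpa using (h1.pow 2).differentiableAt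
    · simpa using DifferentiableAt.fun_mul (h1.pow 3).differentiableAt hα
    · simpa using h0.differentiableAt
  have key : ∀ i : Fin 3, HasFDerivAt (fun q => modelEdge α q i)
      ((EuclideanSpace.proj i : E3 →L[ℝ] ℝ).comp (fderiv ℝ (modelEdge α) q)) q := fun i =>
    (EuclideanSpace.proj i : E3 →L[ℝ] ℝ).hasFDerivAt.comp q hd.hasFDerivAt
  have k0 := (key 0).unique ((h1.pow 2).congr_of_eventuallyEq
    (Eventually.of_forall fun q => modelEdge_apply_zero α q))
  have k1 := (key 1).unique (((h1.pow 3).mul hα.hasFDerivAt).congr_of_eventuallyEq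
    (Eventually.of_forall fun q => modelEdge_apply_one α q))
  have k2 := (key 2).unique (h0.congr_of_eventuallyEq
    (Eventually.of_forall fun q => modelEdge_apply_two α q))
  refine ⟨?_, ?_, ?_⟩
  · simpa using congrArg (fun L => L w) k0
  · have := congrArg (fun L => L w) k1
    simp at this
    rw [this]; ring
  · simpa using congrArg (fun L => L w) k2

theorem fderiv_modelEdge_injective_iff {q : E2} (hα : DifferentiableAt ℝ α q) :
    Function.Injective (fderiv ℝ (modelEdge α) q) ↔ q 1 ≠ 0 := by
  constructor
  · intro h h1
    have : fderiv ℝ (modelEdge α) q e2v = 0 := by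
      obtain ⟨k0, k1, k2⟩ := hasFDerivAt_modelEdge_coords hα e2v
      apply E3.ext_coord
      · rw [k0]; simp [h1]
      · rw [k1]; simp [h1]
      · rw [k2]; simp [e2v]
    have h2 : e2v = 0 := h (by rw [this, map_zero])
    simpa [e2v] using congrArg (fun w : E2 => w 1) h2
  · intro h1
    refine (injective_iff_map_eq_zero _).2 fun w hw => ?_
    obtain ⟨k0, -, k2⟩ := hasFDerivAt_modelEdge_coords hα w
    rw [hw] at k0 k2
    apply E2.ext_coord
    · simpa using k2.symm
    · simpa [h1] using k0.symm

/-- The region `{x ≥ 0, y² ≤ C x³}`, which contains the image of the model edge near the origin. -/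
def InCusp (C : ℝ) (y : E3) : Prop := 0 ≤ y 0 ∧ (y 1) ^ 2 ≤ C * (y 0) ^ 3

theorem exists_eventually_inCusp (hα : ContinuousAt α 0) :
    ∃ C, ∀ᶠ q in 𝓝 0, InCusp C (modelEdge α q) := by
  -- On the image y² = α²x³, so any constant above α(0)² works near the origin.
  refine ⟨(α 0) ^ 2 + 1, ?_⟩
  filter_upwards [(hα.pow 2).eventually (gt_mem_nhds (lt_add_one _))] with q hq
  simp only [InCusp, modelEdge_apply_zero, modelEdge_apply_one]
  refine ⟨sq_nonneg _, ?_⟩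
  have h : (q 1 ^ 3 * α q) ^ 2 = α q ^ 2 * (q 1 ^ 2) ^ 3 := by ring
  rw [h]
  exact mul_le_mul_of_nonneg_right hq.le (by positivity)

/-- After rescaling, (c y₁)² ≤ C (c y₀)³ / c, and the right side tends to zero as c → ∞. -/
theorem cone_of_inCusp {ι : Type*} {l : Filter ι} [l.NeBot] {C : ℝ} {y : ι → E3} {c : ι → ℝ}
    {w : E3} (hc : Tendsto c l atTop) (hw : Tendsto (fun n => c n • y n) l (𝓝 w))
    (hy : ∀ᶠ n in l, InCusp C (y n)) : 0 ≤ w 0 ∧ w 1 = 0 := by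
  have h0 : Tendsto (fun n => c n * y n 0) l (𝓝 (w 0)) := by
    simpa [Function.comp_def] using ((EuclideanSpace.proj 0 : E3 →L[ℝ] ℝ).continuous.tendsto w).comp hw
  have h1 : Tendsto (fun n => c n * y n 1) l (𝓝 (w 1)) := by
    simpa [Function.comp_def] using ((EuclideanSpace.proj 1 : E3 →L[ℝ] ℝ).continuous.tendsto w).comp hw
  have hpos := hc.eventually_gt_atTop 0
  refine ⟨?_, ?_⟩
  · refine ge_of_tendsto h0 ?_
    filter_upwards [hpos, hy] with n hn hyn
    exact mul_nonneg hn.le hyn.1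
  · have h2 : Tendsto (fun n => C * (c n * y n 0) ^ 3 * (c n)⁻¹) l (𝓝 (C * w 0 ^ 3 * 0)) :=
      ((h0.pow 3).const_mul C).mul hc.inv_tendsto_atTop
    have h3 : w 1 ^ 2 ≤ C * w 0 ^ 3 * 0 := by
      refine le_of_tendsto_of_tendsto (h1.pow 2) h2 ?_
      filter_upwards [hpos, hy] with n hn hyn
      have h4 : C * (c n * y n 0) ^ 3 * (c n)⁻¹ = c n ^ 2 * (C * y n 0 ^ 3) := by
        field_simp
      rw [h4, mul_pow]
      exact mul_le_mul_of_nonneg_left hyn.2 (sq_nonneg _)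
    rw [mul_zero] at h3
    exact pow_eq_zero_iff two_ne_zero |>.1 (le_antisymm h3 (sq_nonneg _))

theorem HasFDerivAt.tendsto_scaled {ι E F : Type*} [NormedAddCommGroup E] [NormedSpace ℝ E]
    [NormedAddCommGroup F] [NormedSpace ℝ F] {l : Filter ι} {k : E → F} {k' : E →L[ℝ] F} {x v : E}
    (hk : HasFDerivAt k k' x) {c : ι → ℝ} {d : ι → E} (hc : Tendsto c l atTop)
    (hd : Tendsto (fun n => c n • d n) l (𝓝 v)) :
    Tendsto (fun n => c n • (k (x + d n) - k x)) l (𝓝 (k' v)) := by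
  refine (hasFDerivWithinAt_univ.2 hk).lim ?_ (Eventually.of_forall fun _ => mem_univ _) hd
  have h := hc.inv_tendsto_atTop.smul hd
  rw [zero_smul] at h
  refine h.congr' ?_
  filter_upwards [hc.eventually_gt_atTop 0] with n hn
  simp [smul_smul, hn.ne']

/-- The increments may shrink at any rate 1/c: the rate t is used along the axis and on immersed
sheets, the rate t² in the cuspidal direction. -/
theorem cone_of_hasFDerivAt {ι E : Type*} [NormedAddCommGroup E] [NormedSpace ℝ E] {l : Filter ι}
    [l.NeBot] {C : ℝ} {k : E → E3} {k' : E →L[ℝ] E3} {x v : E} (hk : HasFDerivAt k k' x)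
    (h0 : k x 0 = 0) (h1 : k x 1 = 0) {c : ι → ℝ} {d : ι → E} (hc : Tendsto c l atTop)
    (hd : Tendsto (fun n => c n • d n) l (𝓝 v)) (hC : ∀ᶠ n in l, InCusp C (k (x + d n))) :
    0 ≤ k' v 0 ∧ k' v 1 = 0 := by
  have := hk.tendsto_scaled hc hd
  refine cone_of_inCusp (C := C) hc this ?_
  filter_upwards [hC] with n hn
  simpa [InCusp, h0, h1] using hn

theorem exists_ne_zero_of_functional (ℓ : E2 →L[ℝ] ℝ) : ∃ w : E2, w ≠ 0 ∧ ℓ w = 0 := by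
  by_contra! h
  have hinj : Function.Injective (ℓ : E2 →ₗ[ℝ] ℝ) := by
    refine (injective_iff_map_eq_zero _).2 fun w hw => ?_
    by_contra hne
    exact h w hne hw
  have := LinearMap.finrank_le_finrank_of_injective hinj
  simp at this

end ModelBasics

/-! ### Symmetries of the image of the model edge -/

section ModelSymmetry

/-- `G` is the germ at the origin of a map fixing the origin and carrying the germ of the image of
the model edge into itself. -/
structure PreservesModel (α : E2 → ℝ) (G : E3 → E3) : Prop where
  map_zero : G 0 = 0
  incl : ∀ N ∈ 𝓝 (0 : E2), ∀ᶠ q in 𝓝 (0 : E2), ∃ q' ∈ N, modelEdge α q' = G (modelEdge α q)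

/-- `G` is a `C^r` involutive germ preserving the germ of the image of the model edge. -/
structure ModelSymmetry (r : WithTop ℕ∞) (α : E2 → ℝ) (G : E3 → E3) : Prop
    extends PreservesModel α G where
  regularity : r = ∞ ∨ r = ω
  contDiffAt_coeff : ∀ᶠ q in 𝓝 0, ContDiffAt ℝ r α q
  contDiffAt_map : ∀ᶠ x in 𝓝 0, ContDiffAt ℝ r G x
  invol : ∀ᶠ x in 𝓝 0, G (G x) = x

noncomputable def e1E3 : E3 := !₂[1, 0, 0]
noncomputable def e2E3 : E3 := !₂[0, 1, 0]
noncomputable def e3E3 : E3 := !₂[0, 0, 1]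

variable {r : WithTop ℕ∞} {α : E2 → ℝ} {G : E3 → E3}

/-- The differential of the model at the origin kills `e2v`, so the cuspidal direction appears only
at the quadratic scale. -/
theorem tendsto_scaled_modelEdge_transverse (hα : ContinuousAt α 0) :
    Tendsto (fun t : ℝ => ((t ^ 2)⁻¹) • modelEdge α (t • e2v)) (𝓝[>] 0) (𝓝 e1E3) := by
  have h1 : Tendsto (fun t : ℝ => (!₂[1, t * α (t • e2v), 0] : E3)) (𝓝[>] 0) (𝓝 e1E3) := by
    have h2 : Tendsto (fun t : ℝ => t * α (t • e2v)) (𝓝 0) (𝓝 (0 * α 0)) := by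
      refine tendsto_id.mul (hα.tendsto.comp ?_)
      have : Continuous fun t : ℝ => t • e2v := by fun_prop
      simpa using this.tendsto 0
    have h3 : Continuous fun a : ℝ => (!₂[1, a, 0] : E3) := by
      refine (PiLp.continuous_toLp 2 _).comp ?_
      refine continuous_pi fun i => ?_
      fin_cases i <;> simp <;> fun_prop
    rw [zero_mul] at h2
    exact ((h3.tendsto 0).comp h2).mono_left nhdsWithin_le_nhds
  refine h1.congr' ?_
  filter_upwards [self_mem_nhdsWithin] with t ht
  have ht : t ≠ 0 := (mem_Ioi.1 ht).ne'
  apply E3.ext_coord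
  · simp [e2v, ht]
  · simp [e2v]; field_simp
  · simp [e2v]

theorem tendsto_smul_e2v : Tendsto (fun t : ℝ => t • e2v) (𝓝[>] 0) (𝓝 0) := by
  have : Continuous fun t : ℝ => t • e2v := by fun_prop
  simpa using (this.tendsto 0).mono_left nhdsWithin_le_nhds

theorem tendsto_inv_sq_atTop : Tendsto (fun t : ℝ => (t ^ 2)⁻¹) (𝓝[>] 0) atTop := by
  have h : Tendsto (fun t : ℝ => t⁻¹ ^ 2) (𝓝[>] 0) atTop :=
    (tendsto_pow_atTop two_ne_zero).comp tendsto_inv_nhdsGT_zero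
  simpa using h

theorem PreservesModel.exists_eventually_inCusp (h : PreservesModel α G) (hα : ContinuousAt α 0) :
    ∃ C, ∀ᶠ q in 𝓝 0, InCusp C (G (modelEdge α q)) := by
  obtain ⟨C, hC⟩ := _root_.exists_eventually_inCusp hα
  refine ⟨C, ?_⟩
  filter_upwards [h.incl _ hC] with q ⟨q', hq', he⟩
  rw [← he]; exact hq'

theorem PreservesModel.fderiv_e1 (h : PreservesModel α G) (hα : ContinuousAt α 0)
    (hG : DifferentiableAt ℝ G 0) : 0 ≤ fderiv ℝ G 0 e1E3 0 ∧ fderiv ℝ G 0 e1E3 1 = 0 := by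
  obtain ⟨C, hC⟩ := h.exists_eventually_inCusp hα
  refine cone_of_hasFDerivAt (C := C) hG.hasFDerivAt (by simp [h.map_zero]) (by simp [h.map_zero])
    tendsto_inv_sq_atTop (tendsto_scaled_modelEdge_transverse hα) ?_
  simpa using tendsto_smul_e2v.eventually hC

/-- The axis leaves the origin both ways, so the sign condition holds for `e3E3` and for its
negative, and the first coordinate must vanish. -/
theorem PreservesModel.fderiv_e3 (h : PreservesModel α G) (hα : ContinuousAt α 0)
    (hG : DifferentiableAt ℝ G 0) : fderiv ℝ G 0 e3E3 0 = 0 ∧ fderiv ℝ G 0 e3E3 1 = 0 := by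
  obtain ⟨C, hC⟩ := h.exists_eventually_inCusp hα
  have key : ∀ σ : ℝ, 0 ≤ fderiv ℝ G 0 (σ • e3E3) 0 ∧ fderiv ℝ G 0 (σ • e3E3) 1 = 0 := by
    intro σ
    have hlin : Continuous fun t : ℝ => (!₂[t * σ, 0] : E2) := by
      refine (PiLp.continuous_toLp 2 _).comp (continuous_pi fun i => ?_)
      fin_cases i <;> simp <;> fun_prop
    have h0 : (!₂[0 * σ, 0] : E2) = 0 := by apply E2.ext_coord <;> simp
    refine cone_of_hasFDerivAt (C := C) (l := 𝓝[>] (0 : ℝ)) (c := fun t => t⁻¹)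
      (d := fun t => modelEdge α !₂[t * σ, 0]) hG.hasFDerivAt (by simp [h.map_zero])
      (by simp [h.map_zero]) tendsto_inv_nhdsGT_zero ?_ ?_
    · refine tendsto_const_nhds.congr' ?_
      filter_upwards [self_mem_nhdsWithin] with t ht
      have ht : t ≠ 0 := (mem_Ioi.1 ht).ne'
      apply E3.ext_coord <;> simp [e3E3]
      field_simp
    · have := (hlin.tendsto 0).mono_left (nhdsWithin_le_nhds (s := Ioi 0))
      rw [h0] at this
      simpa using this.eventually hC
  have k1 := key 1
  have k2 := key (-1)
  simp only [one_smul, neg_smul, map_neg, PiLp.neg_apply] at k1 k2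
  exact ⟨by linarith [k1.1, k2.1], k1.2⟩

namespace ModelSymmetry

theorem continuousAt_coeff (h : ModelSymmetry r α G) : ContinuousAt α 0 :=
  h.contDiffAt_coeff.self_of_nhds.continuousAt

theorem ne_zero (h : ModelSymmetry r α G) : r ≠ 0 :=
  (zero_lt_one.trans_le (one_le_of_infty_or_omega h.regularity)).ne'

theorem differentiableAt_map (h : ModelSymmetry r α G) : ∀ᶠ x in 𝓝 0, DifferentiableAt ℝ G x := by
  filter_upwards [h.contDiffAt_map] with x hx using hx.differentiableAt h.ne_zero

theorem tendsto_map (h : ModelSymmetry r α G) : Tendsto G (𝓝 0) (𝓝 0) := by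
  simpa [h.map_zero] using h.contDiffAt_map.self_of_nhds.continuousAt.tendsto

theorem fderiv_injective (h : ModelSymmetry r α G) :
    ∀ᶠ x in 𝓝 0, Function.Injective (fderiv ℝ G x) := by
  filter_upwards [h.differentiableAt_map, h.tendsto_map.eventually h.differentiableAt_map,
    h.invol.eventually_nhds] with x h1 h2 h3
  have h4 := (h2.hasFDerivAt.comp x h1.hasFDerivAt).unique
    ((hasFDerivAt_id x).congr_of_eventuallyEq (h3 : _ =ᶠ[𝓝 x] _))
  refine Function.LeftInverse.injective (g := fderiv ℝ G (G x)) fun w => ?_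
  simpa using congrArg (fun L => L w) h4

theorem contDiffAt_modelEdge (h : ModelSymmetry r α G) :
    ∀ᶠ q in 𝓝 0, ContDiffAt ℝ r (modelEdge α) q := by
  filter_upwards [h.contDiffAt_coeff] with q hq using _root_.contDiffAt_modelEdge hq

theorem tendsto_modelEdge (h : ModelSymmetry r α G) : Tendsto (modelEdge α) (𝓝 0) (𝓝 0) := by
  simpa using h.contDiffAt_modelEdge.self_of_nhds.continuousAt.tendsto

theorem contDiffAt_comp (h : ModelSymmetry r α G) :
    ∀ᶠ q in 𝓝 0, ContDiffAt ℝ r (fun q => G (modelEdge α q)) q := by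
  filter_upwards [h.contDiffAt_modelEdge, h.tendsto_modelEdge.eventually h.contDiffAt_map]
    with q h1 h2
  exact h2.comp q h1

/-- A symmetry of the model edge preserves the image of the singular axis. -/
theorem axis_to_axis (h : ModelSymmetry r α G) :
    ∀ᶠ q in 𝓝 (0 : E2), q 1 = 0 → G (modelEdge α q) 0 = 0 ∧ G (modelEdge α q) 1 = 0 := by
  obtain ⟨C, hC⟩ := h.toPreservesModel.exists_eventually_inCusp h.continuousAt_coeff
  have hgood : ∀ᶠ q' in 𝓝 (0 : E2), (∀ᶠ q in 𝓝 q', InCusp C (G (modelEdge α q))) ∧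
      DifferentiableAt ℝ α q' ∧ DifferentiableAt ℝ G (modelEdge α q') ∧
      Function.Injective (fderiv ℝ G (modelEdge α q')) ∧
      DifferentiableAt ℝ (modelEdge α) q' := by
    filter_upwards [hC.eventually_nhds, h.contDiffAt_coeff,
      h.tendsto_modelEdge.eventually h.differentiableAt_map,
      h.tendsto_modelEdge.eventually h.fderiv_injective, h.contDiffAt_modelEdge]
      with q' h1 h2 h3 h4 h5
    exact ⟨h1, h2.differentiableAt h.ne_zero, h3, h4, h5.differentiableAt h.ne_zero⟩
  filter_upwards [h.incl _ hgood, h.tendsto_modelEdge.eventually h.invol] with q hq hinv hq1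
  obtain ⟨q', ⟨k1, k2, k3, k4, k5⟩, he⟩ := hq
  by_cases hq' : q' 1 = 0
  · rw [← he]; simp [hq']
  -- Off the axis the model is immersed, so G ∘ g would be an immersion at `q'`, with value g(q) on
  -- the edge of the cusp because G is an involution. Every direction ±w would have to map into the
  -- half-plane, which leaves only the line of `e3E3` for a differential of rank two.
  exfalso
  have hkd : HasFDerivAt (fun q => G (modelEdge α q))
      ((fderiv ℝ G (modelEdge α q')).comp (fderiv ℝ (modelEdge α) q')) q' :=
    k3.hasFDerivAt.comp q' k5.hasFDerivAt
  set k' := (fderiv ℝ G (modelEdge α q')).comp (fderiv ℝ (modelEdge α) q') with hk'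
  have hinj : Function.Injective k' := by
    rw [hk', ContinuousLinearMap.coe_comp]
    exact k4.comp ((fderiv_modelEdge_injective_iff k2).2 hq')
  have hval : G (modelEdge α q') = modelEdge α q := by rw [he, hinv]
  have cone : ∀ w : E2, 0 ≤ k' w 0 ∧ k' w 1 = 0 := by
    intro w
    refine cone_of_hasFDerivAt (C := C) (l := 𝓝[>] (0 : ℝ)) (c := fun t => t⁻¹)
      (d := fun t => t • w) hkd (by rw [hval]; simp [hq1]) (by rw [hval]; simp [hq1])
      tendsto_inv_nhdsGT_zero ?_ ?_
    · refine tendsto_const_nhds.congr' ?_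
      filter_upwards [self_mem_nhdsWithin] with t ht
      have ht : t ≠ 0 := (mem_Ioi.1 ht).ne'
      rw [smul_smul, inv_mul_cancel₀ ht, one_smul]
    · have hc : Continuous fun t : ℝ => q' + t • w := by fun_prop
      have := (hc.tendsto 0).mono_left (nhdsWithin_le_nhds (s := Ioi 0))
      rw [zero_smul, add_zero] at this
      exact this.eventually k1
  obtain ⟨w, hw, hw2⟩ := exists_ne_zero_of_functional
    ((EuclideanSpace.proj 2 : E3 →L[ℝ] ℝ).comp k')
  refine hw (hinj ?_)
  rw [map_zero]
  have c1 := cone w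
  have c2 := cone (-w)
  simp only [map_neg, PiLp.neg_apply] at c2
  apply E3.ext_coord
  · simp only [PiLp.zero_apply]; linarith [c1.1, c2.1]
  · simpa using c1.2
  · simpa using hw2

/-- The squared second coordinate of a lift of a symmetry through the model edge is `v² m(u, v)`
with `m` positive and of class `C^r`. -/
theorem exists_factor (h : ModelSymmetry r α G) :
    ∃ m : E2 → ℝ, (∀ᶠ q in 𝓝 0, ContDiffAt ℝ r m q) ∧ 0 < m 0 ∧
      ∀ᶠ q in 𝓝 0, G (modelEdge α q) 0 = (q 1) ^ 2 * m q := by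
  obtain ⟨C, hC⟩ := h.toPreservesModel.exists_eventually_inCusp h.continuousAt_coeff
  obtain ⟨m, hm, hGm⟩ := exists_contDiffAt_eq_sq_mul_of_nonneg h.regularity
    (k := fun q => G (modelEdge α q) 0)
    (h.contDiffAt_comp.mono fun q hq => contDiffAt_coord hq 0)
    (h.axis_to_axis.mono fun q hq hq1 => (hq hq1).1) (hC.mono fun q hq => hq.1)
  refine ⟨m, hm, ?_, hGm⟩
  have hGd := h.differentiableAt_map.self_of_nhds
  obtain ⟨a0, a1⟩ := h.toPreservesModel.fderiv_e1 h.continuousAt_coeff hGd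
  obtain ⟨b0, b1⟩ := h.toPreservesModel.fderiv_e3 h.continuousAt_coeff hGd
  have hlim := hGd.hasFDerivAt.tendsto_scaled tendsto_inv_sq_atTop
    (tendsto_scaled_modelEdge_transverse h.continuousAt_coeff)
  have hlim0 := ((EuclideanSpace.proj 0 : E3 →L[ℝ] ℝ).continuous.tendsto _).comp hlim
  -- At the points (0, t), the first coordinate of G ∘ g divided by t² is m; its limit is also read
  -- off from the derivative of G in the direction `e1E3`.
  have hm0 : m 0 = fderiv ℝ G 0 e1E3 0 := by
    refine tendsto_nhds_unique (hm.self_of_nhds.continuousAt.tendsto.comp tendsto_smul_e2v)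
      (hlim0.congr' ?_)
    filter_upwards [tendsto_smul_e2v.eventually hGm, self_mem_nhdsWithin] with t ht ht0
    have ht0 : t ≠ 0 := (mem_Ioi.1 ht0).ne'
    simp only [Function.comp, zero_add, h.map_zero, sub_zero, map_smul]
    change _ * G _ 0 = _
    rw [ht]
    simp [e2v, ht0]
  refine lt_of_le_of_ne (hm0 ▸ a0) fun hzero => ?_
  have hinj := h.fderiv_injective.self_of_nhds
  rw [← hzero] at hm0
  set A := fderiv ℝ G 0
  -- If m(0) = 0, both `e1E3` and `e3E3` go into the line of `e3E3`, and this combination lies in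
  -- the kernel.
  have h1 : A (A e3E3 2 • e1E3 - A e1E3 2 • e3E3) = 0 := by
    rw [map_sub, map_smul, map_smul]
    apply E3.ext_coord
    · simp [b0, ← hm0]
    · simp [a1, b1]
    · simp; ring
  have h2 := hinj (h1.trans (map_zero A).symm)
  have h3 : A e3E3 2 = 0 := by simpa [e1E3, e3E3] using congrArg (fun x : E3 => x 0) h2
  have h4 : A e3E3 = A 0 := by
    rw [map_zero]
    exact E3.ext_coord b0 b1 h3
  simpa [e3E3] using congrArg (fun x : E3 => x 2) (hinj h4)

end ModelSymmetry

end ModelSymmetry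

/-! ### Connectedness on half-discs -/

section HalfDisc

def halfDisc (R σ : ℝ) : Set E2 := Metric.ball 0 R ∩ {q | 0 < σ * q 1}

theorem isOpen_halfDisc (R σ : ℝ) : IsOpen (halfDisc R σ) := by
  refine Metric.isOpen_ball.inter (isOpen_lt continuous_const ?_)
  exact continuous_const.mul (EuclideanSpace.proj 1 : E2 →L[ℝ] ℝ).continuous

theorem isPreconnected_halfDisc (R σ : ℝ) : IsPreconnected (halfDisc R σ) := by
  refine ((convex_ball _ _).inter ?_).isPreconnected
  exact convex_halfSpace_gt (f := fun q : E2 => σ * q 1)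
    ((σ • (EuclideanSpace.proj 1 : E2 →L[ℝ] ℝ)).toLinearMap.isLinear) 0

theorem mem_halfDisc_cases {R : ℝ} {q : E2} (hq : q ∈ Metric.ball (0 : E2) R) :
    q 1 = 0 ∨ q ∈ halfDisc R 1 ∨ q ∈ halfDisc R (-1) := by
  rcases lt_trichotomy (q 1) 0 with h | h | h
  · exact Or.inr (Or.inr ⟨hq, by simpa using h⟩)
  · exact Or.inl h
  · exact Or.inr (Or.inl ⟨hq, by simpa using h⟩)

theorem exists_small_sign {P : E2 → Prop} (hP : ∀ᶠ q in 𝓝 (0 : E2), P q) {s : ℝ}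
    (hs : s = 1 ∨ s = -1) : ∃ q : E2, s * q 1 < 0 ∧ P q := by
  have hc : Continuous fun t : ℝ => (-s * t) • e2v := by fun_prop
  have h1 := (hc.tendsto 0).mono_left (nhdsWithin_le_nhds (s := Ioi 0))
  rw [mul_zero, zero_smul] at h1
  obtain ⟨t, ht, ht0⟩ := ((h1.eventually hP).and self_mem_nhdsWithin).exists
  refine ⟨_, ?_, ht⟩
  have ht0 : 0 < t := ht0
  rcases hs with rfl | rfl <;> simpa [e2v] using ht0

/-- Two `C¹` functions on a connected open set whose product vanishes and which have no common
critical zero cannot both be nonzero. -/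
theorem eq_zero_or_eq_zero_of_no_common_critical_zero {S : Set E2} (hS : IsOpen S)
    (hSc : IsPreconnected S) {D₁ D₂ : E2 → ℝ} (h1 : ContDiffOn ℝ 1 D₁ S) (h2 : ContDiffOn ℝ 1 D₂ S)
    (hprod : ∀ q ∈ S, D₁ q * D₂ q = 0)
    (hcrit : ∀ q ∈ S, D₁ q = 0 → D₂ q = 0 → fderiv ℝ D₁ q = 0 → fderiv ℝ D₂ q = 0 → False) :
    (∀ q ∈ S, D₁ q = 0) ∨ (∀ q ∈ S, D₂ q = 0) := by
  -- These are the points where D does not vanish to first order. The two sets are open, disjoint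
  -- and cover S by `hcrit`, so they cannot both be nonempty.
  let V : (E2 → ℝ) → Set E2 := fun D => {q ∈ S | D q ≠ 0 ∨ fderiv ℝ D q ≠ 0}
  have hVopen : ∀ D : E2 → ℝ, ContDiffOn ℝ 1 D S → IsOpen (V D) := by
    intro D hD
    have e : V D = (S ∩ D ⁻¹' {0}ᶜ) ∪ (S ∩ fderiv ℝ D ⁻¹' {0}ᶜ) := by
      ext q; simp [V, and_or_left]
    rw [e]
    exact (hD.continuousOn.isOpen_inter_preimage hS isOpen_compl_singleton).union
      ((hD.continuousOn_fderiv_of_isOpen hS le_rfl).isOpen_inter_preimage hS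
        isOpen_compl_singleton)
  have hdiff : ∀ {D : E2 → ℝ}, ContDiffOn ℝ 1 D S → ∀ q ∈ S, DifferentiableAt ℝ D q :=
    fun hD q hq => (hD.contDiffAt (hS.mem_nhds hq)).differentiableAt one_ne_zero
  have hflat : ∀ {D D' : E2 → ℝ}, ContDiffOn ℝ 1 D S → (∀ q ∈ S, D q * D' q = 0) → ∀ q ∈ S,
      D q ≠ 0 → D' q = 0 ∧ fderiv ℝ D' q = 0 := by
    intro D D' hD hp q hq hne
    have h3 : D' =ᶠ[𝓝 q] fun _ => 0 := by
      filter_upwards [(hdiff hD q hq).continuousAt.eventually_ne hne, hS.mem_nhds hq] with x hx hxS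
      exact (mul_eq_zero.1 (hp x hxS)).resolve_left hx
    exact ⟨h3.self_of_nhds, by rw [h3.fderiv_eq]; simp⟩
  have hprod' : ∀ q ∈ S, D₂ q * D₁ q = 0 := fun q hq => by rw [mul_comm]; exact hprod q hq
  have hdisj : ∀ q ∈ S, q ∈ V D₁ → q ∈ V D₂ → False := by
    rintro q hq ⟨-, ha⟩ ⟨-, hb⟩
    by_cases hz1 : D₁ q = 0
    · by_cases hz2 : D₂ q = 0
      · have ha := ha.resolve_left (by simpa using hz1)
        have hb := hb.resolve_left (by simpa using hz2)
        -- Along a direction outside both kernels, neither function vanishes at small nonzero times,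
        -- against the vanishing product.
        obtain ⟨w, hw1, hw2⟩ : ∃ w, fderiv ℝ D₁ q w ≠ 0 ∧ fderiv ℝ D₂ q w ≠ 0 := by
          obtain ⟨a, ha⟩ := ContinuousLinearMap.exists_ne_zero ha
          obtain ⟨b, hb⟩ := ContinuousLinearMap.exists_ne_zero hb
          by_cases c1 : fderiv ℝ D₂ q a = 0
          · by_cases c2 : fderiv ℝ D₁ q b = 0
            · exact ⟨a + b, by simpa [c2] using ha, by simpa [c1] using hb⟩
            · exact ⟨b, c2, hb⟩
          · exact ⟨a, ha, c1⟩
        have line : ∀ {D : E2 → ℝ}, ContDiffOn ℝ 1 D S → D q = 0 → fderiv ℝ D q w ≠ 0 →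
            ∀ᶠ t : ℝ in 𝓝[≠] 0, D (q + t • w) ≠ 0 := by
          intro D hD hD0 hDw
          have hl : HasDerivAt (fun t : ℝ => q + t • w) w 0 := by
            simpa using ((hasDerivAt_id (0 : ℝ)).smul_const w).const_add q
          have hcomp : HasDerivAt (fun t : ℝ => D (q + t • w)) (fderiv ℝ D q w) 0 := by
            have hq0 : HasFDerivAt D (fderiv ℝ D q) (q + (0 : ℝ) • w) := by
              simpa using (hdiff hD q hq).hasFDerivAt
            exact hq0.comp_hasDerivAt (0 : ℝ) hl
          exact hcomp.eventually_ne hDw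
        have hmem : ∀ᶠ t : ℝ in 𝓝[≠] 0, q + t • w ∈ S := by
          have hc : Continuous fun t : ℝ => q + t • w := by fun_prop
          have := hc.tendsto 0
          rw [zero_smul, add_zero] at this
          exact nhdsWithin_le_nhds (this.eventually (hS.mem_nhds hq))
        obtain ⟨t, t1, t2, t3⟩ := ((line h1 hz1 hw1).and ((line h2 hz2 hw2).and hmem)).exists
        exact (mul_ne_zero t1 t2) (hprod _ t3)
      · obtain ⟨c1, c2⟩ := hflat h2 hprod' q hq hz2
        exact ha.elim (fun h => h c1) fun h => h c2
    · obtain ⟨c1, c2⟩ := hflat h1 hprod q hq hz1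
      exact hb.elim (fun h => h c1) fun h => h c2
  have hcover : S ⊆ V D₁ ∪ V D₂ := by
    intro q hq
    by_contra hn
    simp only [V, mem_union, mem_ofPred_eq, not_or, not_and, ne_eq, not_not] at hn
    exact hcrit q hq (hn.1 hq).1 (hn.2 hq).1 (hn.1 hq).2 (hn.2 hq).2
  by_contra hcon
  push Not at hcon
  obtain ⟨⟨a, haS, ha⟩, ⟨b, hbS, hb⟩⟩ := hcon
  obtain ⟨q, hqS, hq1, hq2⟩ := hSc _ _ (hVopen D₁ h1) (hVopen D₂ h2) hcover
    ⟨a, haS, haS, Or.inl ha⟩ ⟨b, hbS, hbS, Or.inl hb⟩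
  exact hdisj q hqS hq1 hq2

end HalfDisc

/-! ### The two candidate lifts -/

section Lifts

/-- The candidate lifts of a symmetry `G` through the model edge, for `s = ±1`. -/
noncomputable def modelLift (α : E2 → ℝ) (G : E3 → E3) (m : E2 → ℝ) (s : ℝ) (q : E2) : E2 :=
  !₂[G (modelEdge α q) 2, s * (q 1 * √(m q))]

@[simp] theorem modelLift_apply_zero (α : E2 → ℝ) (G : E3 → E3) (m : E2 → ℝ) (s : ℝ) (q : E2) :
    modelLift α G m s q 0 = G (modelEdge α q) 2 := by simp [modelLift]

@[simp] theorem modelLift_apply_one (α : E2 → ℝ) (G : E3 → E3) (m : E2 → ℝ) (s : ℝ) (q : E2) :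
    modelLift α G m s q 1 = s * (q 1 * √(m q)) := by simp [modelLift]

/-- A symmetry of the model edge together with the factor `m` of `v²` in its first coordinate. -/
structure FactoredSymmetry (r : WithTop ℕ∞) (α : E2 → ℝ) (G : E3 → E3) (m : E2 → ℝ) : Prop
    extends ModelSymmetry r α G where
  contDiffAt_factor : ∀ᶠ q in 𝓝 0, ContDiffAt ℝ r m q
  factor_pos_zero : 0 < m 0
  factor_eq : ∀ᶠ q in 𝓝 0, G (modelEdge α q) 0 = (q 1) ^ 2 * m q

namespace FactoredSymmetry

variable {r : WithTop ℕ∞} {α : E2 → ℝ} {G : E3 → E3} {m : E2 → ℝ}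

theorem factor_pos (h : FactoredSymmetry r α G m) : ∀ᶠ q in 𝓝 0, 0 < m q :=
  h.contDiffAt_factor.self_of_nhds.continuousAt.eventually (lt_mem_nhds h.factor_pos_zero)

theorem contDiffAt_sqrt (h : FactoredSymmetry r α G m) :
    ∀ᶠ q in 𝓝 0, ContDiffAt ℝ r (fun q => √(m q)) q := by
  filter_upwards [h.contDiffAt_factor, h.factor_pos] with q h1 h2 using h1.sqrt h2.ne'

theorem contDiffAt_lift (h : FactoredSymmetry r α G m) (s : ℝ) :
    ∀ᶠ q in 𝓝 0, ContDiffAt ℝ r (modelLift α G m s) q := by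
  filter_upwards [h.contDiffAt_sqrt, h.contDiffAt_comp] with q h1 h2
  rw [contDiffAt_euclidean]
  intro i
  fin_cases i
  · simpa using contDiffAt_coord h2 2
  · simpa using contDiffAt_const.mul ((contDiffAt_coord contDiffAt_id 1).mul h1)

theorem lift_zero (h : FactoredSymmetry r α G m) (s : ℝ) : modelLift α G m s 0 = 0 := by
  apply E2.ext_coord <;> simp [h.map_zero]

theorem tendsto_lift (h : FactoredSymmetry r α G m) (s : ℝ) :
    Tendsto (modelLift α G m s) (𝓝 0) (𝓝 0) := by
  simpa [h.lift_zero] using (h.contDiffAt_lift s).self_of_nhds.continuousAt.tendsto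

/-- A point over `G (g q)` is one of the two candidate lifts of `q`. -/
theorem eq_lift_of_modelEdge_eq (h : FactoredSymmetry r α G m) :
    ∀ᶠ q in 𝓝 0, ∀ q', modelEdge α q' = G (modelEdge α q) →
      ∃ s : ℝ, (s = 1 ∨ s = -1) ∧ q' = modelLift α G m s q := by
  filter_upwards [h.factor_eq, h.factor_pos] with q h1 h2 q' hq'
  have e0 := congrArg (fun y : E3 => y 0) hq'
  have e2 := congrArg (fun y : E3 => y 2) hq'
  simp only [modelEdge_apply_zero, modelEdge_apply_two, h1] at e0 e2
  have e3 : (q' 1) ^ 2 = (q 1 * √(m q)) ^ 2 := by rw [e0, mul_pow, Real.sq_sqrt h2.le]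
  rcases sq_eq_sq_iff_eq_or_eq_neg.1 e3 with e | e
  · exact ⟨1, Or.inl rfl, E2.ext_coord (by simpa using e2) (by simpa using e)⟩
  · exact ⟨-1, Or.inr rfl, E2.ext_coord (by simpa using e2) (by simpa using e)⟩

/-- A continuous open germ lifting `G` through the model edge is one of the two candidates. -/
theorem eventually_eq_lift (h : FactoredSymmetry r α G m) {ψ : E2 → E2}
    (hψc : ∀ᶠ q in 𝓝 0, ContinuousAt ψ q) (hopen : 𝓝 0 ≤ map ψ (𝓝 0))
    (hψ : ∀ᶠ q in 𝓝 0, modelEdge α (ψ q) = G (modelEdge α q)) :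
    ∃ s : ℝ, (s = 1 ∨ s = -1) ∧ ∀ᶠ q in 𝓝 0, ψ q = modelLift α G m s q := by
  have hlift := (h.eq_lift_of_modelEdge_eq.and hψ).mono fun q hq => hq.1 _ hq.2
  obtain ⟨R, hR, hball⟩ := Metric.eventually_nhds_iff_ball.1
    ((hψc.and h.factor_pos).and (h.contDiffAt_sqrt.and hlift))
  -- The second coordinate of ψ and v√m have equal squares, and v√m has no zero on a half-disc;
  -- connectedness makes the sign constant there.
  have hsign : ∀ σ : ℝ, ∃ s : ℝ, (s = 1 ∨ s = -1) ∧
      ∀ q ∈ halfDisc R σ, ψ q 1 = s * (q 1 * √(m q)) := by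
    intro σ
    have hc1 : ContinuousOn (fun q => ψ q 1) (halfDisc R σ) := fun q hq =>
      ((EuclideanSpace.proj 1 : E2 →L[ℝ] ℝ).continuous.continuousAt.comp
        (hball q hq.1).1.1).continuousWithinAt
    have hc2 : ContinuousOn (fun q => q 1 * √(m q)) (halfDisc R σ) := fun q hq =>
      (((EuclideanSpace.proj 1 : E2 →L[ℝ] ℝ).continuous.continuousAt).mul
        (hball q hq.1).2.1.continuousAt).continuousWithinAt
    have := (isPreconnected_halfDisc R σ).eq_or_eq_neg_of_sq_eq hc1 hc2 ?_ ?_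
    · rcases this with e | e
      · exact ⟨1, Or.inl rfl, fun q hq => by simpa using e hq⟩
      · exact ⟨-1, Or.inr rfl, fun q hq => by simpa using e hq⟩
    · intro q hq
      obtain ⟨s, hs, e⟩ := (hball q hq.1).2.2
      simp only [Pi.pow_apply, e, modelLift_apply_one]
      rcases hs with rfl | rfl <;> ring
    · intro q hq
      refine mul_ne_zero ?_ (Real.sqrt_pos.2 (hball q hq.1).1.2).ne'
      exact right_ne_zero_of_mul (ne_of_gt hq.2)
  obtain ⟨s₁, hs₁, h₁⟩ := hsign 1
  obtain ⟨s₂, hs₂, h₂⟩ := hsign (-1)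
  by_cases hss : s₁ = s₂
  · subst hss
    refine ⟨s₁, hs₁, ?_⟩
    filter_upwards [Metric.ball_mem_nhds (0 : E2) hR] with q hq
    obtain ⟨s, -, e⟩ := (hball q hq).2.2
    refine E2.ext_coord (by simp [e]) ?_
    rw [modelLift_apply_one]
    rcases mem_halfDisc_cases hq with hq0 | hq1 | hq1
    · simp [e, hq0]
    · exact h₁ q hq1
    · exact h₂ q hq1
  -- Opposite signs would fold the disc into s₁v ≥ 0, whereas ψ covers a neighbourhood of the origin
  -- by `hopen`.
  · exfalso
    have hneg : s₂ = -s₁ := by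
      rcases hs₁ with rfl | rfl <;> rcases hs₂ with rfl | rfl <;> simp_all
    have hev : ∀ᶠ q in 𝓝 0, 0 ≤ s₁ * ψ q 1 := by
      filter_upwards [Metric.ball_mem_nhds (0 : E2) hR] with q hq
      have hsq : s₁ * s₁ = 1 := by rcases hs₁ with rfl | rfl <;> norm_num
      rcases mem_halfDisc_cases hq with hq0 | hq1 | hq1
      · obtain ⟨s, -, e⟩ := (hball q hq).2.2
        simp [e, hq0]
      · have hq2 : 0 < q 1 := by simpa using hq1.2
        rw [h₁ q hq1, ← mul_assoc, hsq]; positivity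
      · have hq2 : 0 < - q 1 := by simpa using hq1.2
        have e : s₁ * (s₂ * (q 1 * √(m q))) = -q 1 * √(m q) := by
          rw [hneg]; linear_combination (-q 1 * √(m q)) * hsq
        rw [h₂ q hq1, e]; positivity
    have hev' : ∀ᶠ q : E2 in 𝓝 0, 0 ≤ s₁ * q 1 :=
      hopen (show {q : E2 | 0 ≤ s₁ * q 1} ∈ map ψ (𝓝 0) from hev)
    obtain ⟨q, hq1, hq2⟩ := exists_small_sign hev' hs₁
    exact absurd hq2 (not_le.2 hq1)

/-- A lift of an involutive symmetry is an involution. -/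
theorem lift_involutive (h : FactoredSymmetry r α G m) {s : ℝ} (hs : s = 1 ∨ s = -1)
    (hψ : ∀ᶠ q in 𝓝 0, modelEdge α (modelLift α G m s q) = G (modelEdge α q)) :
    ∀ᶠ q in 𝓝 0, modelLift α G m s (modelLift α G m s q) = q := by
  filter_upwards [hψ, (h.tendsto_lift s).eventually hψ, h.tendsto_modelEdge.eventually h.invol,
    h.factor_pos, (h.tendsto_lift s).eventually h.factor_pos] with q h1 h2 h3 h4 h5
  rw [h1, h3] at h2
  have e0 := congrArg (fun y : E3 => y 0) h2
  have e2 := congrArg (fun y : E3 => y 2) h2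
  simp only [modelEdge_apply_zero, modelEdge_apply_two] at e0 e2
  refine E2.ext_coord e2 ?_
  -- The sign s enters twice, so the double lift multiplies v by c > 0. Since the square of c v is
  -- v², the value -v is possible only for v = 0.
  set c := √(m q) * √(m (modelLift α G m s q)) with hc
  have hcpos : 0 < c := mul_pos (Real.sqrt_pos.2 h4) (Real.sqrt_pos.2 h5)
  have hform : modelLift α G m s (modelLift α G m s q) 1 = c * q 1 := by
    rw [modelLift_apply_one, modelLift_apply_one, hc]
    rcases hs with rfl | rfl <;> ring
  rw [hform] at e0 ⊢
  rcases sq_eq_sq_iff_eq_or_eq_neg.1 e0 with e | e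
  · exact e
  · have : (c + 1) * q 1 = 0 := by linarith
    have h0 := (mul_eq_zero.1 this).resolve_left (by positivity)
    simp [h0]

theorem fderiv_comp_zero (h : FactoredSymmetry r α G m) (w : E2) :
    fderiv ℝ (fun q => G (modelEdge α q)) 0 w = w 0 • fderiv ℝ G 0 e3E3 := by
  have hd : DifferentiableAt ℝ G (modelEdge α 0) := by
    simpa using h.differentiableAt_map.self_of_nhds
  have he := h.contDiffAt_modelEdge.self_of_nhds.differentiableAt h.ne_zero
  have hα := h.contDiffAt_coeff.self_of_nhds.differentiableAt h.ne_zero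
  have e := (hd.hasFDerivAt.comp (0 : E2) he.hasFDerivAt).fderiv
  have : fderiv ℝ (modelEdge α) 0 w = w 0 • e3E3 := by
    obtain ⟨k0, k1, k2⟩ := hasFDerivAt_modelEdge_coords hα w
    apply E3.ext_coord
    · rw [k0]; simp [e3E3]
    · rw [k1]; simp [e3E3]
    · rw [k2]; simp [e3E3]
  change fderiv ℝ (G ∘ modelEdge α) 0 w = _
  rw [e, ContinuousLinearMap.comp_apply, this, map_smul, modelEdge_zero]

/-- The derivative of a candidate lift at the origin is invertible. -/
theorem fderiv_lift_zero (h : FactoredSymmetry r α G m) {s : ℝ} (hs : s = 1 ∨ s = -1) :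
    ∃ e : E2 ≃L[ℝ] E2, (e : E2 →L[ℝ] E2) = fderiv ℝ (modelLift α G m s) 0 := by
  have hd := (h.contDiffAt_lift s).self_of_nhds.differentiableAt h.ne_zero
  have hsq := h.contDiffAt_sqrt.self_of_nhds.differentiableAt h.ne_zero
  have hcomp := h.contDiffAt_comp.self_of_nhds.differentiableAt h.ne_zero
  have key : ∀ i : Fin 2, HasFDerivAt (fun q => modelLift α G m s q i)
      ((EuclideanSpace.proj i : E2 →L[ℝ] ℝ).comp (fderiv ℝ (modelLift α G m s) 0)) 0 := fun i =>
    (EuclideanSpace.proj i : E2 →L[ℝ] ℝ).hasFDerivAt.comp (0 : E2) hd.hasFDerivAt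
  -- The derivative is diagonal, with entries the third coordinate of `fderiv ℝ G 0 e3E3` and `s *
  -- √(m 0)`, both nonzero.
  have hinj : Function.Injective (fderiv ℝ (modelLift α G m s) 0) := by
    refine (injective_iff_map_eq_zero _).2 fun w hw => ?_
    have f0 : HasFDerivAt (fun q => modelLift α G m s q 0)
        ((EuclideanSpace.proj 2 : E3 →L[ℝ] ℝ).comp
          (fderiv ℝ (fun q => G (modelEdge α q)) 0)) 0 := by
      simp only [modelLift_apply_zero]
      exact (EuclideanSpace.proj 2 : E3 →L[ℝ] ℝ).hasFDerivAt.comp (0 : E2) hcomp.hasFDerivAt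
    have f1 := (((EuclideanSpace.proj 1 : E2 →L[ℝ] ℝ).hasFDerivAt (x := 0)).mul
      hsq.hasFDerivAt).const_mul s
    have g0 := congrArg (fun L => L w) ((key 0).unique f0)
    have g1 := congrArg (fun L => L w) ((key 1).unique (f1.congr_of_eventuallyEq
      (Eventually.of_forall fun q => modelLift_apply_one α G m s q)))
    simp [hw, h.fderiv_comp_zero] at g0 g1
    have hG := h.toPreservesModel.fderiv_e3 h.continuousAt_coeff h.differentiableAt_map.self_of_nhds
    have hne : fderiv ℝ G 0 e3E3 2 ≠ 0 := by
      intro h2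
      have := h.fderiv_injective.self_of_nhds
        ((E3.ext_coord hG.1 hG.2 h2).trans (map_zero (fderiv ℝ G 0)).symm)
      simpa [e3E3] using congrArg (fun x : E3 => x 2) this
    have hs0 : s ≠ 0 := by rcases hs with rfl | rfl <;> norm_num
    have hm0 : √(m 0) ≠ 0 := (Real.sqrt_pos.2 h.factor_pos_zero).ne'
    apply E2.ext_coord
    · simpa [hne] using g0
    · simpa [hs0, hm0] using g1
  refine ⟨(LinearEquiv.ofInjectiveEndo _ hinj).toContinuousLinearEquiv, ?_⟩
  ext w : 1
  rfl

theorem fderiv_lift_invertible (h : FactoredSymmetry r α G m) {s : ℝ} (hs : s = 1 ∨ s = -1) :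
    ∀ᶠ q in 𝓝 0, ∃ e : E2 ≃L[ℝ] E2, (e : E2 →L[ℝ] E2) = fderiv ℝ (modelLift α G m s) q := by
  obtain ⟨e, he⟩ := h.fderiv_lift_zero hs
  have hc : ContinuousAt (fderiv ℝ (modelLift α G m s)) 0 :=
    ((h.contDiffAt_lift s).self_of_nhds.fderiv_right
      (add_one_le_of_infty_or_omega h.regularity)).continuousAt
  have hn := ContinuousLinearEquiv.nhds e
  rw [he] at hn
  exact hc.eventually hn

end FactoredSymmetry

end Lifts

/-! ### Defects of the candidates and existence of a lift -/

/-- The difference of the two sheets of the model edge over `(v², u)`. -/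
noncomputable def sheetGap (α : E2 → ℝ) (q : E2) : ℝ :=
  modelEdge α q 1 - modelEdge α !₂[q 0, -q 1] 1

namespace FactoredSymmetry

variable {r : WithTop ℕ∞} {α : E2 → ℝ} {G : E3 → E3} {m : E2 → ℝ}

/-- The amount by which a candidate lift fails to lift `G`. -/
noncomputable def defect (α : E2 → ℝ) (G : E3 → E3) (m : E2 → ℝ) (s : ℝ) (q : E2) : ℝ :=
  G (modelEdge α q) 1 - modelEdge α (modelLift α G m s q) 1

theorem contDiffAt_defect (h : FactoredSymmetry r α G m) (s : ℝ) :
    ∀ᶠ q in 𝓝 0, ContDiffAt ℝ r (defect α G m s) q := by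
  filter_upwards [h.contDiffAt_comp, h.contDiffAt_lift s,
    (h.tendsto_lift s).eventually h.contDiffAt_modelEdge] with q h1 h2 h3
  exact (contDiffAt_coord h1 1).sub (contDiffAt_coord (h3.comp q h2) 1)

/-- The first and third coordinates match by construction of the candidate; only the second can
fail. -/
theorem modelEdge_lift_eq_iff (h : FactoredSymmetry r α G m) {s : ℝ} (hs : s = 1 ∨ s = -1) :
    ∀ᶠ q in 𝓝 0, modelEdge α (modelLift α G m s q) = G (modelEdge α q) ↔
      defect α G m s q = 0 := by
  filter_upwards [h.factor_eq, h.factor_pos] with q h1 h2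
  constructor
  · intro e; simp only [defect, e, sub_self]
  · intro e
    refine E3.ext_coord ?_ (sub_eq_zero.1 e).symm (by simp)
    have hss : s ^ 2 = 1 := by rcases hs with rfl | rfl <;> norm_num
    rw [h1, modelEdge_apply_zero, modelLift_apply_one, mul_pow, mul_pow, hss,
      Real.sq_sqrt h2.le, one_mul]

/-- Some point lies over G(g(q)) and must be one of the two candidates, but which one may depend on
q. -/
theorem defect_mul_defect (h : FactoredSymmetry r α G m) :
    ∀ᶠ q in 𝓝 0, defect α G m 1 q * defect α G m (-1) q = 0 := by
  filter_upwards [h.eq_lift_of_modelEdge_eq, h.incl _ univ_mem,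
    h.modelEdge_lift_eq_iff (Or.inl rfl), h.modelEdge_lift_eq_iff (Or.inr rfl)]
    with q h1 ⟨q', _, h2⟩ h3 h4
  obtain ⟨s, hs, rfl⟩ := h1 q' h2
  rcases hs with rfl | rfl
  · rw [h3.1 h2, zero_mul]
  · rw [h4.1 h2, mul_zero]

theorem exists_lift_of_defect (h : FactoredSymmetry r α G m) {s : ℝ} (hs : s = 1 ∨ s = -1)
    (h0 : ∀ᶠ q in 𝓝 0, defect α G m s q = 0) :
    ∀ᶠ q in 𝓝 0, modelEdge α (modelLift α G m s q) = G (modelEdge α q) := by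
  filter_upwards [h0, h.modelEdge_lift_eq_iff hs] with q h1 h2 using h2.2 h1

/-- In the analytic category a symmetry of the image lifts. -/
theorem exists_lift_of_analytic (h : FactoredSymmetry ω α G m) :
    ∃ s : ℝ, (s = 1 ∨ s = -1) ∧
      ∀ᶠ q in 𝓝 0, modelEdge α (modelLift α G m s q) = G (modelEdge α q) := by
  obtain ⟨R, hR, hball⟩ := Metric.eventually_nhds_iff_ball.1
    (h.defect_mul_defect.and ((h.contDiffAt_defect 1).and (h.contDiffAt_defect (-1))))
  by_cases hz : ∀ q ∈ Metric.ball (0 : E2) R, defect α G m 1 q = 0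
  · exact ⟨1, Or.inl rfl, h.exists_lift_of_defect (Or.inl rfl)
      (eventually_of_mem (Metric.ball_mem_nhds _ hR) hz)⟩
  · push Not at hz
    obtain ⟨a, ha, hne⟩ := hz
    -- The second defect vanishes near `a`, where the first does not, hence on the whole ball by the
    -- identity theorem.
    have han : AnalyticOnNhd ℝ (defect α G m (-1)) (Metric.ball 0 R) := fun q hq =>
      (hball q hq).2.2.analyticAt
    have hev : defect α G m (-1) =ᶠ[𝓝 a] 0 := by
      filter_upwards [(hball a ha).2.1.continuousAt.eventually_ne hne,
        Metric.isOpen_ball.mem_nhds ha] with q hq hqb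
      exact (mul_eq_zero.1 (hball q hqb).1).resolve_left hq
    have := han.eqOn_zero_of_preconnected_of_eventuallyEq_zero
      (convex_ball _ _).isPreconnected ha hev
    exact ⟨-1, Or.inr rfl, h.exists_lift_of_defect (Or.inr rfl)
      (eventually_of_mem (Metric.ball_mem_nhds _ hR) this)⟩

/-- The two candidates are mirror images in v. This turns a common critical zero of the defects into
a tangency of the sheets. -/
theorem sheetGap_lift (α : E2 → ℝ) (G : E3 → E3) (m : E2 → ℝ) (q : E2) :
    sheetGap α (modelLift α G m 1 q) = defect α G m (-1) q - defect α G m 1 q := by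
  have e : (!₂[modelLift α G m 1 q 0, -modelLift α G m 1 q 1] : E2) = modelLift α G m (-1) q := by
    apply E2.ext_coord <;> simp
  simp only [sheetGap, e, defect]
  ring

/-- If the two sheets of the model edge are nowhere tangent off the singular axis, a symmetry of
the image lifts. -/
theorem exists_lift_of_transverse (h : FactoredSymmetry r α G m)
    (hgap : ∀ᶠ q in 𝓝 (0 : E2), q 1 ≠ 0 → sheetGap α q = 0 → fderiv ℝ (sheetGap α) q ≠ 0) :
    ∃ s : ℝ, (s = 1 ∨ s = -1) ∧
      ∀ᶠ q in 𝓝 0, modelEdge α (modelLift α G m s q) = G (modelEdge α q) := by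
  have h1r := one_le_of_infty_or_omega h.regularity
  have hcoeff : ∀ᶠ q in 𝓝 (0 : E2), DifferentiableAt ℝ (sheetGap α) q := by
    have hflip : Continuous fun q : E2 => (!₂[q 0, -q 1] : E2) := by
      refine (PiLp.continuous_toLp 2 _).comp (continuous_pi fun i => ?_)
      fin_cases i <;> simp <;> fun_prop
    have hf0 : Tendsto (fun q : E2 => (!₂[q 0, -q 1] : E2)) (𝓝 0) (𝓝 0) := by
      have e : (!₂[(0 : E2) 0, -(0 : E2) 1] : E2) = 0 := by apply E2.ext_coord <;> simp
      simpa only [e] using hflip.tendsto 0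
    filter_upwards [h.contDiffAt_modelEdge, hf0.eventually h.contDiffAt_modelEdge] with q k1 k2
    have hfd : ContDiffAt ℝ r (fun q : E2 => (!₂[q 0, -q 1] : E2)) q := by
      rw [contDiffAt_euclidean]
      intro i
      fin_cases i
      · simpa using contDiffAt_coord contDiffAt_id 0
      · simpa using (contDiffAt_coord contDiffAt_id 1).neg
    exact ((contDiffAt_coord k1 1).sub
      (contDiffAt_coord (k2.comp q hfd) 1)).differentiableAt h.ne_zero
  obtain ⟨R, hR, hball⟩ := Metric.eventually_nhds_iff_ball.1
    (((h.defect_mul_defect.and ((h.contDiffAt_defect 1).and (h.contDiffAt_defect (-1)))).and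
    (((h.tendsto_lift 1).eventually (hgap.and hcoeff)).and
      ((h.fderiv_lift_invertible (Or.inl rfl)).and (h.contDiffAt_lift 1)))).and
    ((h.factor_pos.and h.axis_to_axis).and (h.eq_lift_of_modelEdge_eq.and
      ((h.modelEdge_lift_eq_iff (Or.inl rfl)).and (h.modelEdge_lift_eq_iff (Or.inr rfl))))))
  have hhalf : ∀ σ : ℝ, ∃ s : ℝ, (s = 1 ∨ s = -1) ∧ ∀ q ∈ halfDisc R σ, defect α G m s q = 0 := by
    intro σ
    have hcd : ∀ s : ℝ, (s = 1 ∨ s = -1) → ContDiffOn ℝ 1 (defect α G m s) (halfDisc R σ) := by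
      rintro s (rfl | rfl) q hq
      · exact ((hball q hq.1).1.1.2.1.of_le h1r).contDiffWithinAt
      · exact ((hball q hq.1).1.1.2.2.of_le h1r).contDiffWithinAt
    have key : (∀ q ∈ halfDisc R σ, defect α G m 1 q = 0) ∨
        (∀ q ∈ halfDisc R σ, defect α G m (-1) q = 0) := by
      refine eq_zero_or_eq_zero_of_no_common_critical_zero (isOpen_halfDisc R σ)
        (isPreconnected_halfDisc R σ) (hcd 1 (Or.inl rfl)) (hcd (-1) (Or.inr rfl))
        (fun q hq => (hball q hq.1).1.1.1) ?_
      -- At a common critical zero the gap composed with the lift vanishes to first order. The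
      -- derivative of the lift is invertible, so the gap itself does, against `hgap`.
      intro q hq z1 z2 d1 d2
      obtain ⟨⟨⟨-, c1, c2⟩, ⟨hg, hgd⟩, ⟨e, he⟩, hl⟩, ⟨hm, -⟩, -⟩ := hball q hq.1
      have hq1 : q 1 ≠ 0 := right_ne_zero_of_mul (ne_of_gt hq.2)
      refine hg ?_ (by rw [sheetGap_lift, z1, z2, sub_zero]) ?_
      · simp [hq1, (Real.sqrt_pos.2 hm).ne']
      · have hchain : HasFDerivAt (fun q => sheetGap α (modelLift α G m 1 q))
            ((fderiv ℝ (sheetGap α) (modelLift α G m 1 q)).comp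
              (fderiv ℝ (modelLift α G m 1) q)) q :=
          hgd.hasFDerivAt.comp q (hl.differentiableAt h.ne_zero).hasFDerivAt
        have hdiff := (c2.differentiableAt h.ne_zero).hasFDerivAt.sub
          (c1.differentiableAt h.ne_zero).hasFDerivAt
        have hu := hchain.unique (hdiff.congr_of_eventuallyEq
          (Eventually.of_forall fun q => sheetGap_lift α G m q))
        rw [d1, d2, sub_zero, ← he] at hu
        ext w
        have := congrArg (fun L => L (e.symm w)) hu
        simpa using this
    rcases key with h0 | h0
    · exact ⟨1, Or.inl rfl, h0⟩
    · exact ⟨-1, Or.inr rfl, h0⟩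
  obtain ⟨s₁, hs₁, h₁⟩ := hhalf 1
  obtain ⟨s₂, hs₂, h₂⟩ := hhalf (-1)
  have hlift : ∀ {s : ℝ}, (s = 1 ∨ s = -1) → ∀ q ∈ Metric.ball (0 : E2) R,
      defect α G m s q = 0 → modelEdge α (modelLift α G m s q) = G (modelEdge α q) := by
    rintro s (rfl | rfl) q hq hz
    · exact (hball q hq).2.2.2.1.2 hz
    · exact (hball q hq).2.2.2.2.2 hz
  have haxis : ∀ s : ℝ, ∀ q ∈ Metric.ball (0 : E2) R, q 1 = 0 → defect α G m s q = 0 := by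
    intro s q hq hq0
    simp [defect, ((hball q hq).2.1.2 hq0).2, hq0]
  by_cases hss : s₁ = s₂
  · subst hss
    refine ⟨s₁, hs₁, h.exists_lift_of_defect hs₁ ?_⟩
    filter_upwards [Metric.ball_mem_nhds (0 : E2) hR] with q hq
    rcases mem_halfDisc_cases hq with hq0 | hq1 | hq1
    · exact haxis _ q hq hq0
    · exact h₁ q hq1
    · exact h₂ q hq1
  · exfalso
    have hneg : s₂ = -s₁ := by
      rcases hs₁ with rfl | rfl <;> rcases hs₂ with rfl | rfl <;> simp_all
    have hsq : s₁ * s₁ = 1 := by rcases hs₁ with rfl | rfl <;> norm_num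
    -- With opposite signs on the two halves, both halves lift to the side s₁v ≥ 0.
    have himg : ∀ q ∈ Metric.ball (0 : E2) R, ∃ s : ℝ, (s = 1 ∨ s = -1) ∧
        modelEdge α (modelLift α G m s q) = G (modelEdge α q) ∧
        0 ≤ s₁ * modelLift α G m s q 1 := by
      intro q hq
      have hmp := Real.sqrt_nonneg (m q)
      rcases mem_halfDisc_cases hq with hq0 | hq1 | hq1
      · exact ⟨1, Or.inl rfl, hlift (Or.inl rfl) q hq (haxis _ q hq hq0), by simp [hq0]⟩
      · refine ⟨s₁, hs₁, hlift hs₁ q hq (h₁ q hq1), ?_⟩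
        have hq2 : 0 < q 1 := by simpa using hq1.2
        rw [modelLift_apply_one, ← mul_assoc, hsq]; positivity
      · refine ⟨s₂, hs₂, hlift hs₂ q hq (h₂ q hq1), ?_⟩
        have hq2 : 0 < - q 1 := by simpa using hq1.2
        have e : s₁ * (s₂ * (q 1 * √(m q))) = -q 1 * √(m q) := by
          rw [hneg]; linear_combination (-q 1 * √(m q)) * hsq
        rw [modelLift_apply_one, e]; positivity
    have hBnhds := Metric.ball_mem_nhds (0 : E2) hR
    -- Applying `himg` twice, together with G ∘ G = id, gives every g(q) a preimage with s₁v ≥ 0. If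
    -- s₁v < 0 at q, this is the mirror point, so the gap vanishes on an open set and is critical
    -- there, against `hgap`.
    have hzero : ∀ᶠ q : E2 in 𝓝 0, s₁ * q 1 < 0 → sheetGap α q = 0 := by
      filter_upwards [hBnhds, (h.tendsto_lift 1).eventually hBnhds,
        (h.tendsto_lift (-1)).eventually hBnhds, h.tendsto_modelEdge.eventually h.invol]
        with q k0 k1 k2 k3 hlt
      obtain ⟨s, hs, e1, -⟩ := himg q k0
      have hmem : modelLift α G m s q ∈ Metric.ball (0 : E2) R := by
        rcases hs with rfl | rfl <;> assumption
      obtain ⟨s', -, e2, hpos⟩ := himg _ hmem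
      set q'' := modelLift α G m s' (modelLift α G m s q)
      rw [e1, k3] at e2
      have f0 := congrArg (fun y : E3 => y 0) e2
      have f2 := congrArg (fun y : E3 => y 2) e2
      simp only [modelEdge_apply_zero, modelEdge_apply_two] at f0 f2
      have hq'' : q'' = !₂[q 0, -q 1] := by
        refine E2.ext_coord (by simpa using f2) ?_
        rcases sq_eq_sq_iff_eq_or_eq_neg.1 f0 with e | e
        · rw [e] at hpos; linarith
        · simpa using e
      rw [hq''] at e2
      simp only [sheetGap, e2, sub_self]
    obtain ⟨q, hq1, hq2, hq3⟩ := exists_small_sign (hzero.eventually_nhds.and hgap) hs₁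
    have hc : Continuous fun q : E2 => s₁ * q 1 :=
      continuous_const.mul (EuclideanSpace.proj 1 : E2 →L[ℝ] ℝ).continuous
    have hflat : sheetGap α =ᶠ[𝓝 q] fun _ => 0 := by
      filter_upwards [hq2, (hc.tendsto q).eventually (gt_mem_nhds hq1)] with x hx hx1
      exact hx hx1
    refine hq3 (right_ne_zero_of_mul hq1.ne) hflat.self_of_nhds ?_
    rw [hflat.fderiv_eq]; simp

end FactoredSymmetry

/-! ### Involutive germs of the line -/

section OneVariable

theorem exists_strictMonoOn_of_deriv_pos {h : ℝ → ℝ} (hc : ContDiffAt ℝ 1 h 0)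
    (hd : 0 < deriv h 0) : ∃ δ > 0, ContinuousOn h (Ioo (-δ) δ) ∧ StrictMonoOn h (Ioo (-δ) δ) := by
  have hev : ∀ᶠ t in 𝓝 (0 : ℝ), ContinuousAt h t ∧ 0 < deriv h t := by
    have h1 : ∀ᶠ t in 𝓝 (0 : ℝ), ContDiffAt ℝ 1 h t := hc.eventually (by decide)
    have h2 : ContinuousAt (deriv h) 0 := by
      have := (hc.fderiv_right (m := 0) (by norm_num)).continuousAt
      exact this.clm_apply continuousAt_const
    filter_upwards [h1, h2.eventually (lt_mem_nhds hd)] with t k1 k2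
    exact ⟨k1.continuousAt, k2⟩
  obtain ⟨δ, hδ, hball⟩ := Metric.eventually_nhds_iff_ball.1 hev
  rw [Real.ball_eq_Ioo, zero_sub, zero_add] at hball
  have hcont : ContinuousOn h (Ioo (-δ) δ) := fun t ht => (hball t ht).1.continuousWithinAt
  refine ⟨δ, hδ, hcont, strictMonoOn_of_deriv_pos (convex_Ioo _ _) hcont ?_⟩
  rw [interior_Ioo]
  exact fun t ht => (hball t ht).2

theorem exists_strictAntiOn_of_deriv_neg {h : ℝ → ℝ} (hc : ContDiffAt ℝ 1 h 0)
    (hd : deriv h 0 < 0) : ∃ δ > 0, ContinuousOn h (Ioo (-δ) δ) ∧ StrictAntiOn h (Ioo (-δ) δ) := by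
  obtain ⟨δ, hδ, h1, h2⟩ := exists_strictMonoOn_of_deriv_pos (h := fun t => -h t) hc.neg
    (by simpa using hd)
  exact ⟨δ, hδ, h1.neg.congr fun t _ => (neg_neg (h t)).symm, by simpa using h2.neg⟩

/-- An involutive germ of the line with positive derivative is the identity. -/
theorem eventually_eq_self_of_involutive {h : ℝ → ℝ} (hc : ContDiffAt ℝ 1 h 0) (h0 : h 0 = 0)
    (hd : 0 < deriv h 0) (hinv : ∀ᶠ t in 𝓝 0, h (h t) = t) : ∀ᶠ t in 𝓝 0, h t = t := by
  obtain ⟨δ, hδ, -, hmono⟩ := exists_strictMonoOn_of_deriv_pos hc hd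
  have hI : Ioo (-δ) δ ∈ 𝓝 (0 : ℝ) := Ioo_mem_nhds (by linarith) hδ
  have ht : Tendsto h (𝓝 0) (𝓝 0) := by simpa [h0] using hc.continuousAt.tendsto
  filter_upwards [hinv, hI, ht.eventually hI] with t k1 k2 k3
  -- As h is increasing, h t < t would give t = h (h t) < h t, and symmetrically in the other case.
  rcases lt_trichotomy (h t) t with h1 | h1 | h1
  · have := hmono k3 k2 h1
    rw [k1] at this; linarith
  · exact h1
  · have := hmono k2 k3 h1
    rw [k1] at this; linarith

end OneVariable

/-! ### Action on the singular axis -/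

namespace ModelSymmetry

variable {r : WithTop ℕ∞} {α : E2 → ℝ} {G : E3 → E3}

/-- The map induced by a symmetry on the image of the singular axis. -/
noncomputable def axisMap (G : E3 → E3) (u : ℝ) : ℝ := G (u • e3E3) 2

theorem modelEdge_axis (α : E2 → ℝ) {q : E2} (hq : q 1 = 0) : modelEdge α q = q 0 • e3E3 := by
  apply E3.ext_coord <;> simp [hq, e3E3]

theorem tendsto_axis : Tendsto (fun u : ℝ => u • e3E3) (𝓝 0) (𝓝 0) := by
  have : Continuous fun u : ℝ => u • e3E3 := by fun_prop
  simpa using this.tendsto 0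

theorem apply_axis (h : ModelSymmetry r α G) :
    ∀ᶠ u in 𝓝 (0 : ℝ), G (u • e3E3) = axisMap G u • e3E3 := by
  have hc : Continuous fun u : ℝ => (!₂[u, 0] : E2) := by
    refine (PiLp.continuous_toLp 2 _).comp (continuous_pi fun i => ?_)
    fin_cases i <;> simp <;> fun_prop
  have h0 : (!₂[(0 : ℝ), 0] : E2) = 0 := by apply E2.ext_coord <;> simp
  have := hc.tendsto 0
  rw [h0] at this
  filter_upwards [this.eventually h.axis_to_axis] with u hu
  have hu := hu (by simp)
  rw [modelEdge_axis α (by simp)] at hu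
  simp only [Matrix.cons_val_zero] at hu
  apply E3.ext_coord
  · rw [hu.1]; simp [e3E3]
  · rw [hu.2]; simp [e3E3]
  · simp [e3E3, axisMap]

theorem axisMap_zero (h : ModelSymmetry r α G) : axisMap G 0 = 0 := by
  simp [axisMap, h.map_zero]

theorem contDiffAt_axisMap (h : ModelSymmetry r α G) : ContDiffAt ℝ 1 (axisMap G) 0 := by
  have h1 : ContDiffAt ℝ 1 (fun u : ℝ => u • e3E3) 0 := contDiffAt_id.smul contDiffAt_const
  have h2 : ContDiffAt ℝ 1 G ((0 : ℝ) • e3E3) := by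
    rw [zero_smul]
    exact h.contDiffAt_map.self_of_nhds.of_le (one_le_of_infty_or_omega h.regularity)
  exact contDiffAt_coord (h2.comp (0 : ℝ) h1) 2

theorem deriv_axisMap (h : ModelSymmetry r α G) {ε : ℝ} (hε : fderiv ℝ G 0 e3E3 = ε • e3E3) :
    deriv (axisMap G) 0 = ε := by
  have h1 : HasDerivAt (fun u : ℝ => u • e3E3) e3E3 0 := by
    simpa using (hasDerivAt_id (0 : ℝ)).smul_const e3E3
  have h2 : HasFDerivAt G (fderiv ℝ G 0) ((0 : ℝ) • e3E3) := by
    rw [zero_smul]; exact h.differentiableAt_map.self_of_nhds.hasFDerivAt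
  have h3 := (EuclideanSpace.proj 2 : E3 →L[ℝ] ℝ).hasFDerivAt.comp_hasDerivAt (0 : ℝ)
    (h2.comp_hasDerivAt (0 : ℝ) h1)
  have h4 : HasDerivAt (axisMap G) _ 0 := h3
  rw [h4.deriv, hε]
  simp [e3E3]

theorem axisMap_involutive (h : ModelSymmetry r α G) :
    ∀ᶠ u in 𝓝 0, axisMap G (axisMap G u) = u := by
  have ht : Tendsto (axisMap G) (𝓝 0) (𝓝 0) := by
    simpa [h.axisMap_zero] using h.contDiffAt_axisMap.continuousAt.tendsto
  filter_upwards [h.apply_axis, ht.eventually h.apply_axis, tendsto_axis.eventually h.invol]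
    with u h1 h2 h3
  rw [h1, h2] at h3
  simpa [e3E3] using congrArg (fun y : E3 => y 2) h3

/-- A symmetry fixing the direction of the axis fixes the image of the axis pointwise. -/
theorem apply_eq_self_on_axis (h : ModelSymmetry r α G) (hε : fderiv ℝ G 0 e3E3 = e3E3) :
    ∀ᶠ q in 𝓝 (0 : E2), q 1 = 0 → G (modelEdge α q) = modelEdge α q := by
  have hd := h.deriv_axisMap (ε := 1) (by simpa using hε)
  have h1 := eventually_eq_self_of_involutive h.contDiffAt_axisMap h.axisMap_zero
    (by rw [hd]; exact one_pos) h.axisMap_involutive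
  have hp : Tendsto (fun q : E2 => q 0) (𝓝 0) (𝓝 0) :=
    (EuclideanSpace.proj 0 : E2 →L[ℝ] ℝ).continuous.tendsto' 0 0 (by simp)
  filter_upwards [hp.eventually h1, hp.eventually h.apply_axis] with q k1 k2 hq
  rw [modelEdge_axis α hq, k2, k1]

end ModelSymmetry

/-! ### Orthogonal maps in an adapted frame -/

section LinearPart

theorem exists_combination_of_orthogonal {a b c : E3} (ha : a ≠ 0) (hb : b ≠ 0) (hc : c ≠ 0)
    (hab : inner ℝ a b = 0) (hac : inner ℝ a c = 0) (hbc : inner ℝ b c = 0) (y : E3) :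
    ∃ x₁ x₂ x₃ : ℝ, y = x₁ • a + x₂ • b + x₃ • c := by
  have hli : LinearIndependent ℝ ![a, b, c] := by
    refine linearIndependent_of_ne_zero_of_inner_eq_zero (𝕜 := ℝ) ?_ ?_
    · intro i; fin_cases i <;> assumption
    · intro i j hij
      fin_cases i <;> fin_cases j <;>
        first
        | exact absurd rfl hij
        | assumption
        | (rw [real_inner_comm]; assumption)
  have hspan := hli.span_eq_top_of_card_eq_finrank (by simp)
  have hy : y ∈ Submodule.span ℝ (Set.range ![a, b, c]) := by rw [hspan]; trivial
  rw [Submodule.mem_span_range_iff_exists_fun] at hy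
  obtain ⟨x, hx⟩ := hy
  refine ⟨x 0, x 1, x 2, ?_⟩
  rw [← hx, Fin.sum_univ_three]
  rfl

theorem eq_one_or_neg_one_of_isometry {L : E3 ≃ₗᵢ[ℝ] E3} {x : E3} (hx : x ≠ 0) {c : ℝ}
    (h : L x = c • x) : c = 1 ∨ c = -1 := by
  have h1 : ‖c • x‖ = ‖x‖ := by rw [← h, L.norm_map]
  rw [norm_smul, mul_eq_right₀ (norm_ne_zero_iff.2 hx)] at h1
  exact eq_or_eq_neg_of_abs_eq h1

/-- An orthogonal map preserving a half-plane with boundary `ℝ τ` is diagonal in an adapted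
orthogonal frame, and fixes the inner conormal direction. -/
theorem exists_adapted_frame {L : E3 ≃ₗᵢ[ℝ] E3} {τ ξ n : E3} (hτ : τ ≠ 0)
    (hξ : ∀ x : ℝ, ξ ≠ x • τ) (hn : n ≠ 0) (hnτ : inner ℝ τ n = 0) (hnξ : inner ℝ ξ n = 0)
    {a b c : ℝ} (ha : 0 ≤ a) (hLτ : L τ = c • τ) (hLξ : L ξ = a • ξ + b • τ) :
    (c = 1 ∨ c = -1) ∧ ∃ e : E3, e ≠ 0 ∧ inner ℝ τ e = 0 ∧ inner ℝ e n = 0 ∧ L e = e ∧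
      (L n = n ∨ L n = -n) := by
  have hc := eq_one_or_neg_one_of_isometry hτ hLτ
  refine ⟨hc, ?_⟩
  have hc0 : c ≠ 0 := by rcases hc with rfl | rfl <;> norm_num
  have hττ : inner ℝ τ τ ≠ (0 : ℝ) := inner_self_ne_zero.2 hτ
  -- The vector e is the part of ξ orthogonal to τ. Orthogonality removes the τ-component of L e, so
  -- L e = a e; then a = ±1 and a ≥ 0 give a = 1.
  set k : ℝ := inner ℝ τ ξ / inner ℝ τ τ with hk
  set e : E3 := ξ - k • τ with he
  have he0 : e ≠ 0 := sub_ne_zero.2 (hξ k)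
  have hτe : inner ℝ τ e = 0 := by
    rw [he, inner_sub_right, inner_smul_right, hk]; field_simp; ring
  have hen : inner ℝ e n = 0 := by
    rw [he, inner_sub_left, inner_smul_left, hnξ, hnτ]; simp
  have hLe' : ∃ z : ℝ, L e = a • e + z • τ := by
    refine ⟨a * k + b - k * c, ?_⟩
    rw [he, map_sub, map_smul, hLξ, hLτ]; module
  obtain ⟨z, hz⟩ := hLe'
  have hz0 : z = 0 := by
    have h1 : inner ℝ (L τ) (L e) = 0 := by rw [L.inner_map_map, hτe]
    rw [hLτ, hz, inner_smul_left, inner_add_right, inner_smul_right, inner_smul_right, hτe] at h1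
    simpa [hc0, hτ] using h1
  rw [hz0, zero_smul, add_zero] at hz
  have ha1 : a = 1 := by
    rcases eq_one_or_neg_one_of_isometry he0 hz with h | h
    · exact h
    · linarith
  rw [ha1, one_smul] at hz
  refine ⟨e, he0, hτe, hen, hz, ?_⟩
  obtain ⟨x₁, x₂, x₃, hx⟩ := exists_combination_of_orthogonal hτ he0 hn hτe hnτ hen (L n)
  have h1 : inner ℝ (L τ) (L n) = 0 := by rw [L.inner_map_map, hnτ]
  have h2 : inner ℝ (L e) (L n) = 0 := by rw [L.inner_map_map, hen]
  have hee : inner ℝ e e ≠ (0 : ℝ) := inner_self_ne_zero.2 he0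
  have heτ : inner ℝ e τ = 0 := by rw [real_inner_comm]; exact hτe
  rw [hLτ, hx] at h1
  rw [hz, hx] at h2
  simp only [inner_add_right, inner_smul_right, inner_smul_left, hτe, hnτ, hen, heτ] at h1 h2
  have hx1 : x₁ = 0 := by simpa [hc0, hτ] using h1
  have hx2 : x₂ = 0 := by simpa [he0] using h2
  rw [hx1, hx2, zero_smul, zero_smul, add_zero, zero_add] at hx
  rcases eq_one_or_neg_one_of_isometry hn hx with h | h
  · left; rw [hx, h, one_smul]
  · right; rw [hx, h]; simp

/-- The linear part of an isometry of space. -/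
noncomputable def linearPart (T : E3 ≃ᵢ E3) : E3 ≃ₗᵢ[ℝ] E3 :=
  T.toRealAffineIsometryEquiv.linearIsometryEquiv

theorem apply_eq_linearPart (T : E3 ≃ᵢ E3) {x₀ : E3} (h : T x₀ = x₀) (x : E3) :
    T x = linearPart T (x - x₀) + x₀ := by
  have h1 := T.toRealAffineIsometryEquiv.map_vsub x x₀
  simp only [IsometryEquiv.coeFn_toRealAffineIsometryEquiv, vsub_eq_sub, h] at h1
  rw [linearPart, h1, sub_add_cancel]

theorem eq_reflection_of_frame {T : E3 ≃ᵢ E3} {x₀ : E3} (hT : T x₀ = x₀)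
    (S : AffineSubspace ℝ E3) [Nonempty S] (hS : x₀ ∈ S) {a b c : E3}
    (hspan : ∀ y : E3, ∃ x₁ x₂ x₃ : ℝ, y = x₁ • a + x₂ • b + x₃ • c)
    (hframe : ∀ y : E3, y = a ∨ y = b ∨ y = c → (y ∈ S.direction ∧ linearPart T y = y) ∨
      (y ∈ S.directionᗮ ∧ linearPart T y = -y)) :
    T = (EuclideanGeometry.reflection S).toIsometryEquiv := by
  ext1 x
  have hR : ∀ y : E3, y = a ∨ y = b ∨ y = c → S.direction.reflection y = linearPart T y := by
    intro y hy
    rcases hframe y hy with ⟨h1, h2⟩ | ⟨h1, h2⟩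
    · rw [h2, Submodule.reflection_mem_subspace_eq_self h1]
    · rw [h2, Submodule.reflection_mem_subspace_orthogonalComplement_eq_neg h1]
  change T x = EuclideanGeometry.reflection S x
  rw [EuclideanGeometry.reflection_apply_of_mem S x hS, apply_eq_linearPart T hT, vsub_eq_sub,
    vadd_eq_add]
  congr 1
  obtain ⟨x₁, x₂, x₃, hx⟩ := hspan (x - x₀)
  rw [hx]
  simp only [map_add, map_smul, hR a (Or.inl rfl), hR b (Or.inr (Or.inl rfl)),
    hR c (Or.inr (Or.inr rfl))]

theorem involutive_of_frame {T : E3 ≃ᵢ E3} {x₀ : E3} (hT : T x₀ = x₀) {a b c : E3}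
    (hspan : ∀ y : E3, ∃ x₁ x₂ x₃ : ℝ, y = x₁ • a + x₂ • b + x₃ • c)
    (hframe : ∀ y : E3, y = a ∨ y = b ∨ y = c → linearPart T y = y ∨ linearPart T y = -y)
    (x : E3) : T (T x) = x := by
  have hR : ∀ y : E3, y = a ∨ y = b ∨ y = c → linearPart T (linearPart T y) = y := by
    intro y hy
    rcases hframe y hy with h | h <;> simp [h]
  rw [apply_eq_linearPart T hT (T x), apply_eq_linearPart T hT x, add_sub_cancel_right]
  obtain ⟨x₁, x₂, x₃, hx⟩ := hspan (x - x₀)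
  rw [hx]
  simp only [map_add, map_smul, hR a (Or.inl rfl), hR b (Or.inr (Or.inl rfl)),
    hR c (Or.inr (Or.inr rfl))]
  rw [← hx, sub_add_cancel]

theorem eq_refl_of_frame {T : E3 ≃ᵢ E3} {x₀ : E3} (hT : T x₀ = x₀) {a b c : E3}
    (hspan : ∀ y : E3, ∃ x₁ x₂ x₃ : ℝ, y = x₁ • a + x₂ • b + x₃ • c)
    (ha : linearPart T a = a) (hb : linearPart T b = b) (hc : linearPart T c = c) :
    T = IsometryEquiv.refl E3 := by
  ext1 x
  rw [apply_eq_linearPart T hT x]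
  obtain ⟨x₁, x₂, x₃, hx⟩ := hspan (x - x₀)
  rw [hx]
  simp only [map_add, map_smul, ha, hb, hc]
  rw [← hx, sub_add_cancel]
  rfl

end LinearPart

/-! ### Charts at a generalized cuspidal edge point -/

section LocalDiffeo

variable {E : Type*} [NormedAddCommGroup E] [NormedSpace ℝ E] {r : WithTop ℕ∞}
  {e : OpenPartialHomeomorph E E}

theorem IsLocalDiffeo.contDiffAt (h : IsLocalDiffeo r e) {x : E} (hx : x ∈ e.source) :
    ContDiffAt ℝ r e x := h.1.contDiffAt (e.open_source.mem_nhds hx)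

theorem IsLocalDiffeo.contDiffAt_symm (h : IsLocalDiffeo r e) {x : E} (hx : x ∈ e.target) :
    ContDiffAt ℝ r e.symm x := h.2.contDiffAt (e.open_target.mem_nhds hx)

theorem IsLocalDiffeo.exists_hasFDerivAt (h : IsLocalDiffeo r e) (hr : r ≠ 0) {x : E}
    (hx : x ∈ e.source) :
    ∃ A : E ≃L[ℝ] E, HasFDerivAt e (A : E →L[ℝ] E) x ∧
      HasFDerivAt e.symm (A.symm : E →L[ℝ] E) (e x) := by
  have h1 := ((h.contDiffAt hx).differentiableAt hr).hasFDerivAt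
  have h2 := ((h.contDiffAt_symm (e.map_source hx)).differentiableAt hr).hasFDerivAt
  have h3 := (h2.comp x h1).unique ((hasFDerivAt_id x).congr_of_eventuallyEq
    (by filter_upwards [e.open_source.mem_nhds hx] with y hy using e.left_inv hy))
  have h1' : HasFDerivAt e (fderiv ℝ e x) (e.symm (e x)) := by rwa [e.left_inv hx]
  have h4 := (h1'.comp (e x) h2).unique ((hasFDerivAt_id (e x)).congr_of_eventuallyEq
    (by filter_upwards [e.open_target.mem_nhds (e.map_source hx)] with y hy using e.right_inv hy))
  let A := ContinuousLinearEquiv.equivOfInverse (fderiv ℝ e x) (fderiv ℝ e.symm (e x))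
    (fun w => by simpa using congrArg (fun L => L w) h3)
    (fun w => by simpa using congrArg (fun L => L w) h4)
  exact ⟨A, h1, h2⟩

end LocalDiffeo

/-- Charts bringing the germ of `f : U → ℝ³` at `p` into the form of the model edge. -/
structure EdgeChart (r : WithTop ℕ∞) (f : E2 → E3) (U : Set E2) (p : E2)
    (φ : OpenPartialHomeomorph E2 E2) (Φ : OpenPartialHomeomorph E3 E3) (α : E2 → ℝ) : Prop where
  regularity : r = ∞ ∨ r = ω
  isOpen : IsOpen U
  mem : p ∈ U
  contDiffOn : ContDiffOn ℝ r f U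
  diffeo_source : IsLocalDiffeo r φ
  diffeo_target : IsLocalDiffeo r Φ
  coeff : ContDiffOn ℝ r α φ.target
  mem_source : p ∈ φ.source
  map_p : φ p = 0
  map_fp : Φ (f p) = 0
  normal_form : ∀ q ∈ φ.source, f q ∈ Φ.source ∧ Φ (f q) = modelEdge α (φ q)

namespace EdgeChart

variable {r : WithTop ℕ∞} {f : E2 → E3} {U : Set E2} {p : E2}
  {φ : OpenPartialHomeomorph E2 E2} {Φ : OpenPartialHomeomorph E3 E3} {α : E2 → ℝ}

theorem ne_zero (h : EdgeChart r f U p φ Φ α) : r ≠ 0 :=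
  (zero_lt_one.trans_le (one_le_of_infty_or_omega h.regularity)).ne'

theorem zero_mem (h : EdgeChart r f U p φ Φ α) : (0 : E2) ∈ φ.target := by
  rw [← h.map_p]; exact φ.map_source h.mem_source

theorem zero_mem_target (h : EdgeChart r f U p φ Φ α) : (0 : E3) ∈ Φ.target := by
  rw [← h.map_fp]; exact Φ.map_source (h.normal_form p h.mem_source).1

theorem symm_zero (h : EdgeChart r f U p φ Φ α) : φ.symm 0 = p := by
  rw [← h.map_p, φ.left_inv h.mem_source]

theorem target_symm_zero (h : EdgeChart r f U p φ Φ α) : Φ.symm 0 = f p := by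
  rw [← h.map_fp, Φ.left_inv (h.normal_form p h.mem_source).1]

theorem tendsto_chart (h : EdgeChart r f U p φ Φ α) : Tendsto φ (𝓝 p) (𝓝 0) := by
  simpa [h.map_p] using (φ.continuousAt h.mem_source).tendsto

theorem tendsto_symm (h : EdgeChart r f U p φ Φ α) : Tendsto φ.symm (𝓝 0) (𝓝 p) := by
  simpa [h.symm_zero] using (φ.continuousAt_symm h.zero_mem).tendsto

theorem tendsto_target_symm (h : EdgeChart r f U p φ Φ α) : Tendsto Φ.symm (𝓝 0) (𝓝 (f p)) := by
  simpa [h.target_symm_zero] using (Φ.continuousAt_symm h.zero_mem_target).tendsto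

theorem source_nhds (h : EdgeChart r f U p φ Φ α) : φ.source ∈ 𝓝 p :=
  φ.open_source.mem_nhds h.mem_source

theorem target_nhds (h : EdgeChart r f U p φ Φ α) : φ.target ∈ 𝓝 (0 : E2) :=
  φ.open_target.mem_nhds h.zero_mem

theorem contDiffAt_coeff (h : EdgeChart r f U p φ Φ α) {q : E2} (hq : q ∈ φ.target) :
    ContDiffAt ℝ r α q := h.coeff.contDiffAt (φ.open_target.mem_nhds hq)

theorem contDiffAt_f (h : EdgeChart r f U p φ Φ α) {x : E2} (hx : x ∈ U) :
    ContDiffAt ℝ r f x := h.contDiffOn.contDiffAt (h.isOpen.mem_nhds hx)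

theorem target_symm_modelEdge (h : EdgeChart r f U p φ Φ α) {x : E2} (hx : x ∈ φ.source) :
    Φ.symm (modelEdge α (φ x)) = f x := by
  rw [← (h.normal_form x hx).2, Φ.left_inv (h.normal_form x hx).1]

theorem modelEdge_eq (h : EdgeChart r f U p φ Φ α) {q : E2} (hq : q ∈ φ.target) :
    modelEdge α q = Φ (f (φ.symm q)) := by
  rw [(h.normal_form _ (φ.map_target hq)).2, φ.right_inv hq]

/-- The chain rule for `f` in the charts. -/
theorem exists_hasFDerivAt (h : EdgeChart r f U p φ Φ α) {x : E2} (hx : x ∈ φ.source) :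
    ∃ (A : E2 ≃L[ℝ] E2) (B : E3 ≃L[ℝ] E3), HasFDerivAt φ (A : E2 →L[ℝ] E2) x ∧
      HasFDerivAt φ.symm (A.symm : E2 →L[ℝ] E2) (φ x) ∧
      HasFDerivAt Φ (B : E3 →L[ℝ] E3) (f x) ∧
      HasFDerivAt Φ.symm (B.symm : E3 →L[ℝ] E3) (modelEdge α (φ x)) ∧
      HasFDerivAt f ((B.symm : E3 →L[ℝ] E3).comp
        ((fderiv ℝ (modelEdge α) (φ x)).comp (A : E2 →L[ℝ] E2))) x := by
  obtain ⟨A, hA1, hA2⟩ := h.diffeo_source.exists_hasFDerivAt h.ne_zero hx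
  obtain ⟨B, hB1, hB2⟩ := h.diffeo_target.exists_hasFDerivAt h.ne_zero (h.normal_form x hx).1
  rw [(h.normal_form x hx).2] at hB2
  refine ⟨A, B, hA1, hA2, hB1, hB2, ?_⟩
  have hg := ((contDiffAt_modelEdge (h.contDiffAt_coeff (φ.map_source hx))).differentiableAt
    h.ne_zero).hasFDerivAt
  refine (hB2.comp x (hg.comp x hA1)).congr_of_eventuallyEq ?_
  filter_upwards [φ.open_source.mem_nhds hx] with y hy
  exact (h.target_symm_modelEdge hy).symm

theorem fderiv_injective_iff (h : EdgeChart r f U p φ Φ α) {x : E2} (hx : x ∈ φ.source) :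
    Function.Injective (fderiv ℝ f x) ↔ φ x 1 ≠ 0 := by
  obtain ⟨A, B, -, -, -, -, hf⟩ := h.exists_hasFDerivAt hx
  rw [← fderiv_modelEdge_injective_iff
    ((h.contDiffAt_coeff (φ.map_source hx)).differentiableAt h.ne_zero), hf.fderiv]
  simp only [ContinuousLinearMap.coe_comp, ContinuousLinearEquiv.coe_coe]
  rw [B.symm.injective.of_comp_iff, Function.Injective.of_comp_iff' _ A.bijective]

theorem mem_singularSet_iff (h : EdgeChart r f U p φ Φ α) {x : E2} (hx : x ∈ φ.source)
    (hxU : x ∈ U) : x ∈ singularSet f U ↔ φ x 1 = 0 := by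
  simp only [singularSet, mem_ofPred_eq, hxU, true_and, h.fderiv_injective_iff hx, not_not]

theorem contDiffAt_fderiv_target (h : EdgeChart r f U p φ Φ α) {x : E2} (hx : x ∈ φ.source)
    (hxU : x ∈ U) : ContDiffAt ℝ r (fun y => fderiv ℝ Φ (f y)) x :=
  ((h.diffeo_target.contDiffAt (h.normal_form x hx).1).fderiv_right
    (add_one_le_of_infty_or_omega h.regularity)).comp x (h.contDiffAt_f hxU)

end EdgeChart

/-! ### Unit normal field and singular curve -/

section NormalField

/-- A covector field annihilating the differential of the model edge. -/
noncomputable def modelConormal (α : E2 → ℝ) (q : E2) : E3 :=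
  !₂[-(3 * q 1 * α q + q 1 ^ 2 * fderiv ℝ α q e2v), 2,
    -(2 * q 1 ^ 3 * fderiv ℝ α q !₂[1, 0])]

/-- The conormal is the cross product ∂ᵤg × ∂ᵥg with its factor v removed. Its middle entry is then
2, so it stays nonzero on the axis. -/
theorem inner_fderiv_modelConormal {α : E2 → ℝ} {q : E2} (hα : DifferentiableAt ℝ α q) (w : E2) :
    inner ℝ (fderiv ℝ (modelEdge α) q w) (modelConormal α q) = 0 := by
  obtain ⟨k0, k1, k2⟩ := hasFDerivAt_modelEdge_coords hα w
  have hw : w = w 0 • !₂[1, 0] + w 1 • e2v := by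
    apply E2.ext_coord <;> simp [e2v]
  have hαw : fderiv ℝ α q w = w 0 * fderiv ℝ α q !₂[1, 0] + w 1 * fderiv ℝ α q e2v := by
    conv_lhs => rw [hw]
    simp only [map_add, map_smul, smul_eq_mul]
  simp only [PiLp.inner_apply, Fin.sum_univ_three, k0, k1, k2, hαw, modelConormal]
  simp
  ring

/-- The transpose of a linear map of space, applied to a vector. -/
noncomputable def transposeApply (B : E3 →L[ℝ] E3) (N : E3) : E3 :=
  WithLp.toLp 2 fun i => inner ℝ (B (EuclideanSpace.single i 1)) N

theorem inner_transposeApply (B : E3 →L[ℝ] E3) (N w : E3) :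
    inner ℝ w (transposeApply B N) = inner ℝ (B w) N := by
  have hw : w = ∑ i, w i • EuclideanSpace.single i (1 : ℝ) := by
    ext j; simp [Pi.single_apply]
  conv_rhs => rw [hw]
  simp only [map_sum, map_smul, sum_inner, inner_smul_left, transposeApply, PiLp.inner_apply]
  simp [mul_comm]

variable {r : WithTop ℕ∞} {f : E2 → E3} {U : Set E2} {p : E2}
  {φ : OpenPartialHomeomorph E2 E2} {Φ : OpenPartialHomeomorph E3 E3} {α : E2 → ℝ}

theorem contDiffAt_modelConormal (hr : r = ∞ ∨ r = ω) {q : E2} (hα : ContDiffAt ℝ r α q) :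
    ContDiffAt ℝ r (modelConormal α) q := by
  have h1 : ContDiffAt ℝ r (fun q : E2 => q 1) q := contDiffAt_coord contDiffAt_id 1
  have hd : ∀ w : E2, ContDiffAt ℝ r (fun q => fderiv ℝ α q w) q := fun w =>
    (hα.fderiv_right (add_one_le_of_infty_or_omega hr)).clm_apply contDiffAt_const
  rw [contDiffAt_euclidean]
  intro i
  fin_cases i
  · simpa [modelConormal] using
      (((contDiffAt_const (c := (3 : ℝ))).mul h1).mul hα).add ((h1.pow 2).mul (hd e2v)) |>.neg
  · simpa [modelConormal] using contDiffAt_const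
  · simpa [modelConormal] using
      (((contDiffAt_const (c := (2 : ℝ))).mul (h1.pow 3)).mul (hd !₂[1, 0])).neg

theorem exists_open_of_eventually {P : E2 → Prop} {x : E2} (h : ∀ᶠ y in 𝓝 x, P y) :
    ∃ W : Set E2, IsOpen W ∧ x ∈ W ∧ ∀ y ∈ W, P y := by
  obtain ⟨W, hW, hWo, hx⟩ := mem_nhds_iff.1 h
  exact ⟨W, hWo, hx, hW⟩

/-- Normals transform by the transpose of the derivative of `Φ`, so the conormal of the model is
pulled back and normalized. -/
theorem EdgeChart.exists_unitNormal (h : EdgeChart r f U p φ Φ α) :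
    ∃ ν, IsUnitNormalNear r f p ν := by
  set N : E2 → E3 := fun x => transposeApply (fderiv ℝ Φ (f x)) (modelConormal α (φ x)) with hN
  have hNc : ∀ x, x ∈ φ.source → x ∈ U → ContDiffAt ℝ r N x := by
    intro x hx hxU
    rw [contDiffAt_euclidean]
    intro i
    exact ((h.contDiffAt_fderiv_target hx hxU).clm_apply contDiffAt_const).inner ℝ
      ((contDiffAt_modelConormal h.regularity (h.contDiffAt_coeff (φ.map_source hx))).comp x
        (h.diffeo_source.contDiffAt hx))
  have hNp : N p ≠ 0 := by
    obtain ⟨A, B, -, -, hB, -⟩ := h.exists_hasFDerivAt h.mem_source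
    intro h0
    -- This pairing singles out the middle entry 2 of the conormal.
    have h1 := inner_transposeApply (fderiv ℝ Φ (f p)) (modelConormal α (φ p)) (B.symm e2E3)
    rw [hB.fderiv] at h1
    simp only [hN, hB.fderiv] at h0
    rw [h0, h.map_p] at h1
    simp [PiLp.inner_apply, Fin.sum_univ_three, modelConormal, e2E3] at h1
  have hev : ∀ᶠ x in 𝓝 p, x ∈ φ.source ∧ x ∈ U ∧ N x ≠ 0 := by
    filter_upwards [h.source_nhds, h.isOpen.mem_nhds h.mem,
      (hNc p h.mem_source h.mem).continuousAt.eventually_ne hNp] with x h1 h2 h3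
    exact ⟨h1, h2, h3⟩
  obtain ⟨W, hWo, hpW, hW⟩ := exists_open_of_eventually hev
  refine ⟨fun x => ‖N x‖⁻¹ • N x, W, hWo, hpW, fun x hx => ?_, fun x hx => ?_⟩
  · obtain ⟨h1, h2, h3⟩ := hW x hx
    exact ((((hNc x h1 h2).norm ℝ h3).inv (norm_ne_zero_iff.2 h3)).smul
      (hNc x h1 h2)).contDiffWithinAt
  · obtain ⟨h1, h2, h3⟩ := hW x hx
    refine ⟨norm_smul_inv_norm (𝕜 := ℝ) h3, fun w => ?_⟩
    obtain ⟨A, B, -, -, hB, -, hf⟩ := h.exists_hasFDerivAt h1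
    rw [inner_smul_right, hf.fderiv]
    simp only [hN, inner_transposeApply, hB.fderiv]
    simp [inner_fderiv_modelConormal
      ((h.contDiffAt_coeff (φ.map_source h1)).differentiableAt h.ne_zero)]

/-- In the chart the singular set is the axis v = 0; the curve is that axis carried back by
`φ.symm`. -/
theorem EdgeChart.exists_singularCurve (h : EdgeChart r f U p φ Φ α) :
    ∃ γ, IsSingularCurve r f U p γ := by
  have hev : ∀ᶠ q in 𝓝 (0 : E2), q ∈ φ.target ∧ φ.symm q ∈ U := by
    filter_upwards [h.target_nhds, h.tendsto_symm.eventually (h.isOpen.mem_nhds h.mem)]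
      with q h1 h2 using ⟨h1, h2⟩
  have hax : ∀ t : ℝ, HasDerivAt (fun t : ℝ => t • (!₂[1, 0] : E2)) !₂[1, 0] t := fun t => by
    simpa using (hasDerivAt_id t).smul_const (!₂[1, 0] : E2)
  have hax0 : Tendsto (fun t : ℝ => t • (!₂[1, 0] : E2)) (𝓝 0) (𝓝 0) := by
    simpa using (hax 0).continuousAt.tendsto
  obtain ⟨ε, hε, hball⟩ := Metric.eventually_nhds_iff_ball.1 (hax0.eventually hev)
  rw [Real.ball_eq_Ioo, zero_sub, zero_add] at hball
  refine ⟨fun t => φ.symm (t • !₂[1, 0]), ε, hε, by simp [h.symm_zero], ?_, ?_, ?_, ?_⟩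
  · intro t ht
    have h1 : ContDiffAt ℝ r (fun t : ℝ => t • (!₂[1, 0] : E2)) t :=
      contDiffAt_id.smul contDiffAt_const
    exact ((h.diffeo_source.contDiffAt_symm (hball t ht).1).comp t h1).contDiffWithinAt
  · intro s hs t ht hst
    have := φ.symm.injOn (hball s hs).1 (hball t ht).1 hst
    simpa using congrArg (fun w : E2 => w 0) this
  · intro t ht
    have ht' := hball t ht
    have hsrc := φ.map_target ht'.1
    obtain ⟨A, -, -, hA, -⟩ := h.exists_hasFDerivAt hsrc
    rw [φ.right_inv ht'.1] at hA
    refine ⟨?_, ?_⟩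
    · change deriv (φ.symm ∘ fun t : ℝ => t • (!₂[1, 0] : E2)) t ≠ 0
      rw [(hA.comp_hasDerivAt t (hax t)).deriv]
      intro h0
      simp at h0
    · rw [h.mem_singularSet_iff hsrc ht'.2, φ.right_inv ht'.1]
      simp
  · have hc : Tendsto (fun x => φ x 0) (𝓝 p) (𝓝 0) :=
      ((EuclideanSpace.proj 0 : E2 →L[ℝ] ℝ).continuous.tendsto' 0 0 (by simp)).comp h.tendsto_chart
    refine ⟨{x | x ∈ φ.source ∧ φ x 0 ∈ Ioo (-ε) ε},
      inter_mem h.source_nhds (hc.eventually (Ioo_mem_nhds (by linarith) hε)), ?_⟩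
    rintro x ⟨hx, hxs, hxI⟩
    have h1 := (h.mem_singularSet_iff hxs hx.1).1 hx
    refine ⟨φ x 0, hxI, ?_⟩
    have : φ x 0 • (!₂[1, 0] : E2) = φ x := by apply E2.ext_coord <;> simp [h1]
    simp only [this, φ.left_inv hxs]

end NormalField

/-! ### Transfer between the isometry and the model -/

/-- The isometry `T` read in the chart `Φ`. -/
noncomputable def conjugate (Φ : OpenPartialHomeomorph E3 E3) (T : E3 ≃ᵢ E3) (x : E3) : E3 :=
  Φ (T (Φ.symm x))

theorem hasFDerivAt_isometry {T : E3 ≃ᵢ E3} {x₀ : E3} (hT : T x₀ = x₀) (x : E3) :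
    HasFDerivAt T ((linearPart T).toContinuousLinearEquiv : E3 →L[ℝ] E3) x := by
  have h : (T : E3 → E3) = fun x => linearPart T (x - x₀) + x₀ :=
    funext (apply_eq_linearPart T hT)
  rw [h]
  exact ((linearPart T).toContinuousLinearEquiv.hasFDerivAt.comp x
    ((hasFDerivAt_id x).sub_const x₀)).add_const x₀

theorem contDiff_isometry {r : WithTop ℕ∞} {T : E3 ≃ᵢ E3} {x₀ : E3} (hT : T x₀ = x₀) :
    ContDiff ℝ r T := by
  have h : (T : E3 → E3) = fun x => linearPart T (x - x₀) + x₀ :=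
    funext (apply_eq_linearPart T hT)
  rw [h]
  exact ((linearPart T).contDiff.comp (contDiff_id.sub contDiff_const)).add contDiff_const

theorem Filter.Tendsto.clm_apply_of_tendsto {ι E F : Type*} [NormedAddCommGroup E]
    [NormedSpace ℝ E] [NormedAddCommGroup F] [NormedSpace ℝ F] {l : Filter ι} {A : ι → E →L[ℝ] F}
    {A₀ : E →L[ℝ] F} {v : ι → E} {v₀ : E} (hA : Tendsto A l (𝓝 A₀)) (hv : Tendsto v l (𝓝 v₀)) :
    Tendsto (fun n => A n (v n)) l (𝓝 (A₀ v₀)) :=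
  (isBoundedBilinearMap_apply.continuous.tendsto (A₀, v₀)).comp (hA.prodMk_nhds hv)

namespace EdgeChart

variable {r : WithTop ℕ∞} {f : E2 → E3} {U : Set E2} {p : E2}
  {φ : OpenPartialHomeomorph E2 E2} {Φ : OpenPartialHomeomorph E3 E3} {α : E2 → ℝ} {T : E3 ≃ᵢ E3}

theorem conjugate_modelEdge (h : EdgeChart r f U p φ Φ α) (T : E3 ≃ᵢ E3) {x : E2}
    (hx : x ∈ φ.source) : conjugate Φ T (modelEdge α (φ x)) = Φ (T (f x)) := by
  rw [conjugate, h.target_symm_modelEdge hx]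

theorem tendsto_isometry (hTp : T (f p) = f p) : Tendsto T (𝓝 (f p)) (𝓝 (f p)) := by
  simpa [hTp] using T.continuous.tendsto (f p)

theorem tendsto_f (h : EdgeChart r f U p φ Φ α) : Tendsto f (𝓝 p) (𝓝 (f p)) :=
  (h.contDiffAt_f h.mem).continuousAt

theorem target_source_nhds (h : EdgeChart r f U p φ Φ α) : Φ.source ∈ 𝓝 (f p) :=
  Φ.open_source.mem_nhds (h.normal_form p h.mem_source).1

theorem preservesModel (h : EdgeChart r f U p φ Φ α) (hTp : T (f p) = f p)
    (hincl : ∀ N ∈ 𝓝 p, N ⊆ U → ∃ V ∈ 𝓝 p, V ⊆ U ∧ (fun q => T (f q)) '' V ⊆ f '' N) :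
    PreservesModel α (conjugate Φ T) := by
  refine ⟨by rw [conjugate, h.target_symm_zero, hTp, h.map_fp], fun N hN => ?_⟩
  obtain ⟨V, hV, -, hVN⟩ := hincl (φ ⁻¹' N ∩ (φ.source ∩ U))
    (inter_mem (h.tendsto_chart hN) (inter_mem h.source_nhds (h.isOpen.mem_nhds h.mem)))
    fun x hx => hx.2.2
  filter_upwards [h.tendsto_symm hV, h.target_nhds] with q hq hqt
  obtain ⟨x', hx', he⟩ := hVN ⟨_, hq, rfl⟩
  refine ⟨φ x', hx'.1, ?_⟩
  rw [← (h.normal_form x' hx'.2.1).2, he, ← h.conjugate_modelEdge T (φ.map_target hqt),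
    φ.right_inv hqt]

theorem modelSymmetry (h : EdgeChart r f U p φ Φ α) (hTp : T (f p) = f p)
    (hG : PreservesModel α (conjugate Φ T)) (hinv : ∀ x, T (T x) = x) :
    ModelSymmetry r α (conjugate Φ T) := by
  have hTt := (tendsto_isometry hTp).comp h.tendsto_target_symm
  refine { hG with
    regularity := h.regularity
    contDiffAt_coeff := ?_
    contDiffAt_map := ?_
    invol := ?_ }
  · filter_upwards [h.target_nhds] with q hq using h.contDiffAt_coeff hq
  · filter_upwards [Φ.open_target.mem_nhds h.zero_mem_target, hTt h.target_source_nhds]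
      with x h1 h2
    exact (h.diffeo_target.contDiffAt h2).comp x ((contDiff_isometry hTp).contDiffAt.comp x
      (h.diffeo_target.contDiffAt_symm h1))
  · filter_upwards [Φ.open_target.mem_nhds h.zero_mem_target, hTt h.target_source_nhds]
      with x h1 h2
    have h3 : T (Φ.symm x) ∈ Φ.source := h2
    simp only [conjugate]
    rw [Φ.left_inv h3, hinv, Φ.right_inv h1]

/-- The action of the linear part of `T` on the images of the coordinate vectors of the model. -/
theorem exists_linearPart_apply (h : EdgeChart r f U p φ Φ α) (hTp : T (f p) = f p)
    (hG : PreservesModel α (conjugate Φ T)) :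
    ∃ a b c : ℝ, 0 ≤ a ∧
      linearPart T (fderiv ℝ Φ.symm 0 e3E3) = c • fderiv ℝ Φ.symm 0 e3E3 ∧
      linearPart T (fderiv ℝ Φ.symm 0 e1E3) =
        a • fderiv ℝ Φ.symm 0 e1E3 + b • fderiv ℝ Φ.symm 0 e3E3 ∧
      fderiv ℝ (conjugate Φ T) 0 e3E3 = c • e3E3 := by
  obtain ⟨A, B, -, -, hB, hB', -⟩ := h.exists_hasFDerivAt h.mem_source
  rw [h.map_p, modelEdge_zero] at hB'
  have h1 : HasFDerivAt T ((linearPart T).toContinuousLinearEquiv : E3 →L[ℝ] E3) (Φ.symm 0) :=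
    hasFDerivAt_isometry hTp _
  have h2 : HasFDerivAt Φ (B : E3 →L[ℝ] E3) (T (Φ.symm 0)) := by
    rwa [h.target_symm_zero, hTp]
  have hGd : HasFDerivAt (conjugate Φ T) _ 0 := h2.comp (0 : E3) (h1.comp (0 : E3) hB')
  have hα : ContinuousAt α 0 := (h.contDiffAt_coeff h.zero_mem).continuousAt
  obtain ⟨a0, a1⟩ := hG.fderiv_e1 hα hGd.differentiableAt
  obtain ⟨b0, b1⟩ := hG.fderiv_e3 hα hGd.differentiableAt
  -- By the chain rule the derivative of `Φ.symm` intertwines DG(0) with the linear part of `T`.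
  have hLB : ∀ w, linearPart T (fderiv ℝ Φ.symm 0 w) =
      fderiv ℝ Φ.symm 0 (fderiv ℝ (conjugate Φ T) 0 w) := by
    intro w
    rw [hGd.fderiv, hB'.fderiv]
    simp
  set D := fderiv ℝ (conjugate Φ T) 0
  have e3 : D e3E3 = D e3E3 2 • e3E3 := by
    apply E3.ext_coord
    · rw [b0]; simp [e3E3]
    · rw [b1]; simp [e3E3]
    · simp [e3E3]
  have e1 : D e1E3 = D e1E3 0 • e1E3 + D e1E3 2 • e3E3 := by
    apply E3.ext_coord
    · simp [e1E3, e3E3]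
    · rw [a1]; simp [e1E3, e3E3]
    · simp [e1E3, e3E3]
  refine ⟨D e1E3 0, D e1E3 2, D e3E3 2, a0, ?_, ?_, e3⟩
  · rw [hLB]
    conv_lhs => rw [e3]
    rw [map_smul]
  · rw [hLB]
    conv_lhs => rw [e1]
    rw [map_add, map_smul, map_smul]

theorem tangentDirection_eq (h : EdgeChart r f U p φ Φ α) :
    tangentDirection f p = ℝ ∙ fderiv ℝ Φ.symm 0 e3E3 := by
  obtain ⟨A, B, -, -, -, hB', hf⟩ := h.exists_hasFDerivAt h.mem_source
  rw [h.map_p] at hf hB'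
  rw [modelEdge_zero] at hB'
  have hα := (h.contDiffAt_coeff h.zero_mem).differentiableAt h.ne_zero
  have hg : ∀ w, fderiv ℝ (modelEdge α) 0 w = w 0 • e3E3 := by
    intro w
    obtain ⟨k0, k1, k2⟩ := hasFDerivAt_modelEdge_coords hα w
    apply E3.ext_coord
    · rw [k0]; simp [e3E3]
    · rw [k1]; simp [e3E3]
    · rw [k2]; simp [e3E3]
  ext y
  simp only [tangentDirection, LinearMap.mem_range, Submodule.mem_span_singleton, hf.fderiv,
    hB'.fderiv]
  constructor
  · rintro ⟨w, rfl⟩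
    exact ⟨A w 0, by simp [hg]⟩
  · rintro ⟨c, rfl⟩
    refine ⟨A.symm !₂[c, 0], by simp [hg]⟩

/-- The limiting normal is orthogonal to the tangent direction and to the cuspidal direction. -/
theorem inner_normal_eq_zero (h : EdgeChart r f U p φ Φ α) {ν : E2 → E3}
    (hν : IsUnitNormalNear r f p ν) :
    inner ℝ (fderiv ℝ Φ.symm 0 e3E3) (ν p) = 0 ∧ inner ℝ (fderiv ℝ Φ.symm 0 e1E3) (ν p) = 0 := by
  obtain ⟨W, hWo, hpW, hνc, hW⟩ := hν
  constructor
  · have hmem : fderiv ℝ Φ.symm 0 e3E3 ∈ tangentDirection f p := by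
      rw [h.tangentDirection_eq]; exact Submodule.mem_span_singleton_self _
    obtain ⟨w, hw⟩ := hmem
    rw [← hw]
    exact (hW p hpW).2 w
  · have hα := h.contDiffAt_coeff h.zero_mem
    have hν0 : Tendsto (fun t : ℝ => ν (φ.symm (t • e2v))) (𝓝[>] 0) (𝓝 (ν p)) :=
      ((hνc.continuousOn.continuousAt (hWo.mem_nhds hpW)).tendsto.comp h.tendsto_symm).comp
        tendsto_smul_e2v
    have hg0 : Tendsto (modelEdge α) (𝓝 0) (𝓝 0) := by
      simpa using (contDiffAt_modelEdge hα).continuousAt.tendsto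
    have hD : Tendsto (fun t : ℝ => fderiv ℝ Φ.symm (modelEdge α (t • e2v))) (𝓝[>] 0)
        (𝓝 (fderiv ℝ Φ.symm 0)) :=
      (((h.diffeo_target.contDiffAt_symm h.zero_mem_target).fderiv_right
        (add_one_le_of_infty_or_omega h.regularity)).continuousAt.tendsto.comp hg0).comp
          tendsto_smul_e2v
    -- Although ∂ᵥg vanishes at the origin, its value at (0, t) divided by 2t tends to e₁.
    -- Orthogonality to ν holds at small t > 0 and passes to the limit.
    have hv : Tendsto (fun t : ℝ => (2 * t)⁻¹ • fderiv ℝ (modelEdge α) (t • e2v) e2v) (𝓝[>] 0)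
        (𝓝 e1E3) := by
      have c1 : Tendsto (fun t : ℝ => 3 / 2 * t * α (t • e2v) +
          t ^ 2 / 2 * fderiv ℝ α (t • e2v) e2v) (𝓝[>] 0) (𝓝 0) := by
        have k1 : Tendsto (fun t : ℝ => α (t • e2v)) (𝓝[>] 0) (𝓝 (α 0)) :=
          hα.continuousAt.tendsto.comp tendsto_smul_e2v
        have k2 : Tendsto (fun t : ℝ => fderiv ℝ α (t • e2v) e2v) (𝓝[>] 0)
            (𝓝 (fderiv ℝ α 0 e2v)) :=
          Filter.Tendsto.clm_apply_of_tendsto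
            ((hα.fderiv_right (add_one_le_of_infty_or_omega h.regularity)).continuousAt.tendsto.comp
              tendsto_smul_e2v) tendsto_const_nhds
        have k3 : Tendsto (fun t : ℝ => 3 / 2 * t) (𝓝[>] 0) (𝓝 0) :=
          ((continuous_const.mul continuous_id).tendsto' 0 0 (by simp)).mono_left
            nhdsWithin_le_nhds
        have k4 : Tendsto (fun t : ℝ => t ^ 2 / 2) (𝓝[>] 0) (𝓝 0) :=
          (((continuous_id.pow 2).div_const 2).tendsto' 0 0 (by simp)).mono_left
            nhdsWithin_le_nhds
        simpa using (k3.mul k1).add (k4.mul k2)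
      have hc : Continuous fun a : ℝ => (!₂[1, a, 0] : E3) := by
        refine (PiLp.continuous_toLp 2 _).comp (continuous_pi fun i => ?_)
        fin_cases i <;> simp <;> fun_prop
      refine ((hc.tendsto 0).comp c1).congr' ?_
      filter_upwards [self_mem_nhdsWithin, tendsto_smul_e2v h.target_nhds] with t ht htt
      have ht : t ≠ 0 := (mem_Ioi.1 ht).ne'
      obtain ⟨k0, k1, k2⟩ := hasFDerivAt_modelEdge_coords
        ((h.contDiffAt_coeff htt).differentiableAt h.ne_zero) e2v
      apply E3.ext_coord
      · simp only [PiLp.smul_apply, k0]; simp [e2v]; field_simp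
      · simp only [PiLp.smul_apply, k1]; simp [e2v]; field_simp
      · simp only [PiLp.smul_apply, k2]; simp [e2v]
    refine tendsto_nhds_unique ((hD.clm_apply_of_tendsto hv).inner hν0) (tendsto_const_nhds.congr' ?_)
    have hmem : ∀ᶠ t : ℝ in 𝓝[>] 0, t • e2v ∈ φ.target ∧ φ.symm (t • e2v) ∈ W := by
      filter_upwards [tendsto_smul_e2v h.target_nhds,
        tendsto_smul_e2v (h.tendsto_symm (hWo.mem_nhds hpW))] with t h1 h2 using ⟨h1, h2⟩
    filter_upwards [hmem] with t ⟨ht, htW⟩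
    obtain ⟨A, B, -, -, -, hB', hf⟩ := h.exists_hasFDerivAt (φ.map_target ht)
    rw [φ.right_inv ht] at hB' hf
    have := (hW _ htW).2 ((2 * t)⁻¹ • A.symm e2v)
    rw [hf.fderiv] at this
    rw [hB'.fderiv, ← this]
    simp

/-- A symmetry fixing the tangent direction fixes the image of the singular set pointwise. -/
theorem apply_eq_self_on_singularSet (h : EdgeChart r f U p φ Φ α) (hTp : T (f p) = f p)
    (hG : ModelSymmetry r α (conjugate Φ T))
    (he : fderiv ℝ (conjugate Φ T) 0 e3E3 = e3E3) :
    ∀ᶠ x in 𝓝 p, x ∈ singularSet f U → T (f x) = f x := by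
  filter_upwards [h.tendsto_chart.eventually (hG.apply_eq_self_on_axis he), h.source_nhds,
    ((tendsto_isometry hTp).comp h.tendsto_f) h.target_source_nhds] with x h1 h2 h3 hx
  have h4 := h1 ((h.mem_singularSet_iff h2 hx.1).1 hx)
  rw [h.conjugate_modelEdge T h2, ← (h.normal_form x h2).2] at h4
  exact Φ.injOn h3 (h.normal_form x h2).1 h4

variable {m : E2 → ℝ}

/-- In the charts a connecting map is one of the two candidate lifts. -/
theorem connectingMap_eq_lift (h : EdgeChart r f U p φ Φ α)
    (hG : FactoredSymmetry r α (conjugate Φ T) m) {ψ : OpenPartialHomeomorph E2 E2}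
    (hψ : IsConnectingMap f U T p ψ) :
    ∃ s : ℝ, (s = 1 ∨ s = -1) ∧ (∀ᶠ x in 𝓝 p, φ (ψ x) = modelLift α (conjugate Φ T) m s (φ x)) ∧
      ∀ᶠ q in 𝓝 0, modelEdge α (modelLift α (conjugate Φ T) m s q) =
        conjugate Φ T (modelEdge α q) := by
  obtain ⟨hps, hψp, -, -, -, hTf⟩ := hψ
  have hψt : Tendsto ψ (𝓝 p) (𝓝 p) := by simpa [hψp] using (ψ.continuousAt hps).tendsto
  have hgood : ∀ᶠ x in 𝓝 p, x ∈ ψ.source ∧ x ∈ φ.source ∧ ψ x ∈ φ.source := by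
    filter_upwards [ψ.open_source.mem_nhds hps, h.source_nhds, hψt h.source_nhds]
      with x h1 h2 h3 using ⟨h1, h2, h3⟩
  have hcomm : ∀ᶠ q in 𝓝 0, modelEdge α (φ (ψ (φ.symm q))) = conjugate Φ T (modelEdge α q) := by
    filter_upwards [h.tendsto_symm.eventually hgood, h.target_nhds] with q ⟨h1, h2, h3⟩ h4
    have := h.conjugate_modelEdge T h2
    rw [φ.right_inv h4] at this
    rw [this, ← (h.normal_form _ h3).2, hTf _ h1]
  have hcont : ∀ᶠ q in 𝓝 0, ContinuousAt (fun q => φ (ψ (φ.symm q))) q := by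
    filter_upwards [h.tendsto_symm.eventually hgood, h.target_nhds] with q ⟨h1, h2, h3⟩ h4
    exact ContinuousAt.comp (f := fun q => ψ (φ.symm q)) (φ.continuousAt h3)
      (ContinuousAt.comp (f := φ.symm) (ψ.continuousAt h1) (φ.continuousAt_symm h4))
  -- This is where ψ being a homeomorphism matters: it excludes a folded lift with different signs
  -- on the two sides.
  have hopen : 𝓝 0 ≤ map (fun q => φ (ψ (φ.symm q))) (𝓝 0) := by
    have e1 : map φ.symm (𝓝 0) = 𝓝 p := by
      have := φ.symm.map_nhds_eq h.zero_mem
      rwa [h.symm_zero] at this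
    have e2 : map ψ (𝓝 p) = 𝓝 p := by
      have := ψ.map_nhds_eq hps
      rwa [hψp] at this
    have e3 : map φ (𝓝 p) = 𝓝 0 := by
      have := φ.map_nhds_eq h.mem_source
      rwa [h.map_p] at this
    have e4 : map (fun q => φ (ψ (φ.symm q))) (𝓝 0) = map φ (map ψ (map φ.symm (𝓝 0))) := by
      simp only [Filter.map_map]; rfl
    rw [e4, e1, e2, e3]
  obtain ⟨s, hs, hlift⟩ := hG.eventually_eq_lift hcont hopen hcomm
  refine ⟨s, hs, ?_, ?_⟩
  · filter_upwards [h.tendsto_chart.eventually hlift, h.source_nhds] with x h1 h2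
    rw [φ.left_inv h2] at h1
    exact h1
  · filter_upwards [hlift, hcomm] with q h1 h2
    rw [← h1, h2]

/-- Near p the map ψ is a candidate lift conjugated by `φ`, hence C^r and involutive. -/
theorem isInvolutionNear_of_connectingMap (h : EdgeChart r f U p φ Φ α)
    (hG : FactoredSymmetry r α (conjugate Φ T) m) {ψ : OpenPartialHomeomorph E2 E2}
    (hψ : IsConnectingMap f U T p ψ) : IsInvolutionNear r ψ ψ.source p := by
  obtain ⟨s, hs, hlift, hedge⟩ := h.connectingMap_eq_lift hG hψ
  obtain ⟨hps, hψp, -, -, -, -⟩ := hψ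
  have hψt : Tendsto ψ (𝓝 p) (𝓝 p) := by simpa [hψp] using (ψ.continuousAt hps).tendsto
  have hform : ∀ᶠ x in 𝓝 p, ψ x = φ.symm (modelLift α (conjugate Φ T) m s (φ x)) := by
    filter_upwards [hlift, hψt h.source_nhds] with x h1 h2
    rw [← h1, φ.left_inv h2]
  have hreg : ∀ᶠ x in 𝓝 p, ContDiffAt ℝ r ψ x := by
    filter_upwards [hform.eventually_nhds, h.source_nhds,
      h.tendsto_chart.eventually (hG.contDiffAt_lift s),
      h.tendsto_chart ((hG.tendsto_lift s) h.target_nhds)] with x h1 h2 h3 h4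
    exact ((h.diffeo_source.contDiffAt_symm h4).comp x
      (h3.comp x (h.diffeo_source.contDiffAt h2))).congr_of_eventuallyEq h1
  have hinv : ∀ᶠ x in 𝓝 p, ψ (ψ x) = x := by
    filter_upwards [hψt.eventually hform, hlift, h.source_nhds,
      h.tendsto_chart.eventually (hG.lift_involutive hs hedge)] with x h1 h2 h3 h4
    rw [h1, h2, h4, φ.left_inv h3]
  have hsrc : ∀ᶠ x in 𝓝 p, x ∈ ψ.source := ψ.open_source.mem_nhds hps
  obtain ⟨R, hR, hball⟩ := Metric.eventually_nhds_iff_ball.1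
    ((hsrc.and (hψt.eventually hsrc)).and
      ((hreg.and (hψt.eventually hreg)).and hinv))
  have hpB : p ∈ Metric.ball p R := Metric.mem_ball_self hR
  have hBs : Metric.ball p R ⊆ ψ.source := fun x hx => (hball x hx).1.1
  have hBc : IsConnected (Metric.ball p R) :=
    ⟨⟨p, hpB⟩, (convex_ball p R).isPreconnected⟩
  -- A ball B need not be invariant, but B ∪ ψ(B) is, as ψ ∘ ψ = id on B. It is connected because
  -- both pieces contain p.
  refine ⟨Metric.ball p R ∪ ψ '' Metric.ball p R, ?_, ?_, Or.inl hpB, ?_, ?_, ?_, ?_⟩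
  · exact Metric.isOpen_ball.union
      (ψ.isOpen_image_of_subset_source Metric.isOpen_ball hBs)
  · exact IsConnected.union ⟨p, hpB, p, hpB, hψp⟩ hBc
      (hBc.image _ (ψ.continuousOn.mono hBs))
  · rintro x (hx | ⟨y, hy, rfl⟩)
    · exact hBs hx
    · exact (hball y hy).1.2
  · rintro x (hx | ⟨y, hy, rfl⟩)
    · exact Or.inr ⟨x, hx, rfl⟩
    · rw [(hball y hy).2.2]; exact Or.inl hy
  · rintro x (hx | ⟨y, hy, rfl⟩)
    · exact (hball x hx).2.1.1.contDiffWithinAt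
    · exact (hball y hy).2.1.2.contDiffWithinAt
  · rintro x (hx | ⟨y, hy, rfl⟩)
    · exact (hball x hx).2.2
    · rw [(hball y hy).2.2]

end EdgeChart

/-! ### Unit normals and derivatives of plane curves -/

section Auxiliary

theorem eq_or_eq_neg_of_orthogonal_range {K : E2 →L[ℝ] E3} (hK : Function.Injective K) {n n' : E3}
    (hn : ‖n‖ = 1) (hn' : ‖n'‖ = 1) (h : ∀ w, inner ℝ (K w) n = 0)
    (h' : ∀ w, inner ℝ (K w) n' = 0) : n' = n ∨ n' = -n := by
  set S := LinearMap.range (K : E2 →ₗ[ℝ] E3)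
  have hS : Module.finrank ℝ S = 2 := by
    rw [LinearMap.finrank_range_of_inj hK]; simp
  have hS' : Module.finrank ℝ Sᗮ = 1 := by
    have := S.finrank_add_finrank_orthogonal
    rw [hS] at this
    simp at this
    omega
  have mem : ∀ {x : E3}, (∀ w, inner ℝ (K w) x = 0) → x ∈ Sᗮ := by
    intro x hx
    rw [Submodule.mem_orthogonal]
    rintro _ ⟨w, rfl⟩
    exact hx w
  have hn0 : n ≠ 0 := by rw [← norm_ne_zero_iff, hn]; exact one_ne_zero
  obtain ⟨c, hc⟩ := (finrank_eq_one_iff_of_nonzero' (⟨n, mem h⟩ : Sᗮ)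
    (fun h0 => hn0 (congrArg Subtype.val h0))).1 hS' ⟨n', mem h'⟩
  have hc' : c • n = n' := congrArg Subtype.val hc
  have hnorm := hn'
  rw [← hc', norm_smul, hn, mul_one, Real.norm_eq_abs] at hnorm
  rcases eq_or_eq_neg_of_abs_eq hnorm with e | e
  · left; rw [← hc', e, one_smul]
  · right; rw [← hc', e]; simp

theorem inner_deriv_eq_zero_of_eventually_const {F : ℝ → E3} {t : ℝ} {n : E3} {k : ℝ}
    (hF : DifferentiableAt ℝ F t) (h : ∀ᶠ s in 𝓝 t, inner ℝ (F s) n = k) :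
    inner ℝ (deriv F t) n = 0 := by
  have h1 := hF.hasDerivAt.inner ℝ (hasDerivAt_const t n)
  have h2 := h1.unique ((hasDerivAt_const t k).congr_of_eventuallyEq h)
  simpa using h2

theorem inner_iteratedDeriv_two_eq_zero {F : ℝ → E3} {n : E3} {k : ℝ} (hF : ContDiffAt ℝ 2 F 0)
    (h : ∀ᶠ s in 𝓝 0, inner ℝ (F s) n = k) : inner ℝ (iteratedDeriv 2 F 0) n = 0 := by
  rw [iteratedDeriv_succ, iteratedDeriv_one]
  have hd : DifferentiableAt ℝ (deriv F) 0 := by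
    have h1 : ContDiffAt ℝ 1 (fderiv ℝ F) 0 := hF.fderiv_right (by norm_num)
    exact (h1.differentiableAt one_ne_zero).clm_apply (differentiableAt_const 1)
  refine inner_deriv_eq_zero_of_eventually_const hd ?_ (k := 0)
  filter_upwards [h.eventually_nhds, hF.eventually (by decide)] with t h1 h2
  exact inner_deriv_eq_zero_of_eventually_const (h2.differentiableAt two_ne_zero) h1

end Auxiliary

/-! ### Connecting maps and transversality of the sheets -/

namespace EdgeChart

variable {r : WithTop ℕ∞} {f : E2 → E3} {U : Set E2} {p : E2}
  {φ : OpenPartialHomeomorph E2 E2} {Φ : OpenPartialHomeomorph E3 E3} {α : E2 → ℝ} {T : E3 ≃ᵢ E3}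
  {m : E2 → ℝ}

/-- In the chart ψ acts on the axis by `axisMap`, whose derivative at 0 is -1. If c is the first
chart coordinate of γ, the change of parameter is c⁻¹ ∘ `axisMap` ∘ c, again with derivative -1 at
0. -/
theorem reversesCurve (h : EdgeChart r f U p φ Φ α)
    (hG : FactoredSymmetry r α (conjugate Φ T) m)
    (he : fderiv ℝ (conjugate Φ T) 0 e3E3 = (-1 : ℝ) • e3E3) {ψ : OpenPartialHomeomorph E2 E2}
    (hψ : IsConnectingMap f U T p ψ) {γ : ℝ → E2} (hγ : IsSingularCurve r f U p γ) :
    ReversesCurve ψ γ := by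
  obtain ⟨s, -, hlift, -⟩ := h.connectingMap_eq_lift hG hψ
  obtain ⟨hps, hψp, -, -, -, -⟩ := hψ
  have hψt : Tendsto ψ (𝓝 p) (𝓝 p) := by simpa [hψp] using (ψ.continuousAt hps).tendsto
  obtain ⟨ε, hε, hγ0, hγc, -, hγs, -⟩ := hγ
  have hI : Ioo (-ε) ε ∈ 𝓝 (0 : ℝ) := Ioo_mem_nhds (by linarith) hε
  have hγc0 : ContDiffAt ℝ r γ 0 := hγc.contDiffAt hI
  have hγt : Tendsto γ (𝓝 0) (𝓝 p) := by simpa [hγ0] using hγc0.continuousAt.tendsto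
  have hφγ : ContDiffAt ℝ r (fun t => φ (γ t)) 0 :=
    ContDiffAt.comp (0 : ℝ) (by rw [hγ0]; exact h.diffeo_source.contDiffAt h.mem_source) hγc0
  set c : ℝ → ℝ := fun t => φ (γ t) 0 with hc_def
  have hc : ContDiffAt ℝ 1 c 0 :=
    (contDiffAt_coord hφγ 0).of_le (one_le_of_infty_or_omega h.regularity)
  have hc0 : c 0 = 0 := by simp [hc_def, hγ0, h.map_p]
  have hzero : ∀ᶠ t in 𝓝 0, φ (γ t) 1 = 0 := by
    filter_upwards [hI, hγt h.source_nhds] with t h1 h2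
    exact (h.mem_singularSet_iff h2 (hγs t h1).2.1).1 (hγs t h1).2
  -- The curve runs in the axis of the chart, so its nonzero velocity must show in the first
  -- coordinate.
  have hc' : deriv c 0 ≠ 0 := by
    obtain ⟨A, -, hA, -⟩ := h.exists_hasFDerivAt h.mem_source
    rw [← hγ0] at hA
    have h1 := hA.comp_hasDerivAt (0 : ℝ) (hγc0.differentiableAt h.ne_zero).hasDerivAt
    have h2 := (EuclideanSpace.proj 0 : E2 →L[ℝ] ℝ).hasFDerivAt.comp_hasDerivAt (0 : ℝ) h1
    have h3 := ((EuclideanSpace.proj 1 : E2 →L[ℝ] ℝ).hasFDerivAt.comp_hasDerivAt (0 : ℝ) h1).unique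
      ((hasDerivAt_const (0 : ℝ) (0 : ℝ)).congr_of_eventuallyEq hzero)
    have h4 : HasDerivAt c _ 0 := h2
    rw [h4.deriv]
    intro h5
    have h6 : A (deriv γ 0) = A 0 := by
      rw [map_zero]
      exact E2.ext_coord (by simpa using h5) (by simpa using h3)
    exact (hγs 0 ⟨by linarith, hε⟩).1 (A.injective h6)
  have hcd := hc.differentiableAt one_ne_zero |>.hasDerivAt
  have hcf := hcd.hasFDerivAt_equiv hc'
  set e := hc.toOpenPartialHomeomorph c hcf one_ne_zero with he_def
  have hec : ∀ t, e t = c t := fun t => rfl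
  have h0e : (0 : ℝ) ∈ e.source := hc.mem_toOpenPartialHomeomorph_source hcf one_ne_zero
  have hsymm : ContDiffAt ℝ 1 e.symm 0 := by
    have := hc.to_localInverse hcf one_ne_zero
    rwa [hc0] at this
  have hsymm0 : e.symm 0 = 0 := by
    have := e.left_inv h0e
    rwa [hec, hc0] at this
  have h0t : (0 : ℝ) ∈ e.target := by
    have := e.map_source h0e
    rwa [hec, hc0] at this
  set a := ModelSymmetry.axisMap (conjugate Φ T) with ha_def
  have ha : ContDiffAt ℝ 1 a 0 := hG.contDiffAt_axisMap
  have ha0 : a 0 = 0 := hG.axisMap_zero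
  have hac : ContDiffAt ℝ 1 (fun t => a (c t)) 0 := ContDiffAt.comp (g := a) (f := c) (0 : ℝ) (by rwa [hc0]) hc
  set H : ℝ → ℝ := fun t => e.symm (a (c t)) with hH_def
  have hH : ContDiffAt ℝ 1 H 0 := ContDiffAt.comp (g := e.symm) (f := fun t => a (c t)) (0 : ℝ)
    (by simpa only [hc0, ha0] using hsymm) hac
  have hH0 : H 0 = 0 := by simp [hH_def, hc0, ha0, hsymm0]
  have hHt : Tendsto H (𝓝 0) (𝓝 0) := by simpa [hH0] using hH.continuousAt.tendsto
  have hct : Tendsto (fun t => a (c t)) (𝓝 0) (𝓝 0) := by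
    simpa [hc0, ha0] using hac.continuousAt.tendsto
  have hcH : ∀ᶠ t in 𝓝 0, c (H t) = a (c t) := by
    filter_upwards [hct (e.open_target.mem_nhds h0t)] with t ht
    exact e.right_inv ht
  have hHd : deriv H 0 = -1 := by
    have k1 : HasDerivAt (fun t => c (H t)) (deriv c 0 * deriv H 0) 0 := by
      have hcd' : HasDerivAt c (deriv c 0) (H 0) := by rwa [hH0]
      exact hcd'.comp (0 : ℝ) (hH.differentiableAt one_ne_zero).hasDerivAt
    have k2 : HasDerivAt (fun t => a (c t)) (-1 * deriv c 0) 0 := by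
      have had : HasDerivAt a (-1) (c 0) := by
        rw [hc0, ← hG.deriv_axisMap he]
        exact (ha.differentiableAt one_ne_zero).hasDerivAt
      exact had.comp (0 : ℝ) hcd
    have k3 := k1.unique (k2.congr_of_eventuallyEq hcH)
    have : deriv c 0 * (deriv H 0 + 1) = 0 := by linarith
    linarith [(mul_eq_zero.1 this).resolve_left hc']
  obtain ⟨δ₁, hδ₁, hHc, hHa⟩ := exists_strictAntiOn_of_deriv_neg hH (by rw [hHd]; norm_num)
  have hev : ∀ᶠ t in 𝓝 0, ψ (γ t) = γ (H t) := by
    filter_upwards [hγt.eventually hlift, hγt.eventually (hψt h.source_nhds), hzero,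
      hHt.eventually hzero, (hγt.comp hHt) h.source_nhds, hcH] with t k1 k2 k3 k4 k5 k6
    refine φ.injOn k2 k5 ?_
    rw [k1]
    refine E2.ext_coord ?_ ?_
    · rw [modelLift_apply_zero, ModelSymmetry.modelEdge_axis α k3]
      exact k6.symm
    · rw [modelLift_apply_one, k3, zero_mul, mul_zero, k4]
  obtain ⟨δ₂, hδ₂, hball⟩ := Metric.eventually_nhds_iff_ball.1 hev
  rw [Real.ball_eq_Ioo, zero_sub, zero_add] at hball
  have hsub₁ : Ioo (-min δ₁ δ₂) (min δ₁ δ₂) ⊆ Ioo (-δ₁) δ₁ :=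
    Ioo_subset_Ioo (neg_le_neg (min_le_left _ _)) (min_le_left _ _)
  have hsub₂ : Ioo (-min δ₁ δ₂) (min δ₁ δ₂) ⊆ Ioo (-δ₂) δ₂ :=
    Ioo_subset_Ioo (neg_le_neg (min_le_right _ _)) (min_le_right _ _)
  exact ⟨min δ₁ δ₂, lt_min hδ₁ hδ₂, H, hHc.mono hsub₁, hHa.mono hsub₁, hH0,
    fun t ht => hball t (hsub₂ ht)⟩

/-- The lift has invertible derivative at the origin, so the inverse function theorem makes it a
local homeomorphism. Restriction to a small ball makes the domain connected. -/
theorem exists_connectingMap (h : EdgeChart r f U p φ Φ α) (hTp : T (f p) = f p)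
    (hG : FactoredSymmetry r α (conjugate Φ T) m) {s : ℝ} (hs : s = 1 ∨ s = -1)
    (hedge : ∀ᶠ q in 𝓝 0, modelEdge α (modelLift α (conjugate Φ T) m s q) =
      conjugate Φ T (modelEdge α q)) : ∃ ψ, IsConnectingMap f U T p ψ := by
  set ℓ := modelLift α (conjugate Φ T) m s with hℓ
  have hℓc : ContDiffAt ℝ r ℓ 0 := (hG.contDiffAt_lift s).self_of_nhds
  obtain ⟨D, hD⟩ := hG.fderiv_lift_zero hs
  have hℓd : HasFDerivAt ℓ (D : E2 →L[ℝ] E2) 0 := by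
    rw [hD]; exact (hℓc.differentiableAt h.ne_zero).hasFDerivAt
  set ρ := hℓc.toOpenPartialHomeomorph ℓ hℓd h.ne_zero with hρ
  have h0ρ : (0 : E2) ∈ ρ.source := hℓc.mem_toOpenPartialHomeomorph_source hℓd h.ne_zero
  have hℓ0 : ℓ 0 = 0 := hG.lift_zero s
  set e := φ.trans (ρ.trans φ.symm) with he
  have hex : ∀ x, e x = φ.symm (ℓ (φ x)) := fun x => rfl
  have hpe : p ∈ e.source := by
    simp only [he, OpenPartialHomeomorph.trans_source, mem_inter_iff, mem_preimage, h.map_p]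
    refine ⟨h.mem_source, h0ρ, ?_⟩
    change ℓ 0 ∈ φ.target
    rw [hℓ0]; exact h.zero_mem
  have hep : e p = p := by rw [hex, h.map_p, hℓ0, h.symm_zero]
  have het : Tendsto e (𝓝 p) (𝓝 p) := by simpa [hep] using (e.continuousAt hpe).tendsto
  have hUn : U ∈ 𝓝 p := h.isOpen.mem_nhds h.mem
  have hev : ∀ᶠ x in 𝓝 p, x ∈ e.source ∧ x ∈ U ∧ e x ∈ U ∧ f (e x) = T (f x) := by
    filter_upwards [e.open_source.mem_nhds hpe, hUn, het hUn, h.source_nhds,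
      h.tendsto_chart.eventually hedge, h.tendsto_chart (hG.tendsto_lift s h.target_nhds),
      ((tendsto_isometry hTp).comp h.tendsto_f) h.target_source_nhds]
      with x h1 h2 h3 h4 h5 h6 h7
    refine ⟨h1, h2, h3, ?_⟩
    have h6 : ℓ (φ x) ∈ φ.target := h6
    have h8 : T (f x) ∈ Φ.source := h7
    rw [hex, ← h.target_symm_modelEdge (φ.map_target h6), φ.right_inv h6, h5,
      h.conjugate_modelEdge T h4, Φ.left_inv h8]
  obtain ⟨R, hR, hball⟩ := Metric.eventually_nhds_iff_ball.1 hev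
  have hsrc : (e.restrOpen (Metric.ball p R) Metric.isOpen_ball).source = Metric.ball p R := by
    rw [OpenPartialHomeomorph.restrOpen_source]
    exact inter_eq_right.2 fun x hx => (hball x hx).1
  refine ⟨e.restrOpen (Metric.ball p R) Metric.isOpen_ball, ?_, hep, ?_, ?_, ?_, ?_⟩
  · rw [hsrc]; exact Metric.mem_ball_self hR
  · rw [hsrc]
    exact ⟨⟨p, Metric.mem_ball_self hR⟩, (convex_ball p R).isPreconnected⟩
  · rw [hsrc]; exact fun x hx => (hball x hx).2.1
  · intro y hy
    have h1 := (e.restrOpen (Metric.ball p R) Metric.isOpen_ball).map_target hy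
    rw [hsrc] at h1
    have h2 := (hball _ h1).2.2.1
    rw [← (e.restrOpen (Metric.ball p R) Metric.isOpen_ball).right_inv hy]
    exact h2
  · rw [hsrc]; exact fun x hx => (hball x hx).2.2.2

/-- If the Legendrian lift is injective, the two sheets are nowhere tangent off the axis. -/
theorem sheets_transverse (h : EdgeChart r f U p φ Φ α) (hL : LegendrianLiftInjectiveNear r f p) :
    ∀ᶠ q in 𝓝 (0 : E2), q 1 ≠ 0 → sheetGap α q = 0 → fderiv ℝ (sheetGap α) q ≠ 0 := by
  obtain ⟨ν, ⟨W, hWo, hpW, hνc, hW⟩, N, hN, hinj⟩ := hL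
  have hflip : ∀ q : E2, (!₂[q 0, -q 1] : E2) = squeeze (-1) q := fun q => by
    apply E2.ext_coord <;> simp
  have hgap : sheetGap α = fun q => modelEdge α q 1 - modelEdge α (squeeze (-1) q) 1 := by
    funext q; rw [sheetGap, hflip]
  have hσ : Tendsto (squeeze (-1)) (𝓝 0) (𝓝 0) := by
    simpa using (squeeze (-1)).continuous.tendsto 0
  have hνt : Tendsto (fun q => ν (φ.symm q)) (𝓝 0) (𝓝 (ν p)) :=
    (hνc.continuousOn.continuousAt (hWo.mem_nhds hpW)).tendsto.comp h.tendsto_symm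
  -- By continuity of ν, opposite unit normals at q and its mirror point are excluded.
  have hpos : ∀ᶠ q in 𝓝 0, 0 < inner ℝ (ν (φ.symm q)) (ν (φ.symm (squeeze (-1) q))) := by
    refine (hνt.inner (hνt.comp hσ)).eventually (lt_mem_nhds ?_)
    rw [real_inner_self_eq_norm_sq, (hW p hpW).1]; norm_num
  have hgood : ∀ᶠ q in 𝓝 0, q ∈ φ.target ∧ φ.symm q ∈ W ∧ φ.symm q ∈ N := by
    filter_upwards [h.target_nhds, h.tendsto_symm (hWo.mem_nhds hpW), h.tendsto_symm hN]
      with q h1 h2 h3 using ⟨h1, h2, h3⟩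
  filter_upwards [hpos, hgood, hσ.eventually hgood] with q k0 ⟨k1, k2, k3⟩ ⟨l1, l2, l3⟩ hq1 hz hd
  set q' := squeeze (-1) q with hq'
  have hq'0 : q' 0 = q 0 := by simp [hq']
  have hq'1 : q' 1 = -q 1 := by simp [hq']
  have hgz : modelEdge α q' = modelEdge α q := by
    rw [hgap] at hz
    apply E3.ext_coord
    · simp [hq'1]
    · exact (sub_eq_zero.1 hz).symm
    · simp [hq'0]
  have hα := (h.contDiffAt_coeff k1).differentiableAt h.ne_zero
  have hα' := (h.contDiffAt_coeff l1).differentiableAt h.ne_zero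
  have hg := (contDiffAt_modelEdge (h.contDiffAt_coeff k1)).differentiableAt h.ne_zero
  have hg' := (contDiffAt_modelEdge (h.contDiffAt_coeff l1)).differentiableAt h.ne_zero
  -- A critical gap makes the mirror map intertwine the two differentials, so the sheets share a
  -- tangent plane. Equal image points and equal normals then contradict injectivity of the
  -- Legendrian lift.
  have hDD : ∀ w, fderiv ℝ (modelEdge α) q' (squeeze (-1) w) = fderiv ℝ (modelEdge α) q w := by
    intro w
    obtain ⟨a0, -, a2⟩ := hasFDerivAt_modelEdge_coords hα w
    obtain ⟨b0, -, b2⟩ := hasFDerivAt_modelEdge_coords hα' (squeeze (-1) w)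
    apply E3.ext_coord
    · rw [a0, b0, hq'1]; simp
    · have e1 := (EuclideanSpace.proj 1 : E3 →L[ℝ] ℝ).hasFDerivAt.comp q hg.hasFDerivAt
      have e2 := (EuclideanSpace.proj 1 : E3 →L[ℝ] ℝ).hasFDerivAt.comp q
        (HasFDerivAt.comp (f := squeeze (-1)) q hg'.hasFDerivAt (squeeze (-1)).hasFDerivAt)
      have e3 : HasFDerivAt (sheetGap α) ((EuclideanSpace.proj 1 : E3 →L[ℝ] ℝ).comp
          (fderiv ℝ (modelEdge α) q) - (EuclideanSpace.proj 1 : E3 →L[ℝ] ℝ).comp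
            ((fderiv ℝ (modelEdge α) q').comp (squeeze (-1)))) q := by
        rw [hgap]; exact e1.sub e2
      rw [e3.fderiv] at hd
      have := congrArg (fun L : E2 →L[ℝ] ℝ => L w) hd
      simp at this
      linarith
    · rw [a2, b2]; simp
  have hx := φ.map_target k1
  have hx' := φ.map_target l1
  obtain ⟨A, B, -, -, -, hB, hf⟩ := h.exists_hasFDerivAt hx
  obtain ⟨A', B', -, -, -, hB', hf'⟩ := h.exists_hasFDerivAt hx'
  rw [φ.right_inv k1] at hB hf
  rw [φ.right_inv l1] at hB' hf'
  rw [hgz] at hB'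
  have hBB := hB'.unique hB
  set K := (B.symm : E3 →L[ℝ] E3).comp (fderiv ℝ (modelEdge α) q) with hK
  have hKinj : Function.Injective K := by
    rw [hK, ContinuousLinearMap.coe_comp]
    exact B.symm.injective.comp ((fderiv_modelEdge_injective_iff hα).2 hq1)
  have hn : ∀ w, inner ℝ (K w) (ν (φ.symm q)) = 0 := by
    intro w
    have := (hW _ k2).2 (A.symm w)
    rw [hf.fderiv] at this
    simpa [hK] using this
  have hn' : ∀ w, inner ℝ (K w) (ν (φ.symm q')) = 0 := by
    intro w
    have := (hW _ l2).2 (A'.symm (squeeze (-1) w))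
    rw [hf'.fderiv, hBB] at this
    simpa [hK, hDD] using this
  have hfx : f (φ.symm q') = f (φ.symm q) := by
    rw [← h.target_symm_modelEdge hx, ← h.target_symm_modelEdge hx', φ.right_inv k1,
      φ.right_inv l1, hgz]
  have hνν : ν (φ.symm q') = ν (φ.symm q) := by
    rcases eq_or_eq_neg_of_orthogonal_range hKinj (hW _ k2).1 (hW _ l2).1 hn hn' with e | e
    · exact e
    · rw [e, inner_neg_right, real_inner_self_eq_norm_sq, (hW _ k2).1] at k0
      norm_num at k0
  have hxx := hinj l3 k3 (Prod.ext hfx hνν)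
  have hqq : q' = q := φ.symm.injOn l1 k1 hxx
  rw [hqq] at hq'1
  exact hq1 (by linarith)

/-- The linear part of a symmetry is diagonal in the frame of the tangent, conormal and normal
directions, and fixes the conormal direction. -/
theorem exists_symmetry_frame (h : EdgeChart r f U p φ Φ α) (hTp : T (f p) = f p)
    (hG : PreservesModel α (conjugate Φ T)) {ν : E2 → E3} (hν : IsUnitNormalNear r f p ν) :
    ∃ (τ e : E3) (c : ℝ), τ ≠ 0 ∧ tangentDirection f p = ℝ ∙ τ ∧ e ≠ 0 ∧
      inner ℝ τ e = 0 ∧ inner ℝ τ (ν p) = 0 ∧ inner ℝ e (ν p) = 0 ∧ (c = 1 ∨ c = -1) ∧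
      linearPart T τ = c • τ ∧ linearPart T e = e ∧
      (linearPart T (ν p) = ν p ∨ linearPart T (ν p) = -ν p) ∧
      (∀ y : E3, ∃ x₁ x₂ x₃ : ℝ, y = x₁ • τ + x₂ • e + x₃ • ν p) ∧
      fderiv ℝ (conjugate Φ T) 0 e3E3 = c • e3E3 := by
  obtain ⟨a, b, c, ha, hτ, hξ, hc⟩ := h.exists_linearPart_apply hTp hG
  obtain ⟨hnτ, hnξ⟩ := h.inner_normal_eq_zero hν
  have hn0 : ν p ≠ 0 := by
    obtain ⟨W, -, hpW, -, hW⟩ := hν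
    rw [← norm_ne_zero_iff, (hW p hpW).1]; exact one_ne_zero
  obtain ⟨A, B, -, -, -, hB', -⟩ := h.exists_hasFDerivAt h.mem_source
  rw [h.map_p, modelEdge_zero] at hB'
  have hinj : Function.Injective (fderiv ℝ Φ.symm 0) := by
    rw [hB'.fderiv]; exact B.symm.injective
  have hτ0 : fderiv ℝ Φ.symm 0 e3E3 ≠ 0 := by
    intro h0
    have := hinj (h0.trans (map_zero _).symm)
    simpa [e3E3] using congrArg (fun x : E3 => x 2) this
  have hξτ : ∀ x : ℝ, fderiv ℝ Φ.symm 0 e1E3 ≠ x • fderiv ℝ Φ.symm 0 e3E3 := by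
    intro x h0
    rw [← map_smul] at h0
    simpa [e1E3, e3E3] using congrArg (fun y : E3 => y 0) (hinj h0)
  obtain ⟨hc1, e, he0, hτe, hen, hLe, hLn⟩ :=
    exists_adapted_frame hτ0 hξτ hn0 hnτ hnξ ha hτ hξ
  exact ⟨_, e, c, hτ0, h.tangentDirection_eq, he0, hτe, hnτ, hen, hc1, hτ, hLe, hLn,
    exists_combination_of_orthogonal hτ0 he0 hn0 hτe hnτ hen, hc⟩

end EdgeChart

/-! ### Assembly of the classification -/

theorem IsGeneralizedCuspidalEdgePoint.exists_edgeChart {r : WithTop ℕ∞} (hr : r = ∞ ∨ r = ω)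
    {U : Set E2} (hU : IsOpen U) {f : E2 → E3} (hf : ContDiffOn ℝ r f U) {p : E2} (hpU : p ∈ U)
    (hp : IsGeneralizedCuspidalEdgePoint r f p) : ∃ φ Φ α, EdgeChart r f U p φ Φ α := by
  obtain ⟨φ, Φ, α, h1, h2, h3, h4, h5, h6, h7⟩ := hp
  exact ⟨φ, Φ, α, hr, hU, hpU, hf, h1, h2, h3, h4, h5, h6, h7⟩

theorem ModelSymmetry.exists_factored {r : WithTop ℕ∞} {α : E2 → ℝ} {G : E3 → E3}
    (h : ModelSymmetry r α G) : ∃ m, FactoredSymmetry r α G m := by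
  obtain ⟨m, h1, h2, h3⟩ := h.exists_factor
  exact ⟨m, h, h1, h2, h3⟩

/-- A curve of singular points whose image is fixed lies in the limiting tangent plane, so the
limiting normal curvature vanishes. -/
theorem limitingNormalCurvature_eq_zero {r : WithTop ℕ∞} (hr : r = ∞ ∨ r = ω) {U : Set E2}
    {f : E2 → E3} {p : E2} (hf : ContDiffAt ℝ r f p) {γ : ℝ → E2}
    (hγ : IsSingularCurve r f U p γ) {ν : E2 → E3}
    (h : ∀ᶠ x in 𝓝 p, x ∈ singularSet f U → inner ℝ (f x - f p) (ν p) = 0) :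
    limitingNormalCurvature f γ ν = 0 := by
  obtain ⟨ε, hε, hγ0, hγc, -, hγs, -⟩ := hγ
  have hI : Ioo (-ε) ε ∈ 𝓝 (0 : ℝ) := Ioo_mem_nhds (by linarith) hε
  have hγc0 : ContDiffAt ℝ r γ 0 := hγc.contDiffAt hI
  have hγt : Tendsto γ (𝓝 0) (𝓝 p) := by simpa [hγ0] using hγc0.continuousAt.tendsto
  have hF : ContDiffAt ℝ 2 (f ∘ γ) 0 :=
    (ContDiffAt.comp (0 : ℝ) (by rwa [hγ0]) hγc0).of_le (two_le_of_infty_or_omega hr)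
  rw [limitingNormalCurvature, hγ0, inner_iteratedDeriv_two_eq_zero (k := inner ℝ (f p) (ν p)) hF,
    zero_div]
  filter_upwards [hI, hγt.eventually h] with t h1 h2
  have := h2 (hγs t h1).2
  rw [inner_sub_left] at this
  exact sub_eq_zero.1 this

theorem mainTheorem4
    (r : WithTop ℕ∞) (hr : r = ∞ ∨ r = ω)
    (U : Set E2) (hU : IsOpen U)
    (f : E2 → E3) (hf : ContDiffOn ℝ r f U)
    (p : E2) (hpU : p ∈ U) (hp : IsGeneralizedCuspidalEdgePoint r f p)
    (T : E3 ≃ᵢ E3) (hTp : T (f p) = f p) (hT : T ≠ IsometryEquiv.refl E3)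
    (hincl : ∀ N ∈ 𝓝 p, N ⊆ U → ∃ V ∈ 𝓝 p, V ⊆ U ∧ (fun q => T (f q)) '' V ⊆ f '' N) :
    (∃ ν, IsUnitNormalNear r f p ν) ∧
    (∃ γ, IsSingularCurve r f U p γ) ∧
    (r = ω ∨ LegendrianLiftInjectiveNear r f p → ∃ ψ, IsConnectingMap f U T p ψ) ∧
    ∀ (ν : E2 → E3) (γ : ℝ → E2), IsUnitNormalNear r f p ν → IsSingularCurve r f U p γ →
      (T = reflectionThrough (limitingTangentPlane f ν p) ∧
        (∃ N ∈ 𝓝 p, f '' (singularSet f U ∩ N) ⊆ limitingTangentPlane f ν p) ∧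
        limitingNormalCurvature f γ ν = 0) ∨
      ((T = reflectionThrough (normalPlane f p) ∨ T = halfTurnAbout (conormalLine f ν p)) ∧
        ∀ ψ : OpenPartialHomeomorph E2 E2, IsConnectingMap f U T p ψ →
          IsInvolutionNear r ψ ψ.source p ∧ ReversesCurve ψ γ) := by
  obtain ⟨φ, Φ, α, h⟩ := hp.exists_edgeChart hr hU hf hpU
  have hP := h.preservesModel hTp hincl
  -- Involutivity follows from the signs in the frame alone, and is needed before any statement
  -- about the axis or the lifts.
  have hinv : ∀ x, T (T x) = x := by
    obtain ⟨ν, hν⟩ := h.exists_unitNormal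
    obtain ⟨τ, e, c, -, -, -, -, -, -, hc, hLτ, hLe, hLn, hspan, -⟩ :=
      h.exists_symmetry_frame hTp hP hν
    refine involutive_of_frame hTp hspan ?_
    rintro y (rfl | rfl | rfl)
    · rcases hc with rfl | rfl
      · left; rw [hLτ, one_smul]
      · right; rw [hLτ, neg_one_smul]
    · exact Or.inl hLe
    · exact hLn
  have hM := h.modelSymmetry hTp hP hinv
  obtain ⟨m, hG⟩ := hM.exists_factored
  refine ⟨h.exists_unitNormal, h.exists_singularCurve, ?_, ?_⟩
  · intro hcase
    have : ∃ s : ℝ, (s = 1 ∨ s = -1) ∧ ∀ᶠ q in 𝓝 0,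
        modelEdge α (modelLift α (conjugate Φ T) m s q) = conjugate Φ T (modelEdge α q) := by
      rcases hcase with rfl | hL
      · exact hG.exists_lift_of_analytic
      · exact hG.exists_lift_of_transverse (h.sheets_transverse hL)
    obtain ⟨s, hs, hedge⟩ := this
    exact h.exists_connectingMap hTp hG hs hedge
  · intro ν γ hν hγ
    obtain ⟨τ, e, c, hτ0, hdir, he0, hτe, hτn, hen, hc, hLτ, hLe, hLn, hspan, hGe⟩ :=
      h.exists_symmetry_frame hTp hP hν
    have heD : e ∈ (tangentDirection f p)ᗮ := by
      rw [hdir, Submodule.mem_orthogonal_singleton_iff_inner_right]; exact hτe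
    have hnD : ν p ∈ (tangentDirection f p)ᗮ := by
      rw [hdir, Submodule.mem_orthogonal_singleton_iff_inner_right]; exact hτn
    have hτD : τ ∈ tangentDirection f p := by
      rw [hdir]; exact Submodule.mem_span_singleton_self τ
    have hτN : τ ∈ (ℝ ∙ ν p)ᗮ := Submodule.mem_orthogonal_singleton_iff_inner_left.2 hτn
    have heN : e ∈ (ℝ ∙ ν p)ᗮ := Submodule.mem_orthogonal_singleton_iff_inner_left.2 hen
    have hnN : ν p ∈ (ℝ ∙ ν p)ᗮᗮ :=
      Submodule.le_orthogonal_orthogonal _ (Submodule.mem_span_singleton_self _)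
    have hτDD : τ ∈ (tangentDirection f p)ᗮᗮ := Submodule.le_orthogonal_orthogonal _ hτD
    -- The sign on the tangent direction separates the two cases. If it is 1, the normal must be
    -- reversed, since `T` is not the identity.
    rcases hc with rfl | rfl
    · left
      rw [one_smul] at hLτ hGe
      have hLn : linearPart T (ν p) = -ν p :=
        hLn.resolve_left fun hn => hT (eq_refl_of_frame hTp hspan hLτ hLe hn)
      -- The linear part fixes f x - f p and reverses ν p, so their inner product equals its own
      -- negative.
      have hplane : ∀ᶠ x in 𝓝 p, x ∈ singularSet f U → inner ℝ (f x - f p) (ν p) = 0 := by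
        filter_upwards [h.apply_eq_self_on_singularSet hTp hM hGe] with x hx hxs
        have h1 := hx hxs
        rw [apply_eq_linearPart T hTp, ← eq_sub_iff_add_eq] at h1
        have h2 := (linearPart T).inner_map_map (f x - f p) (ν p)
        rw [h1, hLn, inner_neg_right] at h2
        linarith
      refine ⟨?_, ⟨_, hplane, ?_⟩,
        limitingNormalCurvature_eq_zero hr (h.contDiffAt_f hpU) hγ hplane⟩
      · refine eq_reflection_of_frame hTp _ (AffineSubspace.self_mem_mk' _ _) hspan ?_
        simp only [limitingTangentPlane, AffineSubspace.direction_mk']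
        rintro y (rfl | rfl | rfl)
        · exact Or.inl ⟨hτN, hLτ⟩
        · exact Or.inl ⟨heN, hLe⟩
        · exact Or.inr ⟨hnN, hLn⟩
      · rintro _ ⟨x, ⟨hxs, hx⟩, rfl⟩
        simp only [limitingTangentPlane, SetLike.mem_coe, AffineSubspace.mem_mk', vsub_eq_sub]
        exact Submodule.mem_orthogonal_singleton_iff_inner_left.2 (hx hxs)
    · right
      have hLτ' : linearPart T τ = -τ := by rw [hLτ, neg_one_smul]
      refine ⟨?_, fun ψ hψ => ⟨h.isInvolutionNear_of_connectingMap hG hψ,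
        h.reversesCurve hG hGe hψ hγ⟩⟩
      rcases hLn with hLn | hLn
      · left
        refine eq_reflection_of_frame hTp _ (AffineSubspace.self_mem_mk' _ _) hspan ?_
        simp only [normalPlane, AffineSubspace.direction_mk']
        rintro y (rfl | rfl | rfl)
        · exact Or.inr ⟨hτDD, hLτ'⟩
        · exact Or.inl ⟨heD, hLe⟩
        · exact Or.inl ⟨hnD, hLn⟩
      · right
        refine eq_reflection_of_frame hTp _ (AffineSubspace.self_mem_mk' _ _) hspan ?_
        simp only [conormalLine, AffineSubspace.direction_mk']
        rintro y (rfl | rfl | rfl)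
        · exact Or.inr ⟨Submodule.orthogonal_le inf_le_right hτDD, hLτ'⟩
        · exact Or.inl ⟨⟨heN, heD⟩, hLe⟩
        · exact Or.inr ⟨Submodule.orthogonal_le inf_le_left hnN, hLn⟩
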